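/- Let $n\ge 1$ and $\alpha>-1$, and for $y>0$ let $$\mathcal K_{\alpha,y}(x)=\frac{\Gamma((\alpha+n+1)/2)}{\Gamma((\alpha+1)/2)\,\pi^{n/2}}\cdot\frac{y^{\alpha+1}}{(|x|^2+y^2)^{(\alpha+n+1)/2}},\qquad x\in\mathbb R^n .$$ Write $\hat f(\xi)=\int_{\mathbb R^n}e^{-i\langle x,\xi\rangle}f(x)\,dx$, extended to $L^2$ as usual. Let $J_\mu$ be the Bessel function of the first kind and $K_\mu$ the modified Bessel function $K_\mu=\frac{\pi}{2}\,\frac{I_{-\mu}-I_\mu}{\sin\mu\pi}$ (defined by the limit in the order when $\mu\in\mathbb Z$). Two tempered distributions $u,v$ on $\mathbb R^n$ are $\mathscr S'$-convolvable if $u(\check v*\varphi)\in\mathscr D'_{L^1}$ for every Schwartz function $\varphi$, where $\check v$ is the reflection of $v$ and $\mathscr D'_{L^1}$ is the dual of the space of smooth functions all of whose derivatives vanish at infinity; their $\mathscr S'$-convolution $u*v$ is then the tempered distribution given by $\langle u*v,\varphi\rangle=\langle u(\check v*\varphi),1\rangle$. For all $0<\eta<y$ there is a unique $\mathcal G_{\alpha,y}(\eta)$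 satisfying $$\mathcal K_{\alpha,y}=\mathcal G_{\alpha,y}(\eta)*\mathcal K_{\alpha,\eta}.$$ More precisely, there is a real-valued function $\mathcal G_{\alpha,y}(\eta)\in C^\infty(\mathbb R^n)\cap L^2(\mathbb R^n)$ for which this equation holds everywhere, with an absolutely convergent convolution integral; it also holds in the sense of the $\mathscr S'$-convolution, and $\mathcal G_{\alpha,y}(\eta)$ is the only tempered distribution that is $\mathscr S'$-convolvable with $\mathcal K_{\alpha,\eta}$ and solves the equation in this sense. Moreover: 1. For every $x\neq 0$, with an absolutely convergent integral, $$\mathcal G_{\alpha,y}(\eta)(x)=\frac{|x|^{(2-n)/2}}{(2\pi)^{n/2}}\left(\frac y\eta\right)^{(\alpha+1)/2}\int_0^\infty\frac{K_{(\alpha+1)/2}(ys)}{K_{(\alpha+1)/2}(\eta s)}\,s^{n/2}J_{(n-2)/2}(|x|s)\,ds .$$ 2. $\widehat{\mathcal K_{\alpha,\eta}}$ has no zeros, $K_{(\alpha+1)/2}(\eta|\xi|)\ne0$ for $\xi\neq0$, and the ($L^2$) Fourier transform of $\mathcal G_{\alpha,y}(\eta)$ is $$\widehat{\mathcal G_{\alpha,y}(\eta)}(\xi)=\frac{\widehat{\mathcal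 K_{\alpha,y}}(\xi)}{\widehat{\mathcal K_{\alpha,\eta}}(\xi)}=\left(\frac y\eta\right)^{(\alpha+1)/2}\frac{K_{(\alpha+1)/2}(y|\xi|)}{K_{(\alpha+1)/2}(\eta|\xi|)},\qquad \xi\ne0 .$$ 3. For $0<\eta_1<\eta_2<y$, $$\mathcal G_{\alpha,y}(\eta_1)=\mathcal G_{\alpha,y}(\eta_2)*\mathcal G_{\alpha,\eta_2}(\eta_1),$$ both pointwise, with an absolutely convergent convolution integral, and as an $\mathscr S'$-convolution. -/

import Mathlib

open Real MeasureTheory Filter Topology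
open scoped SchwartzMap ContDiff Convolution

noncomputable section

namespace GASP

/-- The boundary space `ℝⁿ` with its Euclidean norm. -/
abbrev Rn (n : ℕ) : Type := EuclideanSpace ℝ (Fin n)

/-- The kernel `𝒦_α(x, y)` of the upper half space, for `x ∈ ℝⁿ` and `y > 0`;
`poissonKernel n α y` is the function `𝒦_{α,y}` on `ℝⁿ`. -/
def poissonKernel (n : ℕ) (α y : ℝ) (x : Rn n) : ℝ :=
  Gamma ((α + n + 1) / 2) / (Gamma ((α + 1) / 2) * π ^ ((n : ℝ) / 2)) *
    (y ^ (α + 1) / (‖x‖ ^ 2 + y ^ 2) ^ ((α + n + 1) / 2))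

/-! ### Bessel functions of real order, at positive arguments -/

/-- The modified Bessel function `I_ν(z)`, `z > 0`. -/
def besselI (ν z : ℝ) : ℝ :=
  ∑' m : ℕ, (z / 2) ^ (ν + 2 * m) / (m.factorial * Gamma (ν + m + 1))

/-- `(π / 2) (I_{-ν}(z) - I_ν(z)) / sin (ν π)`, meaningful when `ν` is not an integer. -/
def besselKQuot (ν z : ℝ) : ℝ :=
  π / 2 * ((besselI (-ν) z - besselI ν z) / sin (ν * π))

open Classical in
/-- The modified Bessel function `K_ν(z)`, `z > 0`, of the third kind (Macdonald function); at
integer orders it is defined, as usual, by taking the limit in the order. -/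
def besselK (ν z : ℝ) : ℝ :=
  if sin (ν * π) = 0 then limUnder (𝓝[≠] ν) (fun μ => besselKQuot μ z) else besselKQuot ν z

/-- The Bessel function `J_ν(z)` of the first kind, `z > 0`. -/
def besselJ (ν z : ℝ) : ℝ :=
  ∑' m : ℕ, (-1) ^ m * (z / 2) ^ (ν + 2 * m) / (m.factorial * Gamma (ν + m + 1))

/-! ### Fourier transform with kernel `exp (-i ⟨x, ξ⟩)` -/

/-- The Fourier transform `ξ ↦ ∫ exp (-i ⟨x, ξ⟩) f(x) dx` of an integrable function. -/
def fourierInt {n : ℕ} (f : Rn n → ℂ) (ξ : Rn n) : ℂ :=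
  ∫ x, Complex.exp (-(Complex.I * ((inner ℝ x ξ : ℝ) : ℂ))) * f x

/-- The function `m ∈ L²` is the Fourier transform of the function `g ∈ L²`. -/
def HasFourierL2 {n : ℕ} (g m : Rn n → ℂ) : Prop :=
  MemLp g 2 volume ∧ MemLp m 2 volume ∧
    ∀ φ : 𝓢(Rn n, ℂ), ∫ x, g x * fourierInt φ x = ∫ ξ, m ξ * φ ξ

/-! ### The convolution of tempered distributions -/

/-- `u` belongs to the space `𝒟'_{L¹}` of integrable distributions, the dual of the space of smooth
functions all of whose derivatives vanish at infinity: since the Schwartz functions are dense in the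
latter, this says that `u` is continuous for the seminorms `sup |D^k φ|`. -/
def IsIntegrableDist {n : ℕ} (u : 𝓢'(Rn n, ℂ)) : Prop :=
  ∃ (N : ℕ) (C : ℝ), ∀ φ : 𝓢(Rn n, ℂ),
    ‖u φ‖ ≤ C * ∑ k ∈ Finset.range (N + 1), SchwartzMap.seminorm ℂ 0 k φ

/-- `c` is the integral `⟨u, 1⟩` of `u`: for every sequence of Schwartz functions which is bounded
together with each of its derivatives, and which converges to `1` in `C^∞` (all derivatives
converge locally uniformly), `u (φ_j)` converges to `c`. For `u` in `𝒟'_{L¹}` this is the value at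
`1` of the extension of `u` that is continuous on bounded sets of smooth functions with bounded
derivatives, with the topology of `C^∞`. -/
def HasDistIntegral {n : ℕ} (u : 𝓢'(Rn n, ℂ)) (c : ℂ) : Prop :=
  ∀ φ : ℕ → 𝓢(Rn n, ℂ),
    (∀ k : ℕ, ∃ C : ℝ, ∀ j, SchwartzMap.seminorm ℂ 0 k (φ j) ≤ C) →
    (∀ k : ℕ, TendstoLocallyUniformly (fun j x => iteratedFDeriv ℝ k (φ j) x)
      (iteratedFDeriv ℝ k (fun _ : Rn n => (1 : ℂ))) atTop) →
    Tendsto (fun j => u (φ j)) atTop (𝓝 c)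

/-- The smooth slowly growing function `v̌ ∗ φ : t ↦ ⟨v, φ(· + t)⟩`, where `v̌` is the reflection
of `v`. -/
def reflConv {n : ℕ} (v : 𝓢'(Rn n, ℂ)) (φ : 𝓢(Rn n, ℂ)) (t : Rn n) : ℂ :=
  v (SchwartzMap.compSubConstCLM ℂ (-t) φ)

/-- The tempered distributions `u` and `v` are `𝒮'`-convolvable, and `w` is their
`𝒮'`-convolution: for every Schwartz function `φ` the product `u (v̌ ∗ φ)` is in `𝒟'_{L¹}`, and its
integral is `⟨w, φ⟩`. -/
def IsSConv {n : ℕ} (u v w : 𝓢'(Rn n, ℂ)) : Prop :=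
  ∀ φ : 𝓢(Rn n, ℂ),
    IsIntegrableDist (TemperedDistribution.smulLeftCLM ℂ (reflConv v φ) u) ∧
    HasDistIntegral (TemperedDistribution.smulLeftCLM ℂ (reflConv v φ) u) (w φ)

open Classical in
/-- The tempered distribution `φ ↦ ∫ f φ` given by a real-valued function `f ∈ L²` (and `0` for other
functions). -/
def toDist {n : ℕ} (f : Rn n → ℝ) : 𝓢'(Rn n, ℂ) :=
  if h : MemLp (fun x => (f x : ℂ)) 2 volume then Lp.toTemperedDistribution (h.toLp _) else 0

theorem toDist_apply {n : ℕ} {f : Rn n → ℝ} (h : MemLp f 2 volume) (φ : 𝓢(Rn n, ℂ)) :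
    toDist f φ = ∫ x, φ x * (f x : ℂ) := by
  have h' : MemLp (fun x => (f x : ℂ)) 2 volume := h.ofReal
  rw [toDist, dif_pos h', Lp.toTemperedDistribution_apply]
  refine integral_congr_ae ?_
  filter_upwards [h'.coeFn_toLp] with x hx
  rw [hx, smul_eq_mul]

theorem memLp_poissonKernel (n : ℕ) {α y : ℝ} (hα : -1 < α) (hy : 0 < y) :
    MemLp (poissonKernel n α y) 2 volume := by
  have hn : (0 : ℝ) ≤ n := n.cast_nonneg
  have hpos : ∀ x : Rn n, 0 < ‖x‖ ^ 2 + y ^ 2 := fun x => by positivity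
  have hc : Continuous (poissonKernel n α y) := by
    unfold poissonKernel
    refine continuous_const.mul (continuous_const.div ?_ fun x => (rpow_pos_of_pos (hpos x) _).ne')
    exact Continuous.rpow_const (by fun_prop) fun x => Or.inl (hpos x).ne'
  rw [memLp_two_iff_integrable_sq hc.aestronglyMeasurable]
  set s : ℝ := (α + n + 1) / 2 with hs
  have hs0 : 0 < s := by rw [hs]; linarith
  set A : ℝ := Gamma s / (Gamma ((α + 1) / 2) * π ^ ((n : ℝ) / 2)) with hA
  set d : ℝ := min 1 (y ^ 2) with hd
  have hd0 : 0 < d := lt_min one_pos (by positivity)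
  have hI : Integrable (fun x : Rn n => (A * (y ^ (α + 1) / d ^ s)) ^ 2 *
      (1 + ‖x‖ ^ 2) ^ (-(2 * (α + n + 1)) / 2)) volume := by
    refine (integrable_rpow_neg_one_add_norm_sq ?_).const_mul _
    rw [finrank_euclideanSpace_fin]; linarith
  refine hI.mono' (hc.pow 2).aestronglyMeasurable (ae_of_all _ fun x => ?_)
  have h1 : (0 : ℝ) < 1 + ‖x‖ ^ 2 := by positivity
  have hle : d * (1 + ‖x‖ ^ 2) ≤ ‖x‖ ^ 2 + y ^ 2 := by
    have a := min_le_left 1 (y ^ 2)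
    have b := min_le_right 1 (y ^ 2)
    nlinarith [sq_nonneg ‖x‖]
  have e : (1 + ‖x‖ ^ 2) ^ (-(2 * (α + n + 1)) / 2) = (((1 + ‖x‖ ^ 2) ^ s) ^ 2)⁻¹ := by
    rw [← rpow_natCast ((1 + ‖x‖ ^ 2) ^ s) 2, ← rpow_mul h1.le, ← rpow_neg h1.le]
    congr 1; rw [hs]; push_cast; ring
  have hk : poissonKernel n α y x = A * (y ^ (α + 1) / (‖x‖ ^ 2 + y ^ 2) ^ s) := rfl
  rw [norm_eq_abs, abs_of_nonneg (sq_nonneg _), e, hk, ← inv_pow, ← mul_pow, sq_le_sq, mul_assoc,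
    abs_mul, abs_mul]
  have hy0 : 0 < y ^ (α + 1) := rpow_pos_of_pos hy _
  have hp1 := rpow_pos_of_pos (hpos x) s
  have hp2 := rpow_pos_of_pos h1 s
  have hp3 := rpow_pos_of_pos hd0 s
  refine mul_le_mul_of_nonneg_left ?_ (abs_nonneg _)
  rw [abs_of_pos (by positivity), abs_of_pos (by positivity), ← div_eq_mul_inv, div_div,
    ← mul_rpow hd0.le h1.le]
  exact div_le_div_of_nonneg_left hy0.le (rpow_pos_of_pos (by positivity) _)
    (rpow_le_rpow (by positivity) hle hs0.le)

end GASP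

end

/-! Write ν = (α + 1) / 2. The kernel is a superposition of Gaussians, so its Fourier transform is a
radial profile proportional to r ^ ν K_ν(r), written with the integral of u ^ (ν - 1) exp (-c (u + 1
/ u)) (`fourier_poissonKernel`, `besselK_eq_macInt`). This integral is positive and smooth in c > 0.
Since u + 1 / u ≥ 2, passing from c = a to c = b gains a factor exp (-2 (b - a))
(`macInt_le_exp_mul`). The quotient `poissonMult` of two transforms with a < b is therefore
continuous, even and exponentially decreasing. Its inverse transform `quotKernel` is real, smooth
and square integrable.

The convolution equation is the multiplication formula followed by Fourier inversion. The semigroup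
law is Parseval's identity applied to quotients that telescope. The Bessel integral is the Fourier
integral in polar coordinates. The transform of the sphere comes from the moments of a Gaussian
(`integral_exp_inner_mul_radial`). For continuous square integrable functions, the 𝒮'-convolution
reduces to the pointwise one by Fubini and dominated convergence (`isSConv_toDist`).

Uniqueness cannot be obtained by dividing by the transform of the kernel, as smoothness of that
transform is available only away from the origin. Let T be the inverse transform of the difference
of two solutions. Off the origin division is possible, so T is supported at 0
(`IsFourierOf.supportedAtZero`). The condition on T survives multiplication by linear forms, because
these become derivatives on the other side (`IsFourierOf.convolvesToZero_lineDerivOp`). It excludes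
nonzero multiples of the Dirac distribution, because the kernel has nonzero integral
(`IsFourierOf.eq_zero_of_dirac`). A nonzero distribution of finite order at 0 would become such a
multiple after enough multiplications, so T = 0 (`eq_zero_of_supportedAtZero`). -/

namespace GASP

/-! ### The Macdonald function as an integral -/

/-- The integrand of `macInt`. -/
noncomputable def macKer (ν c u : ℝ) : ℝ := u ^ (ν - 1) * exp (-(c * (u + u⁻¹)))

/-- The integral `∫₀^∞ u ^ (ν - 1) exp (- c (u + 1 / u)) du`, which is `2 K_ν(2 c)`. -/
noncomputable def macInt (ν c : ℝ) : ℝ := ∫ u in Set.Ioi (0 : ℝ), macKer ν c u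

theorem macKer_pos (ν c : ℝ) {u : ℝ} (hu : 0 < u) : 0 < macKer ν c u :=
  mul_pos (rpow_pos_of_pos hu _) (exp_pos _)

theorem continuousOn_macKer (ν c : ℝ) : ContinuousOn (macKer ν c) (Set.Ioi 0) := by
  intro u hu
  have hu : u ≠ 0 := ne_of_gt hu
  refine ContinuousAt.continuousWithinAt ?_
  unfold macKer
  exact (continuousAt_id.rpow_const (Or.inl hu)).mul
    (((continuousAt_id.add (continuousAt_inv₀ hu)).const_mul c).neg.rexp)

theorem aestronglyMeasurable_macKer (ν c : ℝ) :
    AEStronglyMeasurable (macKer ν c) (volume.restrict (Set.Ioi 0)) :=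
  (continuousOn_macKer ν c).aestronglyMeasurable measurableSet_Ioi

theorem exp_neg_div_le (k : ℕ) {c u : ℝ} (hc : 0 < c) (hu : 0 < u) :
    exp (-(c * u⁻¹)) ≤ k.factorial / c ^ k * u ^ k := by
  have hx : 0 < c * u⁻¹ := by positivity
  have h := Real.pow_div_factorial_le_exp (c * u⁻¹) hx.le k
  rw [exp_neg]
  refine (inv_anti₀ (by positivity) h).trans (le_of_eq ?_)
  rw [inv_div, mul_pow, inv_pow]
  field_simp

theorem integrableOn_macKer (ν : ℝ) {c : ℝ} (hc : 0 < c) :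
    IntegrableOn (macKer ν c) (Set.Ioi 0) := by
  -- The factor exp (-c / u) is traded for u ^ k, with k so large that u ^ (ν + k - 1) is integrable
  -- at zero.
  obtain ⟨k, hk⟩ := exists_nat_gt (-ν)
  have h := (integrableOn_rpow_mul_exp_neg_mul_rpow (s := ν + k - 1) (p := 1) (b := c)
    (by linarith) one_pos hc).const_mul (k.factorial / c ^ k)
  refine Integrable.mono' h (aestronglyMeasurable_macKer ν c) ?_
  filter_upwards [ae_restrict_mem measurableSet_Ioi] with u hu
  have hu : 0 < u := hu
  rw [norm_of_nonneg (macKer_pos ν c hu).le, macKer, mul_add, neg_add, exp_add, rpow_one,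
    show ν + k - 1 = (ν - 1) + k by ring, rpow_add hu, rpow_natCast]
  have := exp_neg_div_le k hc hu
  have h1 : 0 < u ^ (ν - 1) := rpow_pos_of_pos hu _
  have h2 := exp_pos (-(c * u))
  calc u ^ (ν - 1) * (exp (-(c * u)) * exp (-(c * u⁻¹)))
      ≤ u ^ (ν - 1) * (exp (-(c * u)) * (k.factorial / c ^ k * u ^ k)) := by gcongr
    _ = _ := by rw [neg_mul]; ring

theorem macInt_pos (ν : ℝ) {c : ℝ} (hc : 0 < c) : 0 < macInt ν c := by
  rw [macInt, setIntegral_pos_iff_support_of_nonneg_ae _ (integrableOn_macKer ν hc)]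
  · have : Set.Ioi (0 : ℝ) ⊆ Function.support (macKer ν c) ∩ Set.Ioi 0 :=
      fun u hu => ⟨(macKer_pos ν c hu).ne', hu⟩
    exact lt_of_lt_of_le (by simp) (measure_mono this)
  · filter_upwards [ae_restrict_mem measurableSet_Ioi] with u hu
    exact (macKer_pos ν c hu).le

theorem two_le_add_inv {u : ℝ} (hu : 0 < u) : 2 ≤ u + u⁻¹ := by
  have : u * u⁻¹ = 1 := mul_inv_cancel₀ hu.ne'
  nlinarith [sq_nonneg (u - 1), inv_pos.2 hu]

/-- The integrands differ by exp (-(b - a)(u + 1 / u)), which is at most exp (-2 (b - a)). All decay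
of the multiplier comes from this factor. -/
theorem macInt_le_exp_mul (ν : ℝ) {a b : ℝ} (ha : 0 < a) (hab : a ≤ b) :
    macInt ν b ≤ exp (-(2 * (b - a))) * macInt ν a := by
  rw [macInt, macInt, ← integral_const_mul]
  refine setIntegral_mono_on (integrableOn_macKer ν (ha.trans_le hab))
    ((integrableOn_macKer ν ha).const_mul _) measurableSet_Ioi fun u hu => ?_
  have hu : 0 < u := hu
  have h1 : 0 < u ^ (ν - 1) := rpow_pos_of_pos hu _
  rw [macKer, macKer, mul_left_comm, ← exp_add]
  gcongr
  nlinarith [two_le_add_inv hu]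

/-- Differentiation brings down -(u + 1 / u), which moves the order up and down by one. The kernels
at c / 2 dominate near c. -/
theorem hasDerivAt_macInt (ν : ℝ) {c : ℝ} (hc : 0 < c) :
    HasDerivAt (macInt ν) (-(macInt (ν + 1) c + macInt (ν - 1) c)) c := by
  have key : ∀ c' u : ℝ, 0 < u →
      -(u + u⁻¹) * macKer ν c' u = -(macKer (ν + 1) c' u + macKer (ν - 1) c' u) := by
    intro c' u hu
    rw [macKer, macKer, macKer, show ν + 1 - 1 = (ν - 1) + 1 by ring, rpow_add hu, rpow_one,
      rpow_sub_one hu.ne' (ν - 1)]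
    ring
  have h2 : 0 < c / 2 := half_pos hc
  have hI := ((integrableOn_macKer (ν + 1) h2).add (integrableOn_macKer (ν - 1) h2))
  have := (hasDerivAt_integral_of_dominated_loc_of_deriv_le (μ := volume.restrict (Set.Ioi (0 : ℝ)))
    (F := fun c u => macKer ν c u) (F' := fun c u => -(macKer (ν + 1) c u + macKer (ν - 1) c u))
    (bound := fun u => macKer (ν + 1) (c / 2) u + macKer (ν - 1) (c / 2) u)
    (Ioi_mem_nhds (show c / 2 < c by linarith))
    (Eventually.of_forall fun c => aestronglyMeasurable_macKer ν c)
    (integrableOn_macKer ν hc)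
    ((aestronglyMeasurable_macKer _ c).add (aestronglyMeasurable_macKer _ c)).neg ?_ hI ?_).2
  · rw [integral_neg, integral_add (integrableOn_macKer _ hc) (integrableOn_macKer _ hc)] at this
    exact this
  · filter_upwards [ae_restrict_mem measurableSet_Ioi] with u hu c' hc'
    have hu : 0 < u := hu
    have hc' : c / 2 < c' := hc'
    have hmono : ∀ μ : ℝ, macKer μ c' u ≤ macKer μ (c / 2) u := fun μ => by
      have h1 : 0 < u ^ (μ - 1) := rpow_pos_of_pos hu _
      unfold macKer
      gcongr
    rw [norm_neg, norm_of_nonneg (add_pos (macKer_pos _ _ hu) (macKer_pos _ _ hu)).le]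
    exact add_le_add (hmono _) (hmono _)
  · filter_upwards [ae_restrict_mem measurableSet_Ioi] with u hu c' hc'
    rw [← key c' u hu]
    have h := (((hasDerivAt_id c').mul_const (u + u⁻¹)).neg.exp).const_mul (u ^ (ν - 1))
    refine h.congr_deriv ?_
    simp only [macKer, id, Pi.neg_apply]
    ring

/-- The derivative is again a combination of such integrals, so the induction treats all orders ν at
once. -/
theorem contDiffOn_macInt (ν : ℝ) : ContDiffOn ℝ ∞ (macInt ν) (Set.Ioi 0) := by
  rw [contDiffOn_infty]
  intro k
  induction k generalizing ν with
  | zero =>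
    exact contDiffOn_zero.2 fun c hc => (hasDerivAt_macInt ν hc).continuousAt.continuousWithinAt
  | succ k ih =>
    rw [Nat.cast_succ, contDiffOn_succ_iff_deriv_of_isOpen isOpen_Ioi]
    refine ⟨fun c hc => (hasDerivAt_macInt ν hc).differentiableAt.differentiableWithinAt,
      by simp, ?_⟩
    exact ((ih (ν + 1)).add (ih (ν - 1))).neg.congr fun c hc => (hasDerivAt_macInt ν hc).deriv

/-- Needed at integer orders, where `besselK` is a limit in the order. The orders ν + 1 and ν - 1
dominate on u ≥ 1 and u ≤ 1 respectively. -/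
theorem continuous_macInt_order {c : ℝ} (hc : 0 < c) : Continuous fun ν => macInt ν c := by
  rw [continuous_iff_continuousAt]
  intro ν
  refine continuousAt_of_dominated
    (bound := fun u => macKer (ν + 1) c u + macKer (ν - 1) c u)
    (Eventually.of_forall fun μ => aestronglyMeasurable_macKer μ c) ?_
    ((integrableOn_macKer _ hc).add (integrableOn_macKer _ hc)) ?_
  · filter_upwards [Ioo_mem_nhds (show ν - 1 < ν by linarith) (show ν < ν + 1 by linarith)] with μ hμ
    filter_upwards [ae_restrict_mem measurableSet_Ioi] with u hu
    have hu : 0 < u := hu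
    rw [norm_of_nonneg (macKer_pos _ _ hu).le]
    rcases le_total 1 u with h1 | h1
    · have : macKer μ c u ≤ macKer (ν + 1) c u :=
        mul_le_mul_of_nonneg_right (rpow_le_rpow_of_exponent_le h1 (by linarith [hμ.2]))
          (exp_pos _).le
      linarith [macKer_pos (ν - 1) c hu]
    · have : macKer μ c u ≤ macKer (ν - 1) c u :=
        mul_le_mul_of_nonneg_right (rpow_le_rpow_of_exponent_ge hu h1 (by linarith [hμ.1]))
          (exp_pos _).le
      linarith [macKer_pos (ν + 1) c hu]
  · filter_upwards [ae_restrict_mem measurableSet_Ioi] with u hu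
    have hu : 0 < u := hu
    unfold macKer
    exact ((continuousAt_const.rpow (continuousAt_id.sub continuousAt_const) (Or.inl hu.ne')).mul
      continuousAt_const)

end GASP

/-! ### The Macdonald function: from the power series to the integral -/

namespace GASP

theorem hasSum_of_eq {ι : Type*} {f g : ι → ℝ} {a b : ℝ} (h : HasSum g b) (hf : ∀ i, f i = g i)
    (ha : a = b) : HasSum f a := by
  rwa [funext hf, ha]

/-- The upper incomplete Gamma integral `∫₁^∞ u ^ (s - 1) exp (- c u) du`. -/
noncomputable def upperGamma (c s : ℝ) : ℝ := ∫ u in Set.Ioi (1 : ℝ), u ^ (s - 1) * exp (-(c * u))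

theorem integrableOn_rpow_mul_exp_Ioi_one (s : ℝ) {c : ℝ} (hc : 0 < c) :
    IntegrableOn (fun u : ℝ => u ^ (s - 1) * exp (-(c * u))) (Set.Ioi 1) := by
  have h := (integrableOn_rpow_mul_exp_neg_mul_rpow (s := |s|) (p := 1) (b := c)
    (by linarith [abs_nonneg s]) one_pos hc).mono_set
      (Set.Ioi_subset_Ioi (zero_le_one' ℝ))
  refine Integrable.mono' h ?_ ?_
  · refine ContinuousOn.aestronglyMeasurable (fun u hu => ?_) measurableSet_Ioi
    have hu : u ≠ 0 := (zero_lt_one.trans hu).ne'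
    exact ((continuousAt_id.rpow_const (Or.inl hu)).mul
      ((continuousAt_id.const_mul c).neg.rexp)).continuousWithinAt
  · filter_upwards [ae_restrict_mem measurableSet_Ioi] with u hu
    have hu1 : (1 : ℝ) < u := hu
    have hu0 : 0 < u := zero_lt_one.trans hu
    have h1 : 0 < u ^ (s - 1) := rpow_pos_of_pos hu0 _
    rw [norm_of_nonneg (by positivity), rpow_one, neg_mul]
    gcongr
    · exact hu1.le
    · linarith [le_abs_self s]

/-- Integration by parts. Together with Γ(s + 1) = s Γ(s), this extends the series below from s + 1
to s. -/
theorem upperGamma_add_one (s : ℝ) {c : ℝ} (hc : 0 < c) :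
    c * upperGamma c (s + 1) = exp (-c) + s * upperGamma c s := by
  have hI := integrableOn_rpow_mul_exp_Ioi_one s hc
  have hI' := integrableOn_rpow_mul_exp_Ioi_one (s + 1) hc
  have h := integral_Ioi_of_hasDerivAt_of_tendsto' (a := (1 : ℝ)) (m := 0)
    (f := fun u : ℝ => u ^ s * exp (-(c * u)))
    (f' := fun u => s * (u ^ (s - 1) * exp (-(c * u))) - c * (u ^ (s + 1 - 1) * exp (-(c * u))))
    (fun u hu => ?_) ((hI.const_mul s).sub (hI'.const_mul c)) ?_
  · rw [integral_sub (hI.const_mul s) (hI'.const_mul c), integral_const_mul,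
      integral_const_mul] at h
    simp only [one_rpow, mul_one, one_mul] at h
    rw [upperGamma, upperGamma]
    linarith
  · have hu0 : u ≠ 0 := (zero_lt_one.trans_le hu).ne'
    have h1 := (hasDerivAt_id u).rpow_const (p := s) (Or.inl hu0)
    have h2 := ((hasDerivAt_id u).const_mul c).neg.exp
    refine (h1.mul h2).congr_deriv ?_
    simp only [id, Pi.neg_apply, add_sub_cancel_right]
    ring
  · refine (tendsto_rpow_mul_exp_neg_mul_atTop_nhds_zero s c hc).congr fun u => ?_
    rw [neg_mul]

/-- The right side is the integral over (0, 1], where the exponential is expanded and integrated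
term by term. -/
theorem hasSum_upperGamma_of_pos {s c : ℝ} (hs : 0 < s) (hc : 0 < c) :
    HasSum (fun j : ℕ => (-c) ^ j / (j.factorial * (s + j)))
      (Gamma s * c ^ (-s) - upperGamma c s) := by
  have hI0 : IntegrableOn (fun u : ℝ => u ^ (s - 1) * exp (-(c * u))) (Set.Ioi 0) := by
    have := integrableOn_rpow_mul_exp_neg_mul_rpow (s := s - 1) (p := 1) (b := c)
      (by linarith) one_pos hc
    simpa only [rpow_one, neg_mul] using this
  have hsplit : Gamma s * c ^ (-s) - upperGamma c s
      = ∫ u in Set.Ioc (0 : ℝ) 1, u ^ (s - 1) * exp (-(c * u)) := by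
    have h1 := Real.integral_rpow_mul_exp_neg_mul_Ioi hs hc
    rw [← Set.Ioc_union_Ioi_eq_Ioi (zero_le_one' ℝ),
      setIntegral_union (Set.Ioc_disjoint_Ioi le_rfl) measurableSet_Ioi
        (hI0.mono_set Set.Ioc_subset_Ioi_self) (integrableOn_rpow_mul_exp_Ioi_one s hc)] at h1
    rw [upperGamma, rpow_neg hc.le, ← inv_rpow hc.le, ← one_div, mul_comm, ← h1]
    ring
  have hint : ∀ j : ℕ, IntervalIntegrable (fun u : ℝ => u ^ (s - 1 + j)) volume 0 1 := fun j =>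
    intervalIntegral.intervalIntegrable_rpow' (by have := j.cast_nonneg (α := ℝ); linarith)
  have hval : ∀ j : ℕ, ∫ u in Set.Ioc (0 : ℝ) 1, u ^ (s - 1 + j) = 1 / (s + j) := fun j => by
    have hj := j.cast_nonneg (α := ℝ)
    rw [← intervalIntegral.integral_of_le zero_le_one, integral_rpow (Or.inl (by linarith)),
      one_rpow, zero_rpow (by linarith), sub_zero, show s - 1 + j + 1 = s + j by ring]
  have hF : ∀ j : ℕ, ∀ u ∈ Set.Ioc (0 : ℝ) 1, u ^ (s - 1) * ((-(c * u)) ^ j / j.factorial)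
      = (-c) ^ j / j.factorial * u ^ (s - 1 + j) := fun j u hu => by
    rw [rpow_add hu.1, rpow_natCast, ← neg_mul, mul_pow]; ring
  have hFi : ∀ j : ℕ, IntegrableOn (fun u : ℝ => u ^ (s - 1) * ((-(c * u)) ^ j / j.factorial))
      (Set.Ioc 0 1) := fun j => by
    refine (integrableOn_congr_fun (hF j) measurableSet_Ioc).2 ?_
    exact ((intervalIntegrable_iff_integrableOn_Ioc_of_le zero_le_one).1 (hint j)).const_mul _
  have hS := hasSum_integral_of_summable_integral_norm (μ := volume.restrict (Set.Ioc (0 : ℝ) 1))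
    (F := fun (j : ℕ) (u : ℝ) => u ^ (s - 1) * ((-(c * u)) ^ j / j.factorial)) hFi ?_
  · rw [hsplit]
    refine hasSum_of_eq hS (fun j => ?_) ?_
    · rw [setIntegral_congr_fun measurableSet_Ioc (hF j), integral_const_mul, hval, div_mul_div_comm,
        mul_one]
    · refine setIntegral_congr_fun measurableSet_Ioc fun u hu => ?_
      rw [tsum_mul_left, Real.exp_eq_exp_ℝ, NormedSpace.exp_eq_tsum_div]
  · refine Summable.of_nonneg_of_le (fun j => by positivity) (fun j => ?_)
      ((Real.summable_pow_div_factorial c).mul_right (1 / s))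
    have : ∀ u ∈ Set.Ioc (0 : ℝ) 1, ‖u ^ (s - 1) * ((-(c * u)) ^ j / j.factorial)‖
        = c ^ j / j.factorial * u ^ (s - 1 + j) := fun u hu => by
      have : 0 < u ^ (s - 1 + j) := rpow_pos_of_pos hu.1 _
      rw [hF j u hu, norm_mul, norm_div, norm_pow, norm_neg, norm_of_nonneg hc.le,
        norm_of_nonneg this.le, norm_of_nonneg (by positivity : (0 : ℝ) ≤ j.factorial)]
    rw [setIntegral_congr_fun measurableSet_Ioc this, integral_const_mul, hval]
    have hj := j.cast_nonneg (α := ℝ)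
    gcongr
    linarith

theorem hasSum_upperGamma {s c : ℝ} (hs : ∀ j : ℕ, s + j ≠ 0) (hc : 0 < c) :
    HasSum (fun j : ℕ => (-c) ^ j / (j.factorial * (s + j)))
      (Gamma s * c ^ (-s) - upperGamma c s) := by
  obtain ⟨N, hN⟩ := exists_nat_gt (-s)
  induction N generalizing s with
  | zero => exact hasSum_upperGamma_of_pos (by simpa using hN) hc
  | succ N ih =>
    have hs0 : s ≠ 0 := by simpa using hs 0
    have h1 := ih (s := s + 1) (fun j => by have := hs (j + 1); push_cast at this; rwa [add_assoc,
      add_comm 1]) (by push_cast at hN; linarith)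
    -- By 1 / (s + j) = (1 - j / (s + j)) / s, the series for s is the exponential series minus this
    -- one, divided by s. The term j = 0 vanishes here, and the rest is the series for s + 1 with
    -- its index shifted.
    have h2 : HasSum (fun j : ℕ => (j : ℝ) * ((-c) ^ j / (j.factorial * (s + j))))
        (-c * (Gamma (s + 1) * c ^ (-(s + 1)) - upperGamma c (s + 1))) := by
      rw [← hasSum_nat_add_iff' 1]
      simp only [Finset.range_one, Finset.sum_singleton, Nat.cast_zero, zero_mul, sub_zero]
      refine hasSum_of_eq (h1.mul_left (-c)) (fun j => ?_) rfl
      have hj : s + 1 + j ≠ 0 := by have := hs (j + 1); push_cast at this; rwa [add_assoc,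
        add_comm 1]
      have hj' : s + (j + 1 : ℕ) ≠ 0 := hs (j + 1)
      rw [Nat.factorial_succ]
      push_cast at hj' ⊢
      have : (j : ℝ) + 1 ≠ 0 := by positivity
      rw [pow_succ]
      rw [show s + 1 + (j : ℝ) = s + (j + 1) by ring]
      field_simp
    have h3 : HasSum (fun j : ℕ => (-c) ^ j / (j.factorial : ℝ)) (exp (-c)) := by
      rw [Real.exp_eq_exp_ℝ]
      exact NormedSpace.expSeries_div_hasSum_exp (-c)
    have h4 := (h3.sub h2).div_const s
    refine hasSum_of_eq h4 (fun j => ?_) ?_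
    · have := hs j
      field_simp
      ring
    · rw [mul_sub, neg_mul c (upperGamma _ _), upperGamma_add_one s hc, Gamma_add_one hs0, neg_add,
        rpow_add hc, rpow_neg_one]
      field_simp
      ring

/-- Integer shifts do not change |sin (ν π)|, and |sin t| ≤ |t|. This bounds the denominators of the
double series uniformly away from zero. -/
theorem exists_pos_le_abs_add_int {ν : ℝ} (hν : sin (ν * π) ≠ 0) :
    ∃ d : ℝ, 0 < d ∧ ∀ z : ℤ, d ≤ |ν + z| := by
  refine ⟨|sin (ν * π)| / π, by positivity, fun z => ?_⟩
  rw [div_le_iff₀ pi_pos, ← abs_of_pos pi_pos, ← abs_mul, abs_of_pos pi_pos]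
  have h : |sin (ν * π)| = |sin ((ν + z) * π)| := by
    rw [add_mul, sin_add_int_mul_pi, abs_mul]
    simp
  rw [h]
  exact abs_sin_le_abs

/-- The half of `macInt` over `(1, ∞)` as a series. -/
theorem hasSum_setIntegral_macKer (ν : ℝ) {c : ℝ} (hc : 0 < c) :
    HasSum (fun k : ℕ => (-c) ^ k / k.factorial * upperGamma c (ν - k))
      (∫ u in Set.Ioi (1 : ℝ), macKer ν c u) := by
  have hF : ∀ k : ℕ, ∀ u ∈ Set.Ioi (1 : ℝ),
      u ^ (ν - 1) * exp (-(c * u)) * ((-(c * u⁻¹)) ^ k / k.factorial)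
      = (-c) ^ k / k.factorial * (u ^ (ν - k - 1) * exp (-(c * u))) := fun k u hu => by
    have hu0 : 0 < u := zero_lt_one.trans hu
    rw [show ν - k - 1 = (ν - 1) + (-k) by ring, rpow_add hu0, rpow_neg hu0.le, rpow_natCast,
      ← neg_mul c u⁻¹, mul_pow, inv_pow]
    ring
  have hI := fun k : ℕ => integrableOn_rpow_mul_exp_Ioi_one (ν - k) hc
  have hS := hasSum_integral_of_summable_integral_norm (μ := volume.restrict (Set.Ioi (1 : ℝ)))
    (F := fun (k : ℕ) (u : ℝ) => u ^ (ν - 1) * exp (-(c * u)) * ((-(c * u⁻¹)) ^ k / k.factorial))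
    (fun k => (integrableOn_congr_fun (hF k) measurableSet_Ioi).2 ((hI k).const_mul _)) ?_
  · refine hasSum_of_eq hS (fun k => ?_) ?_
    · rw [setIntegral_congr_fun measurableSet_Ioi (hF k), integral_const_mul, upperGamma]
    · refine setIntegral_congr_fun measurableSet_Ioi fun u hu => ?_
      have : ∑' k : ℕ, (-(c * u⁻¹)) ^ k / (k.factorial : ℝ) = exp (-(c * u⁻¹)) := by
        rw [Real.exp_eq_exp_ℝ]
        exact (NormedSpace.expSeries_div_hasSum_exp _).tsum_eq
      rw [tsum_mul_left, this, mul_assoc, ← exp_add, macKer]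
      ring_nf
  · refine Summable.of_nonneg_of_le (fun j => by positivity) (fun k => ?_)
      ((Real.summable_pow_div_factorial c).mul_right (upperGamma c ν))
    rw [upperGamma, ← integral_const_mul]
    refine setIntegral_mono_on ?_ ((integrableOn_rpow_mul_exp_Ioi_one ν hc).const_mul _)
      measurableSet_Ioi fun u hu => ?_
    · exact ((integrableOn_congr_fun (hF k) measurableSet_Ioi).2 ((hI k).const_mul _)).norm
    · have hu1 : (1 : ℝ) < u := hu
      have hu0 : 0 < u := zero_lt_one.trans hu1
      have h1 : 0 < u ^ (ν - k - 1) := rpow_pos_of_pos hu0 _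
      rw [hF k u hu, norm_mul, norm_div, norm_pow, norm_neg, norm_of_nonneg hc.le,
        norm_of_nonneg (by positivity : (0 : ℝ) ≤ k.factorial), norm_of_nonneg (by positivity)]
      gcongr
      · exact hu1.le
      · have := k.cast_nonneg (α := ℝ); linarith

/-- The substitution u ↦ 1 / u preserves u + 1 / u and turns the part over (0, 1] into the part over
(1, ∞) with order -ν. -/
theorem macInt_eq_add (ν : ℝ) {c : ℝ} (hc : 0 < c) :
    macInt ν c = (∫ u in Set.Ioi (1 : ℝ), macKer (-ν) c u) + ∫ u in Set.Ioi (1 : ℝ), macKer ν c u := by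
  have hI := integrableOn_macKer ν hc
  have h1 := integral_comp_rpow_Ioi ((Set.Ici (1 : ℝ)).indicator (macKer (-ν) c))
    (neg_ne_zero.2 (one_ne_zero' ℝ))
  have h2 : ∀ x ∈ Set.Ioi (0 : ℝ), (|(-1 : ℝ)| * x ^ ((-1 : ℝ) - 1)) •
      (Set.Ici (1 : ℝ)).indicator (macKer (-ν) c) (x ^ (-1 : ℝ))
      = (Set.Ioc (0 : ℝ) 1).indicator (macKer ν c) x := by
    intro x hx
    have hx : 0 < x := hx
    rw [rpow_neg_one]
    by_cases h : x ≤ 1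
    · rw [Set.indicator_of_mem (show x⁻¹ ∈ Set.Ici (1 : ℝ) from (one_le_inv₀ hx).2 h),
        Set.indicator_of_mem (show x ∈ Set.Ioc (0 : ℝ) 1 from ⟨hx, h⟩), macKer, macKer, smul_eq_mul,
        inv_inv, abs_neg, abs_one, one_mul, ← mul_assoc, inv_rpow hx.le, ← rpow_neg hx.le,
        ← rpow_add hx, add_comm x⁻¹ x]
      congr 2
      ring
    · rw [Set.indicator_of_notMem (show x⁻¹ ∉ Set.Ici (1 : ℝ) from
          fun h' => h ((one_le_inv₀ hx).1 h')),
        Set.indicator_of_notMem (fun h' => h h'.2), smul_zero]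
  rw [setIntegral_congr_fun measurableSet_Ioi h2, setIntegral_indicator measurableSet_Ioc,
    setIntegral_indicator measurableSet_Ici,
    Set.inter_eq_right.2 (show Set.Ioc (0 : ℝ) 1 ⊆ Set.Ioi 0 from Set.Ioc_subset_Ioi_self),
    Set.inter_eq_right.2 (show Set.Ici (1 : ℝ) ⊆ Set.Ioi 0 from
      Set.Ici_subset_Ioi.2 zero_lt_one), integral_Ici_eq_integral_Ioi] at h1
  rw [macInt, ← Set.Ioc_union_Ioi_eq_Ioi (zero_le_one' ℝ),
    setIntegral_union (Set.Ioc_disjoint_Ioi le_rfl) measurableSet_Ioi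
      (hI.mono_set Set.Ioc_subset_Ioi_self)
      (hI.mono_set (Set.Ioi_subset_Ioi zero_le_one)), h1]

/-- The terms of the double series produced by expanding both exponentials. -/
noncomputable def macDouble (c ν : ℝ) (p : ℕ × ℕ) : ℝ :=
  (-c) ^ p.1 / p.1.factorial * ((-c) ^ p.2 / (p.2.factorial * (ν - p.1 + p.2)))

theorem summable_macDouble {c ν : ℝ} (hc : 0 < c) (hν : sin (ν * π) ≠ 0) :
    Summable (macDouble c ν) := by
  obtain ⟨d, hd, h⟩ := exists_pos_le_abs_add_int hν
  have hs := Real.summable_pow_div_factorial c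
  refine Summable.of_norm_bounded
    ((hs.mul_of_nonneg hs (fun k => by positivity) (fun k => by positivity)).mul_right d⁻¹)
    fun p => ?_
  have h1 : d ≤ |ν - p.1 + p.2| := by
    have := h (-p.1 + p.2)
    push_cast at this
    rwa [show ν - (p.1 : ℝ) + p.2 = ν + (-p.1 + p.2) by ring]
  rw [macDouble, norm_mul, norm_div, norm_div, norm_mul, norm_pow, norm_pow, norm_neg,
    norm_of_nonneg hc.le, norm_eq_abs (ν - p.1 + p.2), RCLike.norm_natCast, RCLike.norm_natCast,
    mul_assoc, ← div_div, div_eq_mul_inv _ |_|]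
  gcongr

/-- Exchanging the two indices negates the denominator when ν changes sign. This antisymmetry
cancels the double series in the difference of the two functions I. -/
theorem tsum_macDouble_neg (c ν : ℝ) :
    ∑' p, macDouble c (-ν) p = -∑' p, macDouble c ν p := by
  rw [← (Equiv.prodComm ℕ ℕ).tsum_eq, ← tsum_neg]
  congr 1
  funext p
  simp only [macDouble, Equiv.prodComm_apply, Prod.fst_swap, Prod.snd_swap]
  rw [show -ν - (p.2 : ℝ) + p.1 = -(ν - p.1 + p.2) by ring, mul_neg, div_neg,
    ← div_div, ← div_div]
  ring

/-- Summing over j for fixed k gives Γ(ν - k) minus an upper incomplete Gamma integral, up to powers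
and factorials. The reflection formula turns Γ(ν - k) into the coefficient of I_{-ν}, and the
incomplete integrals add up to the half integral. -/
theorem hasSum_besselI_neg {c ν : ℝ} (hc : 0 < c) (hν : sin (ν * π) ≠ 0) :
    π / sin (ν * π) * besselI (-ν) (2 * c)
      = (∫ u in Set.Ioi (1 : ℝ), macKer ν c u) + ∑' p, macDouble c ν p := by
  obtain ⟨d, hd, h⟩ := exists_pos_le_abs_add_int hν
  have hne : ∀ z : ℤ, ν + z ≠ 0 := fun z => by
    have := hd.trans_le (h z)
    exact abs_pos.1 this
  have h1 : ∀ k : ℕ, HasSum (fun j => macDouble c ν (k, j))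
      ((-c) ^ k / k.factorial * (Gamma (ν - k) * c ^ (-(ν - k)) - upperGamma c (ν - k))) :=
    fun k => (hasSum_upperGamma (s := ν - k) (fun j => by
      have := hne (-k + j)
      push_cast at this
      rwa [show ν - (k : ℝ) + j = ν + (-k + j) by ring]) hc).mul_left _
  have h2 := (summable_macDouble hc hν).hasSum.prod_fiberwise h1
  have h3 := ((hasSum_setIntegral_macKer ν hc).add h2).tsum_eq
  rw [← h3, besselI, ← tsum_mul_left]
  congr 1
  funext k
  have hG := Real.Gamma_mul_Gamma_one_sub (ν - k)
  rw [mul_comm π, sub_mul, sin_sub_nat_mul_pi] at hG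
  have hΓ : Gamma (1 - (ν - k)) ≠ 0 := Real.Gamma_ne_zero fun m => by
    have := hne (-(1 + k + m))
    push_cast at this
    contrapose! this
    linarith
  rw [show -ν + k + 1 = 1 - (ν - k) by ring]
  have hG' : Gamma (ν - k) = π / ((-1) ^ k * sin (ν * π)) / Gamma (1 - (ν - k)) := by
    rw [eq_div_iff hΓ, hG]
  rw [hG', show 2 * c / 2 = c by ring, show -ν + 2 * k = -(ν - k) + k by ring,
    rpow_add hc _ (k : ℝ), rpow_natCast, neg_pow c]
  have : ((-1 : ℝ) ^ k) ≠ 0 := by simp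
  field_simp
  ring

theorem besselKQuot_eq {c ν : ℝ} (hc : 0 < c) (hν : sin (ν * π) ≠ 0) :
    besselKQuot ν (2 * c) = macInt ν c / 2 := by
  have hν' : sin (-ν * π) ≠ 0 := by rwa [neg_mul, sin_neg, neg_ne_zero]
  have h1 := hasSum_besselI_neg hc hν
  have h2 := hasSum_besselI_neg hc hν'
  rw [tsum_macDouble_neg, neg_neg, neg_mul, sin_neg, div_neg] at h2
  have h3 := macInt_eq_add ν hc
  rw [besselKQuot, h3]
  have : π / 2 * ((besselI (-ν) (2 * c) - besselI ν (2 * c)) / sin (ν * π))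
      = (π / sin (ν * π) * besselI (-ν) (2 * c) + -(π / sin (ν * π)) * besselI ν (2 * c)) / 2 := by
    ring
  rw [this, h1, h2]
  ring

/-- At an integer order the formula holds at all nearby other orders, none of which is an integer,
and continuity in the order gives the limit. -/
theorem besselK_eq_macInt {c : ℝ} (hc : 0 < c) (ν : ℝ) : besselK ν (2 * c) = macInt ν c / 2 := by
  rw [besselK]
  split_ifs with h
  · refine Tendsto.limUnder_eq ?_
    have h1 : Tendsto (fun μ => macInt μ c / 2) (𝓝[≠] ν) (𝓝 (macInt ν c / 2)) :=
      (((continuous_macInt_order hc).div_const 2).tendsto ν).mono_left nhdsWithin_le_nhds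
    refine h1.congr' ?_
    obtain ⟨z, hz⟩ := sin_eq_zero_iff.1 h
    have hz : (z : ℝ) = ν := mul_right_cancel₀ pi_ne_zero hz
    filter_upwards [self_mem_nhdsWithin, mem_nhdsWithin_of_mem_nhds
      (Ioo_mem_nhds (show ν - 1 < ν by linarith) (show ν < ν + 1 by linarith))] with μ hμ1 hμ2
    refine (besselKQuot_eq hc fun h0 => hμ1 ?_).symm
    obtain ⟨w, hw⟩ := sin_eq_zero_iff.1 h0
    have hw : (w : ℝ) = μ := mul_right_cancel₀ pi_ne_zero hw
    rw [← hz, ← hw] at hμ2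
    have a : z - 1 < w := by exact_mod_cast hμ2.1
    have b : w < z + 1 := by exact_mod_cast hμ2.2
    rw [Set.mem_singleton_iff, ← hz, ← hw, show w = z by omega]
  · exact besselKQuot_eq hc h

end GASP

namespace GASP

open FourierTransform

/-! ### The Fourier transform of the Poisson kernel -/

theorem fourierInt_eq_fourier {n : ℕ} (f : Rn n → ℂ) (ξ : Rn n) :
    fourierInt f ξ = 𝓕 f ((2 * π)⁻¹ • ξ) := by
  rw [fourierInt, Real.fourier_eq']
  refine integral_congr_ae (Eventually.of_forall fun x => ?_)
  simp only [smul_eq_mul]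
  congr 2
  rw [inner_smul_right, show -2 * π * ((2 * π)⁻¹ * inner ℝ x ξ) = -inner ℝ x ξ by
    field_simp]
  push_cast
  ring

theorem continuous_poissonKernel (n : ℕ) (α : ℝ) {y : ℝ} (hy : 0 < y) :
    Continuous (poissonKernel n α y) := by
  have hpos : ∀ x : Rn n, 0 < ‖x‖ ^ 2 + y ^ 2 := fun x => by positivity
  unfold poissonKernel
  refine continuous_const.mul (continuous_const.div ?_ fun x => (rpow_pos_of_pos (hpos x) _).ne')
  exact Continuous.rpow_const (by fun_prop) fun x => Or.inl (hpos x).ne'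

theorem poissonKernel_neg (n : ℕ) (α y : ℝ) (x : Rn n) :
    poissonKernel n α y (-x) = poissonKernel n α y x := by
  rw [poissonKernel, norm_neg, poissonKernel]

/-- The Poisson kernel is a superposition of Gaussians. -/
theorem poissonKernel_eq_integral (n : ℕ) {α y : ℝ} (hα : -1 < α) (hy : 0 < y) (x : Rn n) :
    poissonKernel n α y x = y ^ (α + 1) / (Gamma ((α + 1) / 2) * π ^ ((n : ℝ) / 2)) *
      ∫ t in Set.Ioi (0 : ℝ), t ^ ((α + n + 1) / 2 - 1) * exp (-(y ^ 2 * t)) *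
        exp (-(t * ‖x‖ ^ 2)) := by
  have hn : (0 : ℝ) ≤ n := n.cast_nonneg
  have hs : 0 < (α + n + 1) / 2 := by linarith
  have hp : 0 < ‖x‖ ^ 2 + y ^ 2 := by positivity
  have h := Real.integral_rpow_mul_exp_neg_mul_Ioi hs hp
  have h' : ∫ t in Set.Ioi (0 : ℝ), t ^ ((α + n + 1) / 2 - 1) * exp (-(y ^ 2 * t)) *
        exp (-(t * ‖x‖ ^ 2)) = (1 / (‖x‖ ^ 2 + y ^ 2)) ^ ((α + n + 1) / 2) *
          Gamma ((α + n + 1) / 2) := by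
    rw [← h]
    refine integral_congr_ae (Eventually.of_forall fun t => ?_)
    simp only
    rw [mul_assoc, ← exp_add]
    ring_nf
  have hr := rpow_pos_of_pos hp ((α + n + 1) / 2)
  rw [h', poissonKernel, one_div, inv_rpow hp.le]
  field_simp

theorem integrableOn_rpow_mul_exp {s c : ℝ} (hs : 0 < s) (hc : 0 < c) :
    IntegrableOn (fun t : ℝ => t ^ (s - 1) * exp (-(c * t))) (Set.Ioi 0) := by
  have := integrableOn_rpow_mul_exp_neg_mul_rpow (s := s - 1) (p := 1) (b := c)
    (by linarith) one_pos hc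
  simpa only [rpow_one, neg_mul] using this

/-- Integrating in x first gives (π / t) ^ (n / 2), which leaves t ^ ((α + 1) / 2 - 1) at zero; this
is integrable because α > -1. -/
theorem integrable_gaussian_superposition (n : ℕ) {α y : ℝ} (hα : -1 < α) (hy : 0 < y) :
    Integrable (fun p : Rn n × ℝ => p.2 ^ ((α + n + 1) / 2 - 1) * exp (-(y ^ 2 * p.2)) *
      exp (-(p.2 * ‖p.1‖ ^ 2))) (volume.prod (volume.restrict (Set.Ioi 0))) := by
  have hm : AEStronglyMeasurable (fun p : Rn n × ℝ => p.2 ^ ((α + n + 1) / 2 - 1) *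
      exp (-(y ^ 2 * p.2)) * exp (-(p.2 * ‖p.1‖ ^ 2)))
      (volume.prod (volume.restrict (Set.Ioi 0))) := by
    refine Measurable.aestronglyMeasurable ?_
    fun_prop
  have hG : ∀ t : ℝ, 0 < t → Integrable (fun x : Rn n => exp (-(t * ‖x‖ ^ 2))) ∧
      ∫ x : Rn n, exp (-(t * ‖x‖ ^ 2)) = (π / t) ^ ((n : ℝ) / 2) := fun t ht => by
    have h := GaussianFourier.integral_rexp_neg_mul_sq_norm (V := Rn n) ht
    rw [finrank_euclideanSpace_fin] at h
    simp only [neg_mul] at h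
    exact ⟨Integrable.of_integral_ne_zero (by rw [h]; positivity), h⟩
  refine (integrable_prod_iff' hm).2 ⟨?_, ?_⟩
  · filter_upwards [ae_restrict_mem measurableSet_Ioi] with t ht
    exact (hG t ht).1.const_mul _
  · have h := (integrableOn_rpow_mul_exp (s := (α + 1) / 2) (c := y ^ 2) (by linarith)
      (by positivity)).const_mul (π ^ ((n : ℝ) / 2))
    refine h.congr ?_
    filter_upwards [ae_restrict_mem measurableSet_Ioi] with t ht
    have ht : 0 < t := ht
    have h1 := rpow_pos_of_pos ht ((α + n + 1) / 2 - 1)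
    have : ∀ x : Rn n, ‖t ^ ((α + n + 1) / 2 - 1) * exp (-(y ^ 2 * t)) * exp (-(t * ‖x‖ ^ 2))‖
        = t ^ ((α + n + 1) / 2 - 1) * exp (-(y ^ 2 * t)) * exp (-(t * ‖x‖ ^ 2)) := fun x =>
      norm_of_nonneg (by positivity)
    simp only [this]
    rw [integral_const_mul, (hG t ht).2, div_rpow pi_pos.le ht.le, show (α + n + 1) / 2 - 1
      = ((α + 1) / 2 - 1) + n / 2 by ring, rpow_add ht]
    have h2 := rpow_pos_of_pos ht ((n : ℝ) / 2)
    field_simp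

theorem integrable_poissonKernel (n : ℕ) {α y : ℝ} (hα : -1 < α) (hy : 0 < y) :
    Integrable (poissonKernel n α y) := by
  have h := ((integrable_gaussian_superposition n hα hy).integral_prod_left).const_mul
    (y ^ (α + 1) / (Gamma ((α + 1) / 2) * π ^ ((n : ℝ) / 2)))
  exact h.congr (Eventually.of_forall fun x => (poissonKernel_eq_integral n hα hy x).symm)

theorem fourier_poissonKernel_eq_integral (n : ℕ) {α y : ℝ} (hα : -1 < α) (hy : 0 < y)
    (v : Rn n) :
    𝓕 (fun x => (poissonKernel n α y x : ℂ)) v = ((y ^ (α + 1) / Gamma ((α + 1) / 2) *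
      ∫ t in Set.Ioi (0 : ℝ), t ^ ((α + 1) / 2 - 1) * exp (-(y ^ 2 * t)) *
        exp (-(π ^ 2 * ‖v‖ ^ 2 / t)) : ℝ) : ℂ) := by
  set B : ℝ := y ^ (α + 1) / (Gamma ((α + 1) / 2) * π ^ ((n : ℝ) / 2)) with hB
  set w : ℝ → ℝ := fun t => t ^ ((α + n + 1) / 2 - 1) * exp (-(y ^ 2 * t)) with hw
  set e : Rn n → ℂ := fun x => Complex.exp (((-2 * π * inner ℝ x v : ℝ) : ℂ) * Complex.I) with he
  have he1 : ∀ x, ‖e x‖ = 1 := fun x => Complex.norm_exp_ofReal_mul_I _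
  have hec : Continuous e := by fun_prop
  have hI : Integrable (fun p : Rn n × ℝ => e p.1 * ((w p.2 * exp (-(p.2 * ‖p.1‖ ^ 2)) : ℝ) : ℂ))
      (volume.prod (volume.restrict (Set.Ioi 0))) := by
    refine (integrable_gaussian_superposition n hα hy).ofReal.bdd_mul (c := 1)
      (hec.comp continuous_fst).aestronglyMeasurable (Eventually.of_forall fun p => (he1 p.1).le)
  have h1 : 𝓕 (fun x => (poissonKernel n α y x : ℂ)) v = B * ∫ x, ∫ t in Set.Ioi (0 : ℝ),
      e x * ((w t * exp (-(t * ‖x‖ ^ 2)) : ℝ) : ℂ) := by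
    rw [Real.fourier_eq', ← integral_const_mul]
    refine integral_congr_ae (Eventually.of_forall fun x => ?_)
    simp only [smul_eq_mul]
    rw [integral_const_mul, integral_complex_ofReal, show (poissonKernel n α y x : ℂ) = B *
      ((∫ t in Set.Ioi (0 : ℝ), w t * exp (-(t * ‖x‖ ^ 2)) : ℝ) : ℂ) by
        rw [poissonKernel_eq_integral n hα hy x, Complex.ofReal_mul]]
    exact mul_left_comm _ _ _
  rw [h1, integral_integral_swap hI]
  have h2 : ∀ t ∈ Set.Ioi (0 : ℝ), ∫ x, e x * ((w t * exp (-(t * ‖x‖ ^ 2)) : ℝ) : ℂ)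
      = ((π ^ ((n : ℝ) / 2) * (t ^ ((α + 1) / 2 - 1) * exp (-(y ^ 2 * t)) *
        exp (-(π ^ 2 * ‖v‖ ^ 2 / t))) : ℝ) : ℂ) := by
    intro t ht
    have ht : 0 < t := ht
    have hg := fourier_gaussian_innerProductSpace (b := (t : ℂ)) (by simpa using ht) v
    rw [Real.fourier_eq', finrank_euclideanSpace_fin] at hg
    have h3 : ∫ x, e x * ((w t * exp (-(t * ‖x‖ ^ 2)) : ℝ) : ℂ)
        = w t * ∫ x, e x • Complex.exp (-(t : ℂ) * ‖x‖ ^ 2) := by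
      rw [← integral_const_mul]
      refine integral_congr_ae (Eventually.of_forall fun x => ?_)
      simp only [smul_eq_mul]
      push_cast
      ring_nf
    rw [h3, hg]
    have h4 : ((π : ℂ) / t) ^ ((n : ℂ) / 2) = (((π / t) ^ ((n : ℝ) / 2) : ℝ) : ℂ) := by
      rw [Complex.ofReal_cpow (by positivity)]
      push_cast
      rfl
    have h5 : Complex.exp (-(π : ℂ) ^ 2 * (‖v‖ : ℂ) ^ 2 / t)
        = ((exp (-(π ^ 2 * ‖v‖ ^ 2 / t)) : ℝ) : ℂ) := by
      push_cast
      congr 1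
      ring
    rw [h4, h5, ← Complex.ofReal_mul, ← Complex.ofReal_mul]
    congr 1
    rw [hw]
    simp only
    rw [div_rpow pi_pos.le ht.le, show (α + n + 1) / 2 - 1
      = ((α + 1) / 2 - 1) + n / 2 by ring, rpow_add ht]
    have h2 := rpow_pos_of_pos ht ((n : ℝ) / 2)
    field_simp
  rw [setIntegral_congr_fun measurableSet_Ioi h2, integral_complex_ofReal, integral_const_mul,
    ← Complex.ofReal_mul]
  congr 1
  rw [hB]
  have h2 := rpow_pos_of_pos pi_pos ((n : ℝ) / 2)
  field_simp

/-- The profile of the Fourier transform of the Poisson kernel: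
`r ^ ν / Γ(ν) ∫₀^∞ u ^ (ν - 1) exp (- r (u + 1 / u)) du`, extended by its limit `1` at `0`. -/
noncomputable def poissonProfile (ν r : ℝ) : ℝ := if r = 0 then 1 else r ^ ν / Gamma ν * macInt ν r

theorem fourier_poissonKernel (n : ℕ) {α y : ℝ} (hα : -1 < α) (hy : 0 < y) (v : Rn n) :
    𝓕 (fun x => (poissonKernel n α y x : ℂ)) v
      = (poissonProfile ((α + 1) / 2) (y * (π * ‖v‖)) : ℂ) := by
  have hν : 0 < (α + 1) / 2 := by linarith
  have hΓ := Real.Gamma_pos_of_pos hν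
  rw [fourier_poissonKernel_eq_integral n hα hy]
  congr 1
  have hyy : y ^ (α + 1) = (y * y) ^ ((α + 1) / 2) := by
    rw [mul_rpow hy.le hy.le, ← rpow_add hy, add_halves]
  rcases eq_or_ne v 0 with rfl | hv
  · have h := Real.integral_rpow_mul_exp_neg_mul_Ioi hν (show 0 < y ^ 2 by positivity)
    simp only [norm_zero, mul_zero, poissonProfile, if_true, ne_eq, OfNat.ofNat_ne_zero,
      not_false_eq_true, zero_pow, zero_div, neg_zero, exp_zero, mul_one]
    rw [h, one_div, inv_rpow (by positivity), hyy, pow_two]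
    have := rpow_pos_of_pos (show 0 < y * y by positivity) ((α + 1) / 2)
    field_simp
  · have hv' : 0 < ‖v‖ := norm_pos_iff.2 hv
    -- The substitution t = (π ‖v‖ / y) u balances the exponents: y² t and π² ‖v‖² / t become y π
    -- ‖v‖ times u and 1 / u.
    have hb : 0 < π * ‖v‖ / y := by positivity
    have hr : y * (π * ‖v‖) ≠ 0 := by positivity
    have h := integral_comp_mul_left_Ioi (fun t : ℝ => t ^ ((α + 1) / 2 - 1) * exp (-(y ^ 2 * t)) *
        exp (-(π ^ 2 * ‖v‖ ^ 2 / t))) 0 hb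
    rw [mul_zero, smul_eq_mul, eq_inv_mul_iff_mul_eq₀ hb.ne'] at h
    rw [← h, poissonProfile, if_neg hr, macInt]
    have h2 : ∀ u ∈ Set.Ioi (0 : ℝ), (π * ‖v‖ / y * u) ^ ((α + 1) / 2 - 1) *
        exp (-(y ^ 2 * (π * ‖v‖ / y * u))) * exp (-(π ^ 2 * ‖v‖ ^ 2 / (π * ‖v‖ / y * u)))
        = (π * ‖v‖ / y) ^ ((α + 1) / 2 - 1) * macKer ((α + 1) / 2) (y * (π * ‖v‖)) u := by
      intro u hu
      have hu : 0 < u := hu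
      rw [macKer, mul_rpow hb.le hu.le, mul_assoc, mul_assoc, mul_assoc, ← exp_add]
      congr 4
      field_simp
      ring
    rw [setIntegral_congr_fun measurableSet_Ioi h2, integral_const_mul, ← mul_assoc, ← mul_assoc,
      hyy, mul_comm (_ / _) (π * ‖v‖ / y), rpow_sub_one hb.ne']
    congr 1
    have : (y * (π * ‖v‖)) ^ ((α + 1) / 2) = (y * y) ^ ((α + 1) / 2) *
        (π * ‖v‖ / y) ^ ((α + 1) / 2) := by
      rw [← mul_rpow (by positivity) hb.le]
      congr 1
      field_simp
    rw [this]
    field_simp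

theorem poissonProfile_pos {ν r : ℝ} (hν : 0 < ν) (hr : 0 ≤ r) : 0 < poissonProfile ν r := by
  rw [poissonProfile]
  split_ifs with h
  · exact one_pos
  · have hr : 0 < r := lt_of_le_of_ne hr (Ne.symm h)
    have := macInt_pos ν hr
    have := Real.Gamma_pos_of_pos hν
    have := rpow_pos_of_pos hr ν
    positivity

theorem poissonProfile_le {ν r a b : ℝ} (hν : 0 < ν) (hr : 0 ≤ r) (ha : 0 < a) (hab : a ≤ b) :
    poissonProfile ν (b * r) ≤ (b / a) ^ ν * exp (-(2 * (b - a)) * r) *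
      poissonProfile ν (a * r) := by
  have hb : 0 < b := ha.trans_le hab
  rcases hr.eq_or_lt with rfl | hr
  · simp only [mul_zero, poissonProfile, if_true, exp_zero, mul_one]
    exact one_le_rpow ((one_le_div ha).2 hab) hν.le
  · have hΓ := Real.Gamma_pos_of_pos hν
    rw [poissonProfile, poissonProfile, if_neg (by positivity), if_neg (by positivity),
      mul_rpow hb.le hr.le, mul_rpow ha.le hr.le, div_rpow hb.le ha.le]
    have h := macInt_le_exp_mul ν (mul_pos ha hr) (mul_le_mul_of_nonneg_right hab hr.le)
    have h1 := rpow_pos_of_pos ha ν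
    have h2 := rpow_pos_of_pos hb ν
    have h3 := rpow_pos_of_pos hr ν
    calc b ^ ν * r ^ ν / Gamma ν * macInt ν (b * r)
        ≤ b ^ ν * r ^ ν / Gamma ν * (exp (-(2 * (b * r - a * r))) * macInt ν (a * r)) := by gcongr
      _ = _ := by
        rw [show -(2 * (b * r - a * r)) = -(2 * (b - a)) * r by ring]
        field_simp

theorem contDiffOn_poissonProfile (ν : ℝ) : ContDiffOn ℝ ∞ (poissonProfile ν) (Set.Ioi 0) := by
  have h : ContDiffOn ℝ ∞ (fun r : ℝ => r ^ ν / Gamma ν * macInt ν r) (Set.Ioi 0) :=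
    (((contDiffOn_id).rpow_const_of_ne fun r hr => (ne_of_gt hr)).div_const _).mul
      (contDiffOn_macInt ν)
  exact h.congr fun r hr => if_neg (ne_of_gt hr)

/-- The halves come from `besselK` being evaluated at 2 c. The factors depending on r alone cancel
in the quotient. -/
theorem poissonProfile_div (ν : ℝ) {a b r : ℝ} (hν : 0 < ν) (ha : 0 < a) (hb : 0 < b)
    (hr : 0 < r) : poissonProfile ν (b * (r / 2)) / poissonProfile ν (a * (r / 2))
      = (b / a) ^ ν * (besselK ν (b * r) / besselK ν (a * r)) := by
  have h : ∀ c : ℝ, 0 < c → poissonProfile ν (c * (r / 2))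
      = c ^ ν * ((r / 2) ^ ν / Gamma ν * 2) * besselK ν (c * r) := fun c hc => by
    have hcr : 0 < c * (r / 2) := by positivity
    rw [show c * r = 2 * (c * (r / 2)) by ring, besselK_eq_macInt hcr, poissonProfile,
      if_neg hcr.ne', mul_rpow hc.le (by positivity)]
    ring
  have h3 : (r / 2) ^ ν / Gamma ν * 2 ≠ 0 := by
    have := rpow_pos_of_pos (half_pos hr) ν
    have := Real.Gamma_pos_of_pos hν
    positivity
  have h1 := (rpow_pos_of_pos ha ν).ne'
  rw [h b hb, h a ha, div_rpow hb.le ha.le, mul_div_mul_comm, mul_div_mul_right _ _ h3]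

theorem besselK_pos (ν : ℝ) {z : ℝ} (hz : 0 < z) : 0 < besselK ν z := by
  have h := besselK_eq_macInt (half_pos hz) ν
  rw [show 2 * (z / 2) = z by ring] at h
  rw [h]
  exact half_pos (macInt_pos ν (half_pos hz))

end GASP

namespace GASP

/-! ### Polar coordinates -/

section Polar

variable {E F : Type*} [NormedAddCommGroup E] [NormedSpace ℝ E] [MeasurableSpace E] [BorelSpace E]
  [FiniteDimensional ℝ E] [NormedAddCommGroup F]

theorem integrable_sphere_prod (μ : Measure E) [μ.IsAddHaarMeasure] {g : E → F}
    (hg : Integrable g μ) :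
    Integrable (fun p : Metric.sphere (0 : E) 1 × Set.Ioi (0 : ℝ) => g ((p.2 : ℝ) • (p.1 : E)))
      (μ.toSphere.prod (Measure.volumeIoiPow (Module.finrank ℝ E - 1))) := by
  have h := μ.measurePreserving_homeomorphUnitSphereProd.integrable_comp_emb
    (g := fun p : Metric.sphere (0 : E) 1 × Set.Ioi (0 : ℝ) => g ((p.2 : ℝ) • (p.1 : E)))
    (Homeomorph.measurableEmbedding _)
  rw [← h]
  have h1 : Integrable (g ∘ ((↑) : ({(0)}ᶜ : Set E) → E)) (μ.comap (↑)) :=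
    (integrableOn_iff_comap_subtypeVal (measurableSet_singleton _).compl).1 hg.integrableOn
  refine h1.congr (Eventually.of_forall fun x => ?_)
  have hx : ‖(x : E)‖ ≠ 0 := norm_ne_zero_iff.2 x.2
  simp [smul_smul, hx]

variable [NormedSpace ℝ F]

theorem integral_volumeIoiPow (k : ℕ) (G : ℝ → F) :
    ∫ r : Set.Ioi (0 : ℝ), G r ∂(Measure.volumeIoiPow k) = ∫ r in Set.Ioi (0 : ℝ), r ^ k • G r := by
  simp only [Measure.volumeIoiPow, ENNReal.ofReal]
  rw [integral_withDensity_eq_integral_smul,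
    integral_subtype_comap measurableSet_Ioi fun a ↦ Real.toNNReal (a ^ k) • G a,
    setIntegral_congr_fun measurableSet_Ioi fun x hx ↦ ?_]
  · rw [NNReal.smul_def, Real.coe_toNNReal _ (pow_nonneg hx.out.le _)]
  · exact (measurable_subtype_coe.pow_const _).real_toNNReal

theorem integrable_volumeIoiPow_iff (k : ℕ) (G : ℝ → F) :
    Integrable (fun r : Set.Ioi (0 : ℝ) => G r) (Measure.volumeIoiPow k) ↔
      IntegrableOn (fun r : ℝ => r ^ k • G r) (Set.Ioi 0) := by
  rw [integrableOn_iff_comap_subtypeVal measurableSet_Ioi, Function.comp_def, Measure.volumeIoiPow,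
    integrable_withDensity_iff_integrable_smul', integrable_congr]
  · refine .of_forall ?_
    rintro ⟨x, hx : 0 < x⟩
    simp (disch := positivity) [ENNReal.toReal_ofReal]
  · fun_prop
  · simp

theorem integral_eq_integral_sphere_prod [Nontrivial E] (μ : Measure E) [μ.IsAddHaarMeasure] (g : E → F) :
    ∫ x, g x ∂μ = ∫ p : Metric.sphere (0 : E) 1 × Set.Ioi (0 : ℝ), g ((p.2 : ℝ) • (p.1 : E))
      ∂(μ.toSphere.prod (Measure.volumeIoiPow (Module.finrank ℝ E - 1))) := by
  rw [← μ.measurePreserving_homeomorphUnitSphereProd.integral_comp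
        (Homeomorph.measurableEmbedding _)]
  have h1 := integral_subtype_comap (μ := μ) (measurableSet_singleton (0 : E)).compl g
  -- Removing the origin costs nothing, since it is a null set in a nontrivial space.
  rw [restrict_compl_singleton] at h1
  rw [← h1]
  refine integral_congr_ae (Eventually.of_forall fun x => ?_)
  have hx : ‖(x : E)‖ ≠ 0 := norm_ne_zero_iff.2 x.2
  simp [smul_smul, hx]

theorem integrableOn_polar (μ : Measure E) [μ.IsAddHaarMeasure] {g : E → F}
    (hg : Integrable g μ) :
    IntegrableOn (fun r : ℝ => r ^ (Module.finrank ℝ E - 1) •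
      ∫ θ : Metric.sphere (0 : E) 1, g (r • (θ : E)) ∂μ.toSphere) (Set.Ioi 0) := by
  rw [← integrable_volumeIoiPow_iff]
  exact (integrable_sphere_prod μ hg).integral_prod_right

theorem integral_polar [Nontrivial E] (μ : Measure E) [μ.IsAddHaarMeasure] {g : E → F} (hg : Integrable g μ) :
    ∫ x, g x ∂μ = ∫ r in Set.Ioi (0 : ℝ), r ^ (Module.finrank ℝ E - 1) •
      ∫ θ : Metric.sphere (0 : E) 1, g (r • (θ : E)) ∂μ.toSphere := by
  rw [← integral_volumeIoiPow, integral_eq_integral_sphere_prod,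
    integral_prod_symm _ (integrable_sphere_prod μ hg)]

end Polar

/-! ### The Fourier transform of the sphere -/

/-- Uniqueness of power series coefficients, used to read off the Gaussian moments from their
generating function. -/
theorem eq_of_hasSum_mul_pow {a b : ℕ → ℝ} {f : ℝ → ℝ}
    (ha : ∀ s, HasSum (fun k => a k * s ^ k) (f s))
    (hb : ∀ s, HasSum (fun k => b k * s ^ k) (f s)) : a = b := by
  have key : ∀ {c : ℕ → ℝ}, (∀ s, HasSum (fun k => c k * s ^ k) (f s)) →
      HasFPowerSeriesAt f (FormalMultilinearSeries.ofScalars ℝ c) 0 := fun {c} hc => by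
    rw [hasFPowerSeriesAt_iff]
    refine Eventually.of_forall fun s => ?_
    simpa [FormalMultilinearSeries.coeff_ofScalars, mul_comm] using hc s
  have h := (key ha).eq_formalMultilinearSeries (key hb)
  funext k
  have := congrArg (fun p => FormalMultilinearSeries.coeff p k) h
  simpa [FormalMultilinearSeries.coeff_ofScalars] using this

theorem integrable_exp_mul_norm_sub_sq (n : ℕ) (c : ℝ) :
    Integrable fun v : Rn n => exp (c * ‖v‖) * exp (-‖v‖ ^ 2) := by
  have h : Integrable fun v : Rn n => exp (-(1 / 2) * ‖v‖ ^ 2) :=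
    Integrable.of_integral_ne_zero (by
      rw [GaussianFourier.integral_rexp_neg_mul_sq_norm (by norm_num)]; positivity)
  refine (h.const_mul (exp (c ^ 2 / 2))).mono' (by fun_prop) (Eventually.of_forall fun v => ?_)
  rw [norm_of_nonneg (by positivity), ← exp_add, ← exp_add]
  refine exp_le_exp.2 ?_
  -- Completing the square: c r ≤ c² / 2 + r² / 2.
  nlinarith [sq_nonneg (c - ‖v‖)]

theorem norm_inner_pow_mul_exp_le {n : ℕ} (x v : Rn n) (k : ℕ) :
    ‖inner ℝ x v ^ k / k.factorial * exp (-‖v‖ ^ 2)‖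
      ≤ (‖x‖ * ‖v‖) ^ k / k.factorial * exp (-‖v‖ ^ 2) := by
  rw [norm_mul, norm_div, norm_pow, RCLike.norm_natCast, norm_of_nonneg (exp_pos _).le]
  gcongr
  exact norm_inner_le_norm x v

theorem integrable_inner_pow_mul_exp {n : ℕ} (x : Rn n) (k : ℕ) :
    Integrable fun v : Rn n => inner ℝ x v ^ k / k.factorial * exp (-‖v‖ ^ 2) := by
  refine (integrable_exp_mul_norm_sub_sq n ‖x‖).mono' (by fun_prop)
    (Eventually.of_forall fun v => (norm_inner_pow_mul_exp_le x v k).trans ?_)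
  gcongr
  exact Real.pow_div_factorial_le_exp _ (by positivity) k

/-- Gaussian moments of the linear form `⟨x, ·⟩`. -/
theorem integral_inner_pow_mul_exp {n : ℕ} (x : Rn n) :
    (fun k : ℕ => ∫ v : Rn n, inner ℝ x v ^ k / k.factorial * exp (-‖v‖ ^ 2))
      = Function.extend (fun m => 2 * m)
        (fun m : ℕ => π ^ ((n : ℝ) / 2) * ((‖x‖ / 2) ^ (2 * m) / m.factorial)) 0 := by
  -- The generating function is the integral of exp (s ⟨x, v⟩ - ‖v‖²), which is an explicit Gaussian
  -- in s; its odd coefficients vanish.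
  refine eq_of_hasSum_mul_pow (f := fun s => π ^ ((n : ℝ) / 2) * exp ((s * (‖x‖ / 2)) ^ 2))
    (fun s => ?_) (fun s => ?_)
  · have h1 : ∀ v : Rn n, HasSum (fun k : ℕ => inner ℝ (s • x) v ^ k / k.factorial
        * exp (-‖v‖ ^ 2)) (exp (inner ℝ (s • x) v) * exp (-‖v‖ ^ 2)) := fun v => by
      refine HasSum.mul_right _ ?_
      rw [Real.exp_eq_exp_ℝ]
      exact NormedSpace.expSeries_div_hasSum_exp _
    have h2 : ∀ v : Rn n, HasSum (fun k : ℕ => (‖s • x‖ * ‖v‖) ^ k / k.factorial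
        * exp (-‖v‖ ^ 2)) (exp (‖s • x‖ * ‖v‖) * exp (-‖v‖ ^ 2)) := fun v => by
      refine HasSum.mul_right _ ?_
      rw [Real.exp_eq_exp_ℝ]
      exact NormedSpace.expSeries_div_hasSum_exp _
    have h := hasSum_integral_of_dominated_convergence (μ := (volume : Measure (Rn n)))
      (fun (k : ℕ) (v : Rn n) => (‖s • x‖ * ‖v‖) ^ k / k.factorial * exp (-‖v‖ ^ 2))
      (fun k => (integrable_inner_pow_mul_exp (s • x) k).aestronglyMeasurable)
      (fun k => Eventually.of_forall fun v => norm_inner_pow_mul_exp_le (s • x) v k)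
      (Eventually.of_forall fun v => (h2 v).summable) ?_ (Eventually.of_forall h1)
    · refine hasSum_of_eq h (fun k => ?_) ?_
      · rw [← integral_mul_const]
        refine integral_congr_ae (Eventually.of_forall fun v => ?_)
        simp only [inner_smul_left, mul_pow, RCLike.conj_to_real]
        ring
      · have hg := GaussianFourier.integral_cexp_neg_mul_sq_norm_add (V := Rn n) (b := 1)
          (by simp) 1 (s • x)
        rw [finrank_euclideanSpace_fin] at hg
        have e1 : ∀ v : Rn n, Complex.exp (-1 * (‖v‖ : ℂ) ^ 2 + 1 * (inner ℝ (s • x) v : ℝ))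
            = ((exp (inner ℝ (s • x) v) * exp (-‖v‖ ^ 2) : ℝ) : ℂ) := fun v => by
          rw [← exp_add]
          push_cast
          ring_nf
        simp only [e1] at hg
        rw [integral_complex_ofReal] at hg
        apply Complex.ofReal_injective
        rw [hg, norm_smul, Complex.ofReal_mul, Complex.ofReal_cpow pi_pos.le]
        push_cast
        rw [div_one]
        congr 2
        rw [show (s * (‖x‖ / 2) : ℂ) ^ 2 = ((s ^ 2 * ‖x‖ ^ 2 / 4 : ℝ) : ℂ) by push_cast; ring,
          show (1 : ℂ) ^ 2 * ((‖s‖ : ℂ) * ‖x‖) ^ 2 / (4 * 1)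
            = ((‖s‖ ^ 2 * ‖x‖ ^ 2 / 4 : ℝ) : ℂ) by push_cast; ring, norm_eq_abs, sq_abs]
    · simp only [fun v => (h2 v).tsum_eq]
      exact integrable_exp_mul_norm_sub_sq n _
  · have hinj : Function.Injective fun m : ℕ => 2 * m := fun a b h => by simpa using h
    refine (hinj.hasSum_iff fun k hk => ?_).1 ?_
    · rw [Function.extend_apply' _ _ _ hk, Pi.zero_apply, zero_mul]
    · have h := NormedSpace.expSeries_div_hasSum_exp ((s * (‖x‖ / 2)) ^ 2)
      rw [← Real.exp_eq_exp_ℝ] at h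
      refine hasSum_of_eq (h.mul_left (π ^ ((n : ℝ) / 2))) (fun m => ?_) rfl
      simp only [Function.comp_apply, hinj.extend_apply]
      rw [← pow_mul, mul_pow]
      ring

/-- In polar coordinates a Gaussian moment is a spherical moment times a radial Gamma integral. No
integration over the sphere itself is ever needed. -/
theorem integral_sphere_inner_pow {n : ℕ} (hn : 1 ≤ n) (x : Rn n) (k : ℕ) :
    (∫ θ : Metric.sphere (0 : Rn n) 1, inner ℝ x (θ : Rn n) ^ k
        ∂(volume : Measure (Rn n)).toSphere) / k.factorial * (Gamma (((n : ℝ) + k) / 2) / 2)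
      = ∫ v : Rn n, inner ℝ x v ^ k / k.factorial * exp (-‖v‖ ^ 2) := by
  have : Nonempty (Fin n) := ⟨⟨0, hn⟩⟩
  rw [integral_polar volume (integrable_inner_pow_mul_exp x k), finrank_euclideanSpace_fin]
  have h1 : ∀ r ∈ Set.Ioi (0 : ℝ), r ^ (n - 1) • ∫ θ : Metric.sphere (0 : Rn n) 1,
      inner ℝ x (r • (θ : Rn n)) ^ k / k.factorial * exp (-‖r • (θ : Rn n)‖ ^ 2)
        ∂(volume : Measure (Rn n)).toSphere
      = (∫ θ : Metric.sphere (0 : Rn n) 1, inner ℝ x (θ : Rn n) ^ k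
        ∂(volume : Measure (Rn n)).toSphere) / k.factorial *
        (r ^ ((n : ℝ) + k - 1) * exp (-r ^ (2 : ℝ))) := by
    intro r hr
    have hr : 0 < r := hr
    have : ∀ θ : Metric.sphere (0 : Rn n) 1, inner ℝ x (r • (θ : Rn n)) ^ k / k.factorial *
        exp (-‖r • (θ : Rn n)‖ ^ 2) = inner ℝ x (θ : Rn n) ^ k * (r ^ k / k.factorial *
          exp (-r ^ 2)) := fun θ => by
      rw [inner_smul_right, norm_smul, norm_eq_of_mem_sphere, mul_one, norm_of_nonneg hr.le,
        mul_pow]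
      ring
    simp only [this]
    rw [integral_mul_const, smul_eq_mul, rpow_two,
      show (n : ℝ) + k - 1 = ((n - 1 : ℕ) : ℝ) + (k : ℝ) by rw [Nat.cast_sub hn]; push_cast; ring,
      rpow_add hr, rpow_natCast, rpow_natCast]
    ring
  rw [setIntegral_congr_fun measurableSet_Ioi h1, integral_const_mul]
  congr 1
  have h2 := integral_rpow_mul_exp_neg_rpow (p := 2) (q := (n : ℝ) + k - 1) two_pos (by
    have : (1 : ℝ) ≤ n := by exact_mod_cast hn
    have := k.cast_nonneg (α := ℝ)
    linarith)
  rw [h2, sub_add_cancel]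
  ring

/-- The exponential is expanded and integrated term by term. Odd moments vanish, and the radial
factors Γ((n - 2) / 2 + m + 1) dividing the even moments are those of the series for J. -/
theorem integral_sphere_exp_inner {n : ℕ} (hn : 1 ≤ n) {x : Rn n} (hx : x ≠ 0) :
    ∫ θ : Metric.sphere (0 : Rn n) 1, Complex.exp (Complex.I * (inner ℝ x (θ : Rn n) : ℝ))
        ∂(volume : Measure (Rn n)).toSphere
      = ((2 * π ^ ((n : ℝ) / 2) * (‖x‖ / 2) ^ ((2 - (n : ℝ)) / 2) *
        besselJ (((n : ℝ) - 2) / 2) ‖x‖ : ℝ) : ℂ) := by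
  have hx0 : 0 < ‖x‖ / 2 := half_pos (norm_pos_iff.2 hx)
  set σ := (volume : Measure (Rn n)).toSphere with hσ
  set c : ℕ → ℝ := fun k => ∫ θ : Metric.sphere (0 : Rn n) 1, inner ℝ x (θ : Rn n) ^ k ∂σ with hc
  have hmom : ∀ k, c k / k.factorial * (Gamma (((n : ℝ) + k) / 2) / 2)
      = Function.extend (fun m => 2 * m)
        (fun m : ℕ => π ^ ((n : ℝ) / 2) * ((‖x‖ / 2) ^ (2 * m) / m.factorial)) 0 k := fun k => by
    rw [hc, integral_sphere_inner_pow hn x k]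
    exact congrFun (integral_inner_pow_mul_exp x) k
  have hinj : Function.Injective fun m : ℕ => 2 * m := fun a b h => by simpa using h
  have hΓ : ∀ k : ℕ, Gamma (((n : ℝ) + k) / 2) / 2 ≠ 0 := fun k => by
    have : (1 : ℝ) ≤ n := by exact_mod_cast hn
    have := Real.Gamma_pos_of_pos (show 0 < ((n : ℝ) + k) / 2 by positivity)
    positivity
  have hbound : ∀ (k : ℕ) (θ : Metric.sphere (0 : Rn n) 1),
      ‖(Complex.I * (inner ℝ x (θ : Rn n) : ℝ)) ^ k / k.factorial‖ ≤ ‖x‖ ^ k / k.factorial := by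
    intro k θ
    rw [norm_div, norm_pow, norm_mul, Complex.norm_I, one_mul, Complex.norm_real,
      Complex.norm_natCast]
    gcongr
    simpa using norm_inner_le_norm (𝕜 := ℝ) x (θ : Rn n)
  have hS := hasSum_integral_of_dominated_convergence (μ := σ)
    (F := fun (k : ℕ) (θ : Metric.sphere (0 : Rn n) 1) =>
      (Complex.I * (inner ℝ x (θ : Rn n) : ℝ)) ^ k / k.factorial)
    (f := fun θ => Complex.exp (Complex.I * (inner ℝ x (θ : Rn n) : ℝ)))
    (fun (k : ℕ) _ => ‖x‖ ^ k / k.factorial)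
    (fun k => Continuous.aestronglyMeasurable (by fun_prop))
    (fun k => Eventually.of_forall (hbound k))
    (Eventually.of_forall fun _ => Real.summable_pow_div_factorial _) (integrable_const _)
    (Eventually.of_forall fun θ => by
      rw [Complex.exp_eq_exp_ℂ]
      exact NormedSpace.expSeries_div_hasSum_exp _)
  have hterm : ∀ k : ℕ, ∫ θ, (Complex.I * (inner ℝ x (θ : Rn n) : ℝ)) ^ k / k.factorial ∂σ
      = Complex.I ^ k * ((c k / k.factorial : ℝ) : ℂ) := fun k => by
    have : ∀ θ : Metric.sphere (0 : Rn n) 1, (Complex.I * (inner ℝ x (θ : Rn n) : ℝ)) ^ k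
        / k.factorial = Complex.I ^ k * ((inner ℝ x (θ : Rn n) ^ k / k.factorial : ℝ) : ℂ) :=
      fun θ => by
        push_cast
        rw [mul_pow, mul_div_assoc]
    simp only [this]
    rw [integral_const_mul, integral_complex_ofReal, integral_div]
  simp only [hterm] at hS
  have hodd : ∀ k ∉ Set.range fun m : ℕ => 2 * m,
      Complex.I ^ k * ((c k / k.factorial : ℝ) : ℂ) = 0 := fun k hk => by
    have := hmom k
    rw [Function.extend_apply' _ _ _ hk, Pi.zero_apply, mul_eq_zero, or_iff_left (hΓ k)] at this
    rw [this, Complex.ofReal_zero, mul_zero]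
  rw [← hS.tsum_eq, ← hinj.tsum_eq (fun k hk => by
    by_contra h
    exact hk (hodd k h)), besselJ, ← tsum_mul_left, Complex.ofReal_tsum]
  congr 1
  funext m
  have h1 := hmom (2 * m)
  rw [hinj.extend_apply, ← eq_div_iff (hΓ _)] at h1
  rw [h1, pow_mul, Complex.I_sq, show (((n : ℝ) + (2 * m : ℕ)) / 2) = (n - 2) / 2 + m + 1 by
    push_cast; ring]
  have h2 := hΓ (2 * m)
  rw [show (((n : ℝ) + (2 * m : ℕ)) / 2) = (n - 2) / 2 + m + 1 by push_cast; ring] at h2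
  have h3 : (‖x‖ / 2) ^ ((2 - (n : ℝ)) / 2) * (‖x‖ / 2) ^ (((n : ℝ) - 2) / 2 + 2 * m)
      = (‖x‖ / 2) ^ (2 * m) := by
    rw [← rpow_add hx0, ← rpow_natCast]
    congr 1
    push_cast
    ring
  rw [show (-1 : ℂ) = ((-1 : ℝ) : ℂ) by norm_num, ← Complex.ofReal_pow, ← Complex.ofReal_mul]
  congr 1
  rw [← h3]
  field_simp

/-- The Fourier transform of a radial function is a Hankel transform. -/
theorem integral_exp_inner_mul_radial {n : ℕ} (hn : 1 ≤ n) {f : ℝ → ℝ}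
    (hf : Integrable fun v : Rn n => f ‖v‖) {x : Rn n} (hx : x ≠ 0) :
    IntegrableOn (fun s : ℝ => f s * s ^ ((n : ℝ) / 2) * besselJ (((n : ℝ) - 2) / 2) (‖x‖ * s))
      (Set.Ioi 0) ∧
    ∫ v : Rn n, Complex.exp (Complex.I * (inner ℝ x v : ℝ)) * f ‖v‖
      = (((2 * π) ^ ((n : ℝ) / 2) * ‖x‖ ^ ((2 - (n : ℝ)) / 2) * ∫ s in Set.Ioi (0 : ℝ),
        f s * s ^ ((n : ℝ) / 2) * besselJ (((n : ℝ) - 2) / 2) (‖x‖ * s) : ℝ) : ℂ) := by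
  have : Nonempty (Fin n) := ⟨⟨0, hn⟩⟩
  have hx0 : 0 < ‖x‖ := norm_pos_iff.2 hx
  set C : ℝ := (2 * π) ^ ((n : ℝ) / 2) * ‖x‖ ^ ((2 - (n : ℝ)) / 2) with hC
  have hC0 : C ≠ 0 := by positivity
  have hg : Integrable fun v : Rn n => Complex.exp (Complex.I * (inner ℝ x v : ℝ)) * f ‖v‖ := by
    refine hf.ofReal.bdd_mul (c := 1) (Continuous.aestronglyMeasurable (by fun_prop))
      (Eventually.of_forall fun v => ?_)
    rw [mul_comm, Complex.norm_exp_ofReal_mul_I]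
  have hr : ∀ r ∈ Set.Ioi (0 : ℝ), r ^ (Module.finrank ℝ (Rn n) - 1) •
      ∫ θ : Metric.sphere (0 : Rn n) 1, Complex.exp (Complex.I * (inner ℝ x (r • (θ : Rn n)) : ℝ)) *
        f ‖r • (θ : Rn n)‖ ∂(volume : Measure (Rn n)).toSphere
      = ((C * (f r * r ^ ((n : ℝ) / 2) * besselJ (((n : ℝ) - 2) / 2) (‖x‖ * r)) : ℝ) : ℂ) := by
    intro r hr
    have hr : 0 < r := hr
    have h1 : ∀ θ : Metric.sphere (0 : Rn n) 1,
        Complex.exp (Complex.I * (inner ℝ x (r • (θ : Rn n)) : ℝ)) * f ‖r • (θ : Rn n)‖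
        = Complex.exp (Complex.I * (inner ℝ (r • x) (θ : Rn n) : ℝ)) * f r := fun θ => by
      rw [inner_smul_right, inner_smul_left, norm_smul, norm_eq_of_mem_sphere, mul_one,
        norm_of_nonneg hr.le]
      simp
    simp only [h1]
    rw [integral_mul_const, integral_sphere_exp_inner hn (smul_ne_zero hr.ne' hx),
      finrank_euclideanSpace_fin, norm_smul, norm_of_nonneg hr.le, Complex.real_smul,
      ← Complex.ofReal_mul, ← Complex.ofReal_mul]
    congr 1
    have h2 : (r * ‖x‖ / 2) ^ ((2 - (n : ℝ)) / 2)
        = r ^ ((2 - (n : ℝ)) / 2) * ‖x‖ ^ ((2 - (n : ℝ)) / 2) / 2 ^ ((2 - (n : ℝ)) / 2) := by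
      rw [div_rpow (by positivity) zero_le_two, mul_rpow hr.le hx0.le]
    have h3 : r ^ (n - 1) * r ^ ((2 - (n : ℝ)) / 2) = r ^ ((n : ℝ) / 2) := by
      rw [← rpow_natCast r (n - 1), ← rpow_add hr]
      congr 1
      rw [Nat.cast_sub hn]
      push_cast
      ring
    have h4 : (2 : ℝ) / 2 ^ ((2 - (n : ℝ)) / 2) = 2 ^ ((n : ℝ) / 2) := by
      rw [div_eq_iff (by positivity), ← rpow_add two_pos, show (n : ℝ) / 2 + (2 - n) / 2 = 1 by ring,
        rpow_one]
    rw [hC, h2, mul_rpow zero_le_two pi_pos.le, ← h3, ← h4, mul_comm r ‖x‖]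
    ring
  have hI := integrableOn_polar volume hg
  have hint := integral_polar volume hg
  rw [integrableOn_congr_fun hr measurableSet_Ioi] at hI
  rw [setIntegral_congr_fun measurableSet_Ioi hr, integral_complex_ofReal, integral_const_mul]
    at hint
  refine ⟨?_, hint⟩
  have h5 := (hI.re).const_mul C⁻¹
  refine h5.congr (Eventually.of_forall fun s => ?_)
  simp [hC0]

end GASP

namespace GASP

open FourierTransform

/-! ### Fourier transforms of even real functions, and Plancherel's theorem -/

section Fourier

variable {V : Type*} [NormedAddCommGroup V] [InnerProductSpace ℝ V] [FiniteDimensional ℝ V]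
  [MeasurableSpace V] [BorelSpace V]

theorem continuous_fourier_of_integrable {f : V → ℂ} (hf : Integrable f) : Continuous (𝓕 f) :=
  VectorFourier.fourierIntegral_continuous Real.continuous_fourierChar continuous_inner hf

theorem norm_fourier_le_integral (f : V → ℂ) (w : V) : ‖𝓕 f w‖ ≤ ∫ v, ‖f v‖ :=
  VectorFourier.norm_fourierIntegral_le_integral_norm _ _ _ f w

theorem integral_fourier_mul {f g : V → ℂ} (hf : Integrable f) (hg : Integrable g) :
    ∫ x, 𝓕 f x * g x = ∫ v, f v * 𝓕 g v := by
  have h := VectorFourier.integral_fourierIntegral_smul_eq_flip (μ := (volume : Measure V))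
    (ν := (volume : Measure V)) (L := innerₗ V) Real.continuous_fourierChar continuous_inner hf hg
  rw [flip_innerₗ] at h
  exact h

theorem fourier_comp_sub (f : V → ℂ) (x w : V) :
    𝓕 (fun t => f (t - x)) w = Complex.exp (((-2 * π * inner ℝ x w : ℝ) : ℂ) * Complex.I) *
      𝓕 f w := by
  rw [Real.fourier_eq', Real.fourier_eq', ← integral_const_mul,
    ← integral_add_right_eq_self _ x]
  refine integral_congr_ae (Eventually.of_forall fun t => ?_)
  simp only [smul_eq_mul, add_sub_cancel_right]
  rw [← mul_assoc, ← Complex.exp_add, inner_add_left]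
  congr 2
  push_cast
  ring

theorem fourier_neg_of_even {f : V → ℂ} (hf : ∀ v, f (-v) = f v) (w : V) :
    𝓕 f (-w) = 𝓕 f w := by
  rw [← Real.fourierInv_eq_fourier_neg, Real.fourierInv_eq_fourier_comp_neg]
  simp only [hf]

theorem fourierInv_of_even {f : V → ℂ} (hf : ∀ v, f (-v) = f v) : 𝓕⁻ f = 𝓕 f := by
  rw [Real.fourierInv_eq_fourier_comp_neg]
  simp only [hf]

/-- Conjugation reflects the frequency and evenness reflects it back, so the transform is real. -/
theorem ofReal_re_fourier {f : V → ℝ} (hf : ∀ v, f (-v) = f v) (w : V) :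
    (((𝓕 (fun v => (f v : ℂ)) w).re : ℝ) : ℂ) = 𝓕 (fun v => (f v : ℂ)) w := by
  rw [← Complex.conj_eq_iff_re]
  refine Eq.trans ?_ (fourier_neg_of_even (fun v => by rw [hf]) w)
  rw [Real.fourier_eq', Real.fourier_eq', ← integral_conj]
  refine integral_congr_ae (Eventually.of_forall fun v => ?_)
  simp only [smul_eq_mul, map_mul, Complex.conj_ofReal, ← Complex.exp_conj, Complex.conj_I,
    inner_neg_right]
  congr 2
  push_cast
  ring

/-- The `L²` Fourier transform of an integrable function is given by the Fourier integral. -/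
theorem coeFn_fourier_toLp {f : V → ℂ} (hf : Integrable f) (hf2 : MemLp f 2 volume) :
    ((𝓕 (hf2.toLp f) : Lp ℂ 2 (volume : Measure V)) : V → ℂ) =ᵐ[volume] 𝓕 f := by
  refine ae_eq_of_integral_contDiff_smul_eq
    ((Lp.memLp (𝓕 (hf2.toLp f) : Lp ℂ 2 (volume : Measure V))).locallyIntegrable (by norm_num))
    (continuous_fourier_of_integrable hf).locallyIntegrable fun g hg hgc => ?_
  have hgC : ContDiff ℝ ∞ fun x => (g x : ℂ) := Complex.ofRealCLM.contDiff.comp hg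
  have hgcC : HasCompactSupport fun x => (g x : ℂ) := hgc.comp_left Complex.ofReal_zero
  set φ : 𝓢(V, ℂ) := hgcC.toSchwartzMap hgC with hφ
  have hφx : ∀ x, φ x = (g x : ℂ) := fun x => rfl
  have h1 : (Lp.toTemperedDistribution (𝓕 (hf2.toLp f) : Lp ℂ 2 (volume : Measure V))) φ
      = Lp.toTemperedDistribution (hf2.toLp f) (𝓕 φ) := by
    rw [← Lp.fourier_toTemperedDistribution_eq, TemperedDistribution.fourier_apply]
  rw [Lp.toTemperedDistribution_apply, Lp.toTemperedDistribution_apply] at h1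
  have h2 : ∫ x, 𝓕 φ x • (hf2.toLp f) x = ∫ x, φ x * 𝓕 f x := by
    rw [SchwartzMap.fourier_coe, ← integral_fourier_mul φ.integrable hf]
    refine integral_congr_ae ?_
    filter_upwards [hf2.coeFn_toLp] with x hx
    rw [hx, smul_eq_mul]
  rw [h2] at h1
  simpa only [hφx, smul_eq_mul, Complex.real_smul] using h1

theorem memLp_fourier {f : V → ℂ} (hf : Integrable f) (hf2 : MemLp f 2 volume) :
    MemLp (𝓕 f) 2 volume :=
  (memLp_congr_ae (coeFn_fourier_toLp hf hf2)).1 (Lp.memLp _)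

theorem integral_conj_fourier_mul_fourier {f g : V → ℂ} (hf : Integrable f)
    (hf2 : MemLp f 2 volume) (hg : Integrable g) (hg2 : MemLp g 2 volume) :
    ∫ x, starRingEnd ℂ (𝓕 f x) * 𝓕 g x = ∫ v, starRingEnd ℂ (f v) * g v := by
  have h := Lp.inner_fourier_eq (hf2.toLp f) (hg2.toLp g)
  rw [L2.inner_def, L2.inner_def] at h
  calc _ = _ := integral_congr_ae ?_
    _ = _ := h
    _ = _ := integral_congr_ae ?_
  · filter_upwards [coeFn_fourier_toLp hf hf2, coeFn_fourier_toLp hg hg2] with x h1 h2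
    rw [h1, h2, RCLike.inner_apply, mul_comm]
  · filter_upwards [hf2.coeFn_toLp, hg2.coeFn_toLp] with x h1 h2
    rw [h1, h2, RCLike.inner_apply, mul_comm]

/-- By evenness K(x - ·) is a translate of K, so the multiplication formula applies and the
translation becomes a character. -/
theorem integral_fourier_mul_comp_sub {m K : V → ℂ} (hm : Integrable m) (hK : Integrable K)
    (hKe : ∀ v, K (-v) = K v) (x : V) :
    ∫ t, 𝓕 m t * K (x - t) = 𝓕 (fun v => m v * 𝓕 K v) x := by
  have h1 : ∀ t, K (x - t) = K (t - x) := fun t => by rw [← hKe, neg_sub]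
  simp only [h1]
  rw [integral_fourier_mul hm (hK.comp_sub_right x), Real.fourier_eq']
  refine integral_congr_ae (Eventually.of_forall fun v => ?_)
  simp only [fourier_comp_sub, smul_eq_mul, real_inner_comm v x]
  ring

/-- The two transforms need not be integrable, so Parseval's identity replaces the multiplication
formula. Modulating m₂ by a character produces the translate by x. -/
theorem integral_fourier_mul_fourier_comp_sub {m₁ m₂ : V → ℝ}
    (h₁ : Integrable m₁) (h₁' : MemLp m₁ 2 volume) (he₁ : ∀ v, m₁ (-v) = m₁ v)
    (h₂ : Integrable m₂) (h₂' : MemLp m₂ 2 volume) (he₂ : ∀ v, m₂ (-v) = m₂ v) (x : V) :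
    ∫ t, 𝓕 (fun v => (m₁ v : ℂ)) t * 𝓕 (fun v => (m₂ v : ℂ)) (x - t)
      = 𝓕 (fun v => (m₁ v : ℂ) * m₂ v) x := by
  set e : V → ℂ := fun v => Complex.exp (((2 * π * inner ℝ v x : ℝ) : ℂ) * Complex.I) with he
  have hec : Continuous e := by fun_prop
  have he1 : ∀ v, ‖e v‖ = 1 := fun v => Complex.norm_exp_ofReal_mul_I _
  have hI : Integrable fun v => e v * (m₂ v : ℂ) :=
    h₂.ofReal.bdd_mul (c := 1) hec.aestronglyMeasurable (Eventually.of_forall fun v => (he1 v).le)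
  have hI2 : MemLp (fun v => e v * (m₂ v : ℂ)) 2 volume := by
    refine (h₂'.ofReal (K := ℂ)).of_le
      (hec.aestronglyMeasurable.mul h₂.ofReal.aestronglyMeasurable)
      (Eventually.of_forall fun v => ?_)
    rw [norm_mul, he1, one_mul]
    rfl
  have h := integral_conj_fourier_mul_fourier h₁.ofReal (h₁'.ofReal (K := ℂ)) hI hI2
  have hL : ∀ t, 𝓕 (fun v => e v * (m₂ v : ℂ)) t = 𝓕 (fun v => (m₂ v : ℂ)) (x - t) := fun t => by
    rw [← fourier_neg_of_even (fun v => by rw [he₂]) (x - t), neg_sub, Real.fourier_eq',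
      Real.fourier_eq']
    refine integral_congr_ae (Eventually.of_forall fun v => ?_)
    simp only [smul_eq_mul, he]
    rw [← mul_assoc, ← Complex.exp_add, inner_sub_right]
    congr 2
    push_cast
    ring
  have hR : 𝓕 (fun v => (m₁ v : ℂ) * m₂ v) x = ∫ v, starRingEnd ℂ (m₁ v : ℂ) * (e v * m₂ v) := by
    rw [← fourierInv_of_even (fun v => by rw [he₁, he₂]), Real.fourierInv_eq']
    refine integral_congr_ae (Eventually.of_forall fun v => ?_)
    simp only [smul_eq_mul, he, Complex.conj_ofReal]
    ring
  rw [hR]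
  refine Eq.trans ?_ h
  refine integral_congr_ae (Eventually.of_forall fun t => ?_)
  simp only [hL]
  congr 1
  have := ofReal_re_fourier he₁ t
  exact (Complex.conj_eq_iff_re.2 this).symm

/-- The Fourier transform of a rapidly decreasing function is smooth with bounded derivatives. -/
theorem hasTemperateGrowth_fourier {f : V → ℂ} (hm : AEStronglyMeasurable f)
    (hf : ∀ k : ℕ, Integrable fun v => ‖v‖ ^ k * ‖f v‖) : (𝓕 f).HasTemperateGrowth := by
  refine ⟨Real.contDiff_fourier fun k _ => hf k, fun k => ⟨0, ∫ v,
    ‖VectorFourier.fourierPowSMulRight (innerSL ℝ) f v k‖, fun x => ?_⟩⟩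
  rw [Real.iteratedFDeriv_fourier (N := ⊤) (fun k _ => hf k) hm le_top, pow_zero, mul_one]
  exact VectorFourier.norm_fourierIntegral_le_integral_norm _ _ _ _ _

end Fourier

end GASP

namespace GASP

open FourierTransform

/-! ### The kernel solving the convolution equation -/

theorem integrable_norm_pow_mul_exp_neg (n k : ℕ) {δ : ℝ} (hδ : 0 < δ) :
    Integrable fun v : Rn n => ‖v‖ ^ k * exp (-(δ * ‖v‖)) := by
  rcases Nat.eq_zero_or_pos n with rfl | hn
  · have : IsFiniteMeasure (volume : Measure (Rn 0)) := by
      rw [volume_euclideanSpace_eq_dirac]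
      infer_instance
    exact (integrable_const (0 ^ k * exp (-(δ * 0)))).congr
      (Eventually.of_forall fun v => by simp [Subsingleton.elim v 0])
  · have : Nonempty (Fin n) := ⟨⟨0, hn⟩⟩
    refine (integrable_fun_norm_addHaar (volume : Measure (Rn n))
      (f := fun r => r ^ k * exp (-(δ * r)))).2 ?_
    rw [finrank_euclideanSpace_fin]
    refine (integrableOn_congr_fun (fun r hr => ?_) measurableSet_Ioi).1
      (integrableOn_rpow_mul_exp (s := (n - 1 : ℕ) + k + 1) (by positivity) hδ)
    rw [add_sub_cancel_right, rpow_add hr, rpow_natCast, rpow_natCast, smul_eq_mul, mul_assoc]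

section Profile

variable (n : ℕ) {α : ℝ} (hα : -1 < α)
include hα

theorem order_pos : 0 < (α + 1) / 2 := by linarith

/-- Continuity at the origin comes for free, since this is the transform of an integrable function.
-/
theorem continuous_poissonProfile_norm {y : ℝ} (hy : 0 < y) :
    Continuous fun v : Rn n => poissonProfile ((α + 1) / 2) (y * (π * ‖v‖)) := by
  have h := Complex.continuous_re.comp
    (continuous_fourier_of_integrable (integrable_poissonKernel n hα hy).ofReal)
  refine h.congr fun v => ?_
  rw [Function.comp_apply]
  refine (congrArg Complex.re (fourier_poissonKernel n hα hy v)).trans ?_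
  simp

theorem poissonProfile_norm_pos {y : ℝ} (hy : 0 < y) (v : Rn n) :
    0 < poissonProfile ((α + 1) / 2) (y * (π * ‖v‖)) :=
  poissonProfile_pos (order_pos hα) (by positivity)

theorem poissonProfile_norm_bound {y : ℝ} (hy : 0 < y) (v : Rn n) :
    poissonProfile ((α + 1) / 2) (y * (π * ‖v‖)) ≤ ∫ x : Rn n, ‖(poissonKernel n α y x : ℂ)‖ := by
  have h := norm_fourier_le_integral (fun x : Rn n => (poissonKernel n α y x : ℂ)) v
  rwa [fourier_poissonKernel n hα hy, Complex.norm_real,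
    norm_of_nonneg (poissonProfile_norm_pos n hα hy v).le] at h

end Profile

/-- The quotient of the Fourier transforms of `poissonKernel n α b` and `poissonKernel n α a`. -/
noncomputable def poissonMult (n : ℕ) (α a b : ℝ) (v : Rn n) : ℝ :=
  poissonProfile ((α + 1) / 2) (b * (π * ‖v‖)) / poissonProfile ((α + 1) / 2) (a * (π * ‖v‖))

/-- The inverse Fourier transform of `poissonMult n α a b`. -/
noncomputable def quotKernel (n : ℕ) (α a b : ℝ) (x : Rn n) : ℝ :=
  (𝓕 (fun v : Rn n => (poissonMult n α a b v : ℂ)) x).re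

theorem poissonMult_neg (n : ℕ) (α a b : ℝ) (v : Rn n) :
    poissonMult n α a b (-v) = poissonMult n α a b v := by
  rw [poissonMult, norm_neg, poissonMult]

theorem ofReal_quotKernel (n : ℕ) (α a b : ℝ) (x : Rn n) :
    (quotKernel n α a b x : ℂ) = 𝓕 (fun v : Rn n => (poissonMult n α a b v : ℂ)) x :=
  ofReal_re_fourier (poissonMult_neg n α a b) x

section Mult

variable (n : ℕ) {α a b : ℝ} (hα : -1 < α) (ha : 0 < a)
include hα ha

theorem continuous_poissonMult (hb : 0 < b) : Continuous (poissonMult n α a b) :=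
  (continuous_poissonProfile_norm n hα hb).div (continuous_poissonProfile_norm n hα ha)
    fun v => (poissonProfile_norm_pos n hα ha v).ne'

theorem norm_poissonMult_le (hab : a < b) (v : Rn n) :
    ‖poissonMult n α a b v‖ ≤ (b / a) ^ ((α + 1) / 2) * exp (-(2 * (b - a) * π * ‖v‖)) := by
  have h1 := poissonProfile_norm_pos n hα ha v
  have h2 := poissonProfile_norm_pos n hα (ha.trans hab) v
  rw [poissonMult, norm_of_nonneg (div_pos h2 h1).le, div_le_iff₀ h1]
  refine (poissonProfile_le (order_pos hα) (by positivity) ha hab.le).trans (le_of_eq ?_)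
  ring_nf

theorem integrable_norm_pow_mul_poissonMult (hab : a < b) (k : ℕ) :
    Integrable fun v : Rn n => ‖v‖ ^ k * ‖(poissonMult n α a b v : ℂ)‖ := by
  have hδ : 0 < 2 * (b - a) * π := by have := sub_pos.2 hab; positivity
  refine ((integrable_norm_pow_mul_exp_neg n k hδ).const_mul ((b / a) ^ ((α + 1) / 2))).mono'
    ?_ (Eventually.of_forall fun v => ?_)
  · have := (continuous_poissonMult n hα ha (ha.trans hab))
    exact Continuous.aestronglyMeasurable (by fun_prop)
  · rw [norm_mul, norm_norm, norm_pow, norm_norm, Complex.norm_real, mul_left_comm]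
    gcongr
    exact norm_poissonMult_le n hα ha hab v

theorem integrable_poissonMult (hab : a < b) : Integrable (poissonMult n α a b) := by
  have h := integrable_norm_pow_mul_poissonMult n hα ha hab 0
  simp only [pow_zero, one_mul, Complex.norm_real] at h
  exact (integrable_norm_iff
    (continuous_poissonMult n hα ha (ha.trans hab)).aestronglyMeasurable).1 h

theorem norm_poissonMult_le_const (hab : a < b) (v : Rn n) :
    ‖poissonMult n α a b v‖ ≤ (b / a) ^ ((α + 1) / 2) := by
  refine (norm_poissonMult_le n hα ha hab v).trans (mul_le_of_le_one_right ?_ ?_)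
  · have := div_pos (ha.trans hab) ha
    positivity
  · have := sub_pos.2 hab
    exact exp_le_one_iff.2 (by simp only [Left.neg_nonpos_iff]; positivity)

theorem memLp_poissonMult (hab : a < b) : MemLp (poissonMult n α a b) 2 volume := by
  have hc := continuous_poissonMult n hα ha (ha.trans hab)
  rw [memLp_two_iff_integrable_sq hc.aestronglyMeasurable]
  have h := (integrable_poissonMult n hα ha hab).bdd_mul (c := (b / a) ^ ((α + 1) / 2))
    hc.aestronglyMeasurable (Eventually.of_forall (norm_poissonMult_le_const n hα ha hab))
  exact h.congr (Eventually.of_forall fun v => (pow_two _).symm)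

theorem poissonMult_mul_profile (v : Rn n) :
    poissonMult n α a b v * poissonProfile ((α + 1) / 2) (a * (π * ‖v‖))
      = poissonProfile ((α + 1) / 2) (b * (π * ‖v‖)) :=
  div_mul_cancel₀ _ (poissonProfile_norm_pos n hα ha v).ne'

theorem contDiff_quotKernel (hab : a < b) : ContDiff ℝ ∞ (quotKernel n α a b) :=
  Complex.reCLM.contDiff.comp
    (Real.contDiff_fourier fun k _ => integrable_norm_pow_mul_poissonMult n hα ha hab k)

theorem memLp_quotKernel (hab : a < b) : MemLp (quotKernel n α a b) 2 volume :=
  (memLp_fourier (integrable_poissonMult n hα ha hab).ofReal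
    ((memLp_poissonMult n hα ha hab).ofReal (K := ℂ))).re

/-- The profile at a is the profile at a / 2, which is bounded, times the multiplier from a / 2 to
a, which is integrable. -/
theorem integrable_poissonProfile_norm :
    Integrable fun v : Rn n => poissonProfile ((α + 1) / 2) (a * (π * ‖v‖)) := by
  have h2 : a / 2 < a := half_lt_self ha
  have := (integrable_poissonMult n hα (half_pos ha) h2).mul_bdd
    (c := ∫ x : Rn n, ‖(poissonKernel n α (a / 2) x : ℂ)‖)
    (continuous_poissonProfile_norm n hα (half_pos ha)).aestronglyMeasurable
    (Eventually.of_forall fun v => by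
      rw [norm_of_nonneg (poissonProfile_norm_pos n hα (half_pos ha) v).le]
      exact poissonProfile_norm_bound n hα (half_pos ha) v)
  exact this.congr (Eventually.of_forall fun v => poissonMult_mul_profile n hα (half_pos ha) v)

/-- The Poisson kernel is the Fourier transform of its Fourier transform. -/
theorem fourier_fourier_poissonKernel (x : Rn n) :
    𝓕 (fun v : Rn n => (poissonProfile ((α + 1) / 2) (a * (π * ‖v‖)) : ℂ)) x
      = poissonKernel n α a x := by
  have hF : 𝓕 (fun x : Rn n => (poissonKernel n α a x : ℂ))
      = fun v : Rn n => (poissonProfile ((α + 1) / 2) (a * (π * ‖v‖)) : ℂ) :=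
    funext fun v => fourier_poissonKernel n hα ha v
  have hI : Integrable (𝓕 (fun x : Rn n => (poissonKernel n α a x : ℂ))) := by
    rw [hF]
    exact (integrable_poissonProfile_norm n hα ha).ofReal
  have h := Continuous.fourierInv_fourier_eq
    (Complex.continuous_ofReal.comp (continuous_poissonKernel n α ha))
    (integrable_poissonKernel n hα ha).ofReal hI
  have h' := congrFun h x
  rw [show (Complex.ofReal ∘ poissonKernel n α a) = fun x : Rn n => (poissonKernel n α a x : ℂ)
    from rfl, hF, fourierInv_of_even (fun v => by rw [norm_neg])] at h'
  exact h'

end Mult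

theorem convolutionExists_of_memLp {n : ℕ} {f g : Rn n → ℝ} (hf : MemLp f 2 volume)
    (hg : MemLp g 2 volume) :
    ConvolutionExists f g (ContinuousLinearMap.mul ℝ ℝ) volume := fun x =>
  hf.integrable_mul (hg.comp_measurePreserving (Measure.measurePreserving_sub_left volume x))

theorem quotKernel_convolution_poissonKernel (n : ℕ) {α a b : ℝ} (hα : -1 < α) (ha : 0 < a)
    (hab : a < b) :
    (quotKernel n α a b ⋆[ContinuousLinearMap.mul ℝ ℝ, volume] poissonKernel n α a)
      = poissonKernel n α b := by
  funext x
  rw [convolution_def]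
  simp only [ContinuousLinearMap.mul_apply']
  apply Complex.ofReal_injective
  rw [← integral_complex_ofReal, ← fourier_fourier_poissonKernel n hα (ha.trans hab) x]
  simp only [Complex.ofReal_mul, ofReal_quotKernel]
  refine (integral_fourier_mul_comp_sub (K := fun x : Rn n => (poissonKernel n α a x : ℂ))
    (integrable_poissonMult n hα ha hab).ofReal (integrable_poissonKernel n hα ha).ofReal
    (fun v => by rw [poissonKernel_neg]) x).trans ?_
  refine congrArg (fun F : Rn n → ℂ => 𝓕 F x) (funext fun v => ?_)
  rw [fourier_poissonKernel n hα ha]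
  exact (Complex.ofReal_mul _ _).symm.trans
    (congrArg Complex.ofReal (poissonMult_mul_profile n hα ha v))

/-- On the Fourier side the two quotients telescope. -/
theorem quotKernel_convolution_quotKernel (n : ℕ) {α a b c : ℝ} (hα : -1 < α) (ha : 0 < a)
    (hab : a < b) (hbc : b < c) :
    quotKernel n α a c
      = (quotKernel n α b c ⋆[ContinuousLinearMap.mul ℝ ℝ, volume] quotKernel n α a b) := by
  have hb := ha.trans hab
  funext x
  rw [convolution_def]
  simp only [ContinuousLinearMap.mul_apply']
  apply Complex.ofReal_injective
  rw [← integral_complex_ofReal]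
  simp only [Complex.ofReal_mul, ofReal_quotKernel]
  refine Eq.trans ?_ (integral_fourier_mul_fourier_comp_sub (integrable_poissonMult n hα hb hbc)
    (memLp_poissonMult n hα hb hbc) (poissonMult_neg n α b c) (integrable_poissonMult n hα ha hab)
    (memLp_poissonMult n hα ha hab) (poissonMult_neg n α a b) x).symm
  refine congrArg (fun F : Rn n → ℂ => 𝓕 F x) (funext fun v => ?_)
  rw [← Complex.ofReal_mul, poissonMult, poissonMult, poissonMult,
    div_mul_div_cancel₀ (poissonProfile_norm_pos n hα hb v).ne']

theorem fourierInt_poissonKernel (n : ℕ) {α y : ℝ} (hα : -1 < α) (hy : 0 < y) (ξ : Rn n) :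
    fourierInt (fun x => (poissonKernel n α y x : ℂ)) ξ
      = (poissonProfile ((α + 1) / 2) (y * (‖ξ‖ / 2)) : ℂ) := by
  rw [fourierInt_eq_fourier, fourier_poissonKernel n hα hy, norm_smul, norm_inv,
    norm_of_nonneg (by positivity : 0 ≤ 2 * π)]
  congr 3
  field_simp

theorem fourierInt_poissonKernel_ne_zero (n : ℕ) {α y : ℝ} (hα : -1 < α) (hy : 0 < y) (ξ : Rn n) :
    fourierInt (fun x => (poissonKernel n α y x : ℂ)) ξ ≠ 0 := by
  rw [fourierInt_poissonKernel n hα hy, Complex.ofReal_ne_zero]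
  exact (poissonProfile_pos (order_pos hα) (by positivity)).ne'

theorem fourierInt_div_eq_poissonMult (n : ℕ) {α a b : ℝ} (hα : -1 < α) (ha : 0 < a) (hb : 0 < b)
    (ξ : Rn n) :
    fourierInt (fun x => (poissonKernel n α b x : ℂ)) ξ /
      fourierInt (fun x => (poissonKernel n α a x : ℂ)) ξ
      = (poissonMult n α a b ((2 * π)⁻¹ • ξ) : ℂ) := by
  rw [fourierInt_eq_fourier, fourierInt_eq_fourier, fourier_poissonKernel n hα hb,
    fourier_poissonKernel n hα ha, ← Complex.ofReal_div, poissonMult]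

theorem fourierInt_div_eq_besselK (n : ℕ) {α a b : ℝ} (hα : -1 < α) (ha : 0 < a) (hb : 0 < b)
    {ξ : Rn n} (hξ : ξ ≠ 0) :
    fourierInt (fun x => (poissonKernel n α b x : ℂ)) ξ /
      fourierInt (fun x => (poissonKernel n α a x : ℂ)) ξ
      = (((b / a) ^ ((α + 1) / 2) * (besselK ((α + 1) / 2) (b * ‖ξ‖) /
        besselK ((α + 1) / 2) (a * ‖ξ‖)) : ℝ) : ℂ) := by
  rw [fourierInt_poissonKernel n hα hb, fourierInt_poissonKernel n hα ha, ← Complex.ofReal_div,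
    poissonProfile_div _ (order_pos hα) ha hb (norm_pos_iff.2 hξ)]

theorem hasFourierL2_quotKernel (n : ℕ) {α a b : ℝ} (hα : -1 < α) (ha : 0 < a) (hab : a < b) :
    HasFourierL2 (fun x => (quotKernel n α a b x : ℂ)) (fun ξ =>
      fourierInt (fun x => (poissonKernel n α b x : ℂ)) ξ /
        fourierInt (fun x => (poissonKernel n α a x : ℂ)) ξ) := by
  have hb := ha.trans hab
  have h2π : (2 * π) ≠ 0 := by positivity
  simp only [fourierInt_div_eq_poissonMult n hα ha hb]
  refine ⟨(memLp_quotKernel n hα ha hab).ofReal, ?_, fun φ => ?_⟩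
  · refine MemLp.ofReal ?_
    have hc : Continuous fun ξ : Rn n => poissonMult n α a b ((2 * π)⁻¹ • ξ) :=
      (continuous_poissonMult n hα ha hb).comp (continuous_const_smul _)
    refine (memLp_two_iff_integrable_sq (μ := volume) hc.aestronglyMeasurable).2 ?_
    exact ((memLp_two_iff_integrable_sq
      (continuous_poissonMult n hα ha hb).aestronglyMeasurable).1
      (memLp_poissonMult n hα ha hab)).comp_smul (inv_ne_zero h2π)
  · simp only [ofReal_quotKernel, fourierInt_eq_fourier]
    have hI : Integrable fun x : Rn n => 𝓕 (φ : Rn n → ℂ) ((2 * π)⁻¹ • x) := by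
      rw [← SchwartzMap.fourier_coe]
      exact (𝓕 φ).integrable.comp_smul (inv_ne_zero h2π)
    -- Fourier inversion with a dilation. The Jacobian (2π) ^ n is removed by the final change of
    -- variables ξ = -2π v, whose sign is absorbed by the evenness of the multiplier.
    have hF : ∀ v : Rn n, 𝓕 (fun x : Rn n => 𝓕 (φ : Rn n → ℂ) ((2 * π)⁻¹ • x)) v
        = |((2 * π) ^ n)| • φ (-((2 * π) • v)) := fun v => by
      have h1 := Measure.integral_comp_smul (volume : Measure (Rn n))
        (fun z : Rn n => Complex.exp (((-2 * π * inner ℝ z ((2 * π) • v) : ℝ) : ℂ) * Complex.I) •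
          𝓕 (φ : Rn n → ℂ) z) (2 * π)⁻¹
      rw [← Real.fourier_eq' (𝓕 (φ : Rn n → ℂ)), finrank_euclideanSpace_fin, inv_pow, inv_inv] at h1
      have h3 := congrArg (fun ψ : 𝓢(Rn n, ℂ) => ψ (-((2 * π) • v))) 
        (fourierInv_fourier_eq φ : 𝓕⁻ (𝓕 φ : 𝓢(Rn n, ℂ)) = φ)
      simp only [SchwartzMap.fourierInv_coe, SchwartzMap.fourier_coe] at h3
      rw [Real.fourierInv_eq_fourier_neg, neg_neg] at h3
      rw [← h3, ← h1, Real.fourier_eq']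
      refine integral_congr_ae (Eventually.of_forall fun x => ?_)
      simp only [inner_smul_left, inner_smul_right, RCLike.conj_to_real]
      congr 5
      field_simp
    refine (integral_fourier_mul (integrable_poissonMult n hα ha hab).ofReal hI).trans ?_
    simp only [hF]
    have h4 := Measure.integral_comp_smul (volume : Measure (Rn n))
        (fun ξ : Rn n => (poissonMult n α a b ((2 * π)⁻¹ • ξ) : ℂ) * φ ξ) (-(2 * π))
    have h5 : |((-(2 * π)) ^ Module.finrank ℝ (Rn n))⁻¹| = |((2 * π) ^ n)|⁻¹ := by
      rw [finrank_euclideanSpace_fin, abs_inv, abs_pow, abs_neg, abs_pow]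
    have h6 : |((2 * π) ^ n)| ≠ 0 := by positivity
    rw [h5, eq_inv_smul_iff₀ h6, ← integral_smul] at h4
    rw [← h4]
    refine integral_congr_ae (Eventually.of_forall fun v => ?_)
    simp only [neg_smul, smul_neg, smul_smul, inv_mul_cancel₀ h2π, one_smul, poissonMult_neg,
      Complex.real_smul]
    exact mul_left_comm _ _ _

theorem quotKernel_eq_integral {n : ℕ} (hn : 1 ≤ n) {α a b : ℝ} (hα : -1 < α) (ha : 0 < a)
    (hab : a < b) {x : Rn n} (hx : x ≠ 0) :
    IntegrableOn (fun s : ℝ => besselK ((α + 1) / 2) (b * s) / besselK ((α + 1) / 2) (a * s) *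
      s ^ ((n : ℝ) / 2) * besselJ (((n : ℝ) - 2) / 2) (‖x‖ * s)) (Set.Ioi 0) volume ∧
    quotKernel n α a b x = ‖x‖ ^ ((2 - (n : ℝ)) / 2) / (2 * π) ^ ((n : ℝ) / 2) *
      (b / a) ^ ((α + 1) / 2) *
      ∫ s in Set.Ioi (0 : ℝ), besselK ((α + 1) / 2) (b * s) / besselK ((α + 1) / 2) (a * s) *
        s ^ ((n : ℝ) / 2) * besselJ (((n : ℝ) - 2) / 2) (‖x‖ * s) := by
  have hb := ha.trans hab
  have h2π : (0 : ℝ) < 2 * π := by positivity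
  set ρ : ℝ → ℝ := fun r => poissonProfile ((α + 1) / 2) (b * (r / 2)) /
    poissonProfile ((α + 1) / 2) (a * (r / 2)) with hρ
  have hρm : ∀ v : Rn n, ρ ‖v‖ = poissonMult n α a b ((2 * π)⁻¹ • v) := fun v => by
    rw [poissonMult, norm_smul, norm_inv, norm_of_nonneg h2π.le, hρ]
    simp only
    congr 3 <;> field_simp
  have hI : Integrable fun v : Rn n => ρ ‖v‖ := by
    simp only [hρm]
    exact (integrable_poissonMult n hα ha hab).comp_smul (inv_ne_zero h2π.ne')
  -- The formula has kernel exp (i ⟨x, v⟩), whereas `𝓕` carries a minus sign; hence the point -x.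
  obtain ⟨h1, h2⟩ := integral_exp_inner_mul_radial hn hI (neg_ne_zero.2 hx)
  rw [norm_neg] at h1 h2
  have hC : (b / a) ^ ((α + 1) / 2) ≠ 0 := by positivity
  have hk : ∀ s ∈ Set.Ioi (0 : ℝ), ρ s * s ^ ((n : ℝ) / 2) * besselJ (((n : ℝ) - 2) / 2) (‖x‖ * s)
      = (b / a) ^ ((α + 1) / 2) * (besselK ((α + 1) / 2) (b * s) / besselK ((α + 1) / 2) (a * s) *
      s ^ ((n : ℝ) / 2) * besselJ (((n : ℝ) - 2) / 2) (‖x‖ * s)) := fun s hs => by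
    rw [hρ]
    simp only
    rw [poissonProfile_div _ (order_pos hα) ha hb hs]
    ring
  rw [integrableOn_congr_fun hk measurableSet_Ioi] at h1
  rw [setIntegral_congr_fun measurableSet_Ioi hk, integral_const_mul] at h2
  refine ⟨?_, ?_⟩
  · have := h1.const_mul ((b / a) ^ ((α + 1) / 2))⁻¹
    refine IntegrableOn.congr_fun this (fun s _ => ?_) measurableSet_Ioi
    rw [inv_mul_cancel_left₀ hC]
  · apply Complex.ofReal_injective
    rw [ofReal_quotKernel, Real.fourier_eq']
    have h4 := Measure.integral_comp_smul (volume : Measure (Rn n))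
      (fun v : Rn n => Complex.exp (Complex.I * (inner ℝ (-x) v : ℝ)) * ρ ‖v‖) (2 * π)
    -- The Jacobian is split into two equal factors, one of which cancels the constant of the Hankel
    -- transform.
    have h5 : |((2 * π) ^ Module.finrank ℝ (Rn n))⁻¹|
        = ((2 * π) ^ ((n : ℝ) / 2))⁻¹ * ((2 * π) ^ ((n : ℝ) / 2))⁻¹ := by
      rw [finrank_euclideanSpace_fin, ← mul_inv, ← rpow_add h2π, add_halves, rpow_natCast,
        abs_of_pos (by positivity)]
    have h6 : ∫ v : Rn n, Complex.exp (((-2 * π * inner ℝ v x : ℝ) : ℂ) * Complex.I) •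
        (poissonMult n α a b v : ℂ) = ∫ v : Rn n,
        Complex.exp (Complex.I * (inner ℝ (-x) ((2 * π) • v) : ℝ)) * ρ ‖(2 * π) • v‖ := by
      refine integral_congr_ae (Eventually.of_forall fun v => ?_)
      simp only
      rw [hρm, smul_smul, inv_mul_cancel₀ h2π.ne', one_smul, smul_eq_mul, inner_smul_right,
        inner_neg_left, real_inner_comm v x]
      congr 2
      push_cast
      ring
    rw [h6, h4, h5, h2, Complex.real_smul, ← Complex.ofReal_mul]
    congr 1
    have := rpow_pos_of_pos h2π ((n : ℝ) / 2)
    generalize ∫ s in Set.Ioi (0 : ℝ), besselK ((α + 1) / 2) (b * s) /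
      besselK ((α + 1) / 2) (a * s) * s ^ ((n : ℝ) / 2) *
        besselJ (((n : ℝ) - 2) / 2) (‖x‖ * s) = I
    field_simp

end GASP

namespace GASP

open FourierTransform

/-! ### `𝒮'`-convolution of square integrable functions -/

/-- `g` is square integrable and is the Fourier transform of the bounded integrable function `m`. -/
structure IsFourierOf {n : ℕ} (g m : Rn n → ℝ) : Prop where
  memLp : MemLp g 2 volume
  integrable : Integrable m
  bounded : ∃ C, ∀ v, ‖m v‖ ≤ C
  eq : ∀ x, (g x : ℂ) = 𝓕 (fun v => (m v : ℂ)) x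

theorem isFourierOf_poissonKernel (n : ℕ) {α y : ℝ} (hα : -1 < α) (hy : 0 < y) :
    IsFourierOf (poissonKernel n α y)
      (fun v : Rn n => poissonProfile ((α + 1) / 2) (y * (π * ‖v‖))) where
  memLp := memLp_poissonKernel n hα hy
  integrable := integrable_poissonProfile_norm n hα hy
  bounded := ⟨_, fun v => by
    rw [norm_of_nonneg (poissonProfile_norm_pos n hα hy v).le]
    exact poissonProfile_norm_bound n hα hy v⟩
  eq := fun x => (fourier_fourier_poissonKernel n hα hy x).symm

theorem isFourierOf_quotKernel (n : ℕ) {α a b : ℝ} (hα : -1 < α) (ha : 0 < a) (hab : a < b) :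
    IsFourierOf (quotKernel n α a b) (poissonMult n α a b) where
  memLp := memLp_quotKernel n hα ha hab
  integrable := integrable_poissonMult n hα ha hab
  bounded := ⟨_, norm_poissonMult_le_const n hα ha hab⟩
  eq := ofReal_quotKernel n α a b

theorem IsFourierOf.continuous {n : ℕ} {g m : Rn n → ℝ} (h : IsFourierOf g m) : Continuous g := by
  have h1 := Complex.continuous_re.comp (continuous_fourier_of_integrable h.integrable.ofReal)
  refine h1.congr fun x => ?_
  exact (congrArg Complex.re (h.eq x)).symm.trans (Complex.ofReal_re _)

theorem reflConv_toDist {n : ℕ} {g : Rn n → ℝ} (hg : MemLp g 2 volume) (φ : 𝓢(Rn n, ℂ))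
    (t : Rn n) : reflConv (toDist g) φ t = ∫ x, φ (x + t) * (g x : ℂ) := by
  rw [reflConv, toDist_apply hg]
  simp only [SchwartzMap.compSubConstCLM_apply, sub_neg_eq_add]

/-- Convolution becomes a product. As m is bounded, the product decreases rapidly in the integrated
sense, which makes the multiplier of the 𝒮'-convolution smooth. -/
theorem IsFourierOf.reflConv_eq {n : ℕ} {g m : Rn n → ℝ} (h : IsFourierOf g m)
    (φ : 𝓢(Rn n, ℂ)) :
    reflConv (toDist g) φ = 𝓕⁻ (fun v => 𝓕 (φ : Rn n → ℂ) v * (m v : ℂ)) := by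
  funext t
  rw [reflConv_toDist h.memLp]
  simp only [h.eq]
  have h1 : ∀ x : Rn n, φ (x + t) = φ (x - -t) := fun x => by rw [sub_neg_eq_add]
  have hI : Integrable fun x : Rn n => φ (x - -t) := φ.integrable.comp_sub_right (-t)
  simp only [h1, mul_comm (φ _)]
  refine (integral_fourier_mul h.integrable.ofReal hI).trans ?_
  rw [Real.fourierInv_eq']
  refine integral_congr_ae (Eventually.of_forall fun v => ?_)
  simp only [fourier_comp_sub, smul_eq_mul, inner_neg_left, real_inner_comm v t]
  rw [show -2 * π * -inner ℝ v t = 2 * π * inner ℝ v t by ring]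
  rw [mul_left_comm]
  exact congrArg _ (mul_comm _ _)

theorem IsFourierOf.integrable_pow_mul {n : ℕ} {g m : Rn n → ℝ} (h : IsFourierOf g m)
    (φ : 𝓢(Rn n, ℂ)) (k : ℕ) :
    Integrable fun v : Rn n => ‖v‖ ^ k * ‖𝓕 (φ : Rn n → ℂ) v * (m v : ℂ)‖ := by
  obtain ⟨C, hC⟩ := h.bounded
  have h1 : Integrable fun v : Rn n => ‖v‖ ^ k * ‖𝓕 (φ : Rn n → ℂ) v‖ := by
    rw [← SchwartzMap.fourier_coe]
    exact (𝓕 φ).integrable_pow_mul volume k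
  refine (h1.mul_bdd (c := C) h.integrable.norm.aestronglyMeasurable
    (Eventually.of_forall fun v => by rw [norm_norm]; exact hC v)).congr
      (Eventually.of_forall fun v => ?_)
  simp only [norm_mul, Complex.norm_real]
  ring

theorem IsFourierOf.hasTemperateGrowth_reflConv {n : ℕ} {g m : Rn n → ℝ} (h : IsFourierOf g m)
    (φ : 𝓢(Rn n, ℂ)) : (reflConv (toDist g) φ).HasTemperateGrowth := by
  rw [h.reflConv_eq, Real.fourierInv_eq_fourier_comp_neg]
  have hm : AEStronglyMeasurable fun v : Rn n => 𝓕 (φ : Rn n → ℂ) v * (m v : ℂ) :=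
    (continuous_fourier_of_integrable φ.integrable).aestronglyMeasurable.mul
      h.integrable.ofReal.aestronglyMeasurable
  refine hasTemperateGrowth_fourier
    (hm.comp_measurePreserving (Measure.measurePreserving_neg volume)) fun k => ?_
  have := (h.integrable_pow_mul φ k).comp_neg
  simpa only [norm_neg] using this

/-- The bound |f g| ≤ (f² + g²) / 2 controls the integral in t uniformly in s, and φ is integrable
in s. -/
theorem integrable_mul_mul_comp_sub {n : ℕ} {f g : Rn n → ℝ} (hf : MemLp f 2 volume)
    (hfc : Continuous f) (hg : MemLp g 2 volume) (hgc : Continuous g) (φ : 𝓢(Rn n, ℂ)) :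
    Integrable (fun p : Rn n × Rn n => (f p.1 : ℂ) * (φ p.2 * (g (p.2 - p.1) : ℂ)))
      (volume.prod volume) := by
  have hm : AEStronglyMeasurable
      (fun p : Rn n × Rn n => (f p.1 : ℂ) * (φ p.2 * (g (p.2 - p.1) : ℂ)))
      (volume.prod volume) := by
    have := φ.continuous
    exact Continuous.aestronglyMeasurable (by fun_prop)
  have hf2 := hf.integrable_sq
  have hg2 := hg.integrable_sq
  have hfg : ∀ s, Integrable fun t => f t * g (s - t) := fun s =>
    convolutionExists_of_memLp hf hg s
  rw [integrable_prod_iff' hm]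
  refine ⟨Eventually.of_forall fun s => ?_, ?_⟩
  · refine ((hfg s).ofReal.mul_const (φ s)).congr (Eventually.of_forall fun t => ?_)
    simp only [Complex.coe_algebraMap, RCLike.ofReal_mul]
    ring_nf
  · refine (φ.integrable.norm.mul_const (((∫ t, f t ^ 2) + ∫ t, g t ^ 2) / 2)).mono'
      hm.norm.prod_swap.integral_prod_right' (Eventually.of_forall fun s => ?_)
    have h1 : ∀ t, ‖(f t : ℂ) * (φ s * (g (s - t) : ℂ))‖ = ‖φ s‖ * ‖f t * g (s - t)‖ := fun t => by
      simp only [norm_mul, Complex.norm_real]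
      ring
    simp only [h1]
    rw [norm_of_nonneg (by positivity), integral_const_mul]
    gcongr
    have hg3 : Integrable fun t => g (s - t) ^ 2 := hg2.comp_sub_left s
    have h2 : ∫ t, g (s - t) ^ 2 = ∫ t, g t ^ 2 :=
      integral_sub_left_eq_self (fun t => g t ^ 2) volume s
    rw [← h2, ← integral_add hf2 hg3, ← integral_div]
    refine integral_mono (hfg s).norm ((hf2.add hg3).div_const 2) fun t => ?_
    simp only [norm_eq_abs, abs_mul]
    nlinarith [sq_nonneg (|f t| - |g (s - t)|), sq_abs (f t), sq_abs (g (s - t))]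

theorem reflConv_toDist_eq_integral_sub {n : ℕ} {g : Rn n → ℝ} (hg : MemLp g 2 volume)
    (φ : 𝓢(Rn n, ℂ)) (t : Rn n) :
    reflConv (toDist g) φ t = ∫ s, φ s * (g (s - t) : ℂ) := by
  rw [reflConv_toDist hg]
  have := integral_add_right_eq_self (μ := (volume : Measure (Rn n)))
    (fun s => φ s * (g (s - t) : ℂ)) t
  simpa only [add_sub_cancel_right] using this

theorem tendsto_apply_of_tendstoLocallyUniformly {n : ℕ} {φ : ℕ → 𝓢(Rn n, ℂ)}
    (h : TendstoLocallyUniformly (fun j x => iteratedFDeriv ℝ 0 (φ j) x)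
      (iteratedFDeriv ℝ 0 (fun _ : Rn n => (1 : ℂ))) atTop) (x : Rn n) :
    Tendsto (fun j => φ j x) atTop (𝓝 1) := by
  have h1 := (tendstoLocallyUniformlyOn_univ.2 h).tendsto_at (Set.mem_univ x)
  have h2 : Continuous fun T : Rn n [×0]→L[ℝ] ℂ => T 0 := by fun_prop
  have h3 := (h2.tendsto _).comp h1
  simpa [Function.comp_def, iteratedFDeriv_zero_apply] using h3

/-- The product of f with the smooth multiplier is an integrable function. Hence the supremum
seminorm alone bounds it, its distributional integral is the ordinary one by dominated convergence,
and Fubini evaluates it. -/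
theorem isSConv_toDist {n : ℕ} {f g h m : Rn n → ℝ} (hf : MemLp f 2 volume) (hfc : Continuous f)
    (hg : IsFourierOf g m) (hh : MemLp h 2 volume)
    (hfg : h = (f ⋆[ContinuousLinearMap.mul ℝ ℝ, volume] g)) :
    IsSConv (toDist f) (toDist g) (toDist h) := by
  intro φ
  set R := reflConv (toDist g) φ with hR
  have hRt : R.HasTemperateGrowth := hg.hasTemperateGrowth_reflConv φ
  have hI := integrable_mul_mul_comp_sub hf hfc hg.memLp hg.continuous φ
  have hRf : ∀ t, ∫ s, (f t : ℂ) * (φ s * (g (s - t) : ℂ)) = R t * f t := fun t => by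
    rw [integral_const_mul, hR, reflConv_toDist_eq_integral_sub hg.memLp, mul_comm]
  have hRI : Integrable fun t => R t * f t := by
    have := hI.integral_prod_left
    simp only [hRf] at this
    exact this
  have happ : ∀ χ : 𝓢(Rn n, ℂ), TemperedDistribution.smulLeftCLM ℂ R (toDist f) χ
      = ∫ t, χ t * (R t * f t) := fun χ => by
    rw [TemperedDistribution.smulLeftCLM_apply_apply, toDist_apply hf]
    simp only [SchwartzMap.smulLeftCLM_apply_apply hRt, smul_eq_mul]
    refine integral_congr_ae (Eventually.of_forall fun t => ?_)
    simp only
    ring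
  refine ⟨⟨0, ∫ t, ‖R t * f t‖, fun χ => ?_⟩, fun χ hχ1 hχ2 => ?_⟩
  · rw [happ, zero_add, Finset.sum_range_one, ← integral_mul_const]
    refine norm_integral_le_of_norm_le (hRI.norm.mul_const _) (Eventually.of_forall fun t => ?_)
    rw [norm_mul, mul_comm]
    gcongr
    exact SchwartzMap.norm_le_seminorm ℂ χ t
  · have hlim : toDist h φ = ∫ t, R t * f t := by
      rw [toDist_apply hh]
      simp only [← hRf]
      rw [integral_integral_swap hI]
      refine integral_congr_ae (Eventually.of_forall fun s => ?_)
      simp only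
      rw [hfg, convolution_def, ← integral_complex_ofReal, ← integral_const_mul]
      refine integral_congr_ae (Eventually.of_forall fun t => ?_)
      simp only [ContinuousLinearMap.mul_apply', Complex.ofReal_mul]
      ring
    rw [hlim]
    simp only [happ]
    obtain ⟨C, hC⟩ := hχ1 0
    refine tendsto_integral_of_dominated_convergence (fun t => C * ‖R t * f t‖)
      (fun j => (χ j).continuous.aestronglyMeasurable.mul hRI.aestronglyMeasurable)
      (hRI.norm.const_mul C) (fun j => Eventually.of_forall fun t => ?_)
      (Eventually.of_forall fun t => ?_)
    · rw [norm_mul]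
      gcongr
      exact (SchwartzMap.norm_le_seminorm ℂ (χ j) t).trans (hC j)
    · have := (tendsto_apply_of_tendstoLocallyUniformly (hχ2 0) t).mul_const (R t * f t)
      rwa [one_mul] at this

end GASP

namespace GASP

/-! ### Dilations and multiplications of Schwartz functions -/

section Dilation

variable {V : Type*} [NormedAddCommGroup V] [NormedSpace ℝ V]

/-- The dilation `x ↦ χ (a x)` of a Schwartz function. -/
noncomputable def dilate (a : ℝˣ) : 𝓢(V, ℂ) →L[ℂ] 𝓢(V, ℂ) :=
  SchwartzMap.compCLMOfContinuousLinearEquiv ℂ (ContinuousLinearEquiv.smulLeft (R₁ := ℝ) a)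

theorem dilate_apply (a : ℝˣ) (χ : 𝓢(V, ℂ)) (x : V) : dilate a χ x = χ ((a : ℝ) • x) := rfl

theorem iteratedFDeriv_dilate (a : ℝˣ) (χ : 𝓢(V, ℂ)) (i : ℕ) (x : V) :
    iteratedFDeriv ℝ i (dilate a χ) x = (a : ℝ) ^ i • iteratedFDeriv ℝ i χ ((a : ℝ) • x) := by
  have h := iteratedFDeriv_comp_const_smul (𝕜 := ℝ) (i := i) (f := (χ : V → ℂ)) (a : ℝ)
    (χ.smooth i)
  exact congrFun h x

theorem norm_iteratedFDeriv_dilate_le (a : ℝˣ) (χ : 𝓢(V, ℂ)) (i : ℕ) (x : V) :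
    ‖iteratedFDeriv ℝ i (dilate a χ) x‖ ≤ |(a : ℝ)| ^ i * SchwartzMap.seminorm ℂ 0 i χ := by
  rw [iteratedFDeriv_dilate, norm_smul, norm_pow, norm_eq_abs]
  gcongr
  exact SchwartzMap.norm_iteratedFDeriv_le_seminorm ℂ χ i _

/-- Leibniz' rule, with the weight 1 + ‖x‖ absorbed by one more power in the seminorms of ψ. The
weight is there because a dilated cutoff is close to its value at 0 only locally. -/
theorem seminorm_smulLeftCLM_le {f : V → ℂ} (hf : f.HasTemperateGrowth) (ψ : 𝓢(V, ℂ)) (k l : ℕ)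
    {B : ℝ} (hB : ∀ i ≤ l, ∀ x, ‖iteratedFDeriv ℝ i f x‖ ≤ B * (1 + ‖x‖)) :
    SchwartzMap.seminorm ℂ k l (SchwartzMap.smulLeftCLM ℂ f ψ) ≤
      B * ∑ i ∈ Finset.range (l + 1), (l.choose i : ℝ) *
        (SchwartzMap.seminorm ℂ k (l - i) ψ + SchwartzMap.seminorm ℂ (k + 1) (l - i) ψ) := by
  have hB0 : 0 ≤ B := by
    have := (norm_nonneg _).trans (hB 0 (Nat.zero_le _) 0)
    simpa using this
  refine SchwartzMap.seminorm_le_bound ℂ k l _ (by positivity) fun x => ?_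
  have h1 : (SchwartzMap.smulLeftCLM ℂ f ψ : V → ℂ) = fun y => f y * ψ y := by
    funext y
    rw [SchwartzMap.smulLeftCLM_apply_apply hf, smul_eq_mul]
  rw [h1]
  have h2 := norm_iteratedFDeriv_mul_le (𝕜 := ℝ) (N := l) (n := l)
    (hf.1.of_le (by exact_mod_cast le_top)) (ψ.smooth l) x le_rfl
  refine (mul_le_mul_of_nonneg_left h2 (by positivity)).trans ?_
  rw [Finset.mul_sum, Finset.mul_sum]
  refine Finset.sum_le_sum fun i hi => ?_
  have h3 := hB i (by simpa [Nat.lt_succ_iff] using hi) x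
  have h4 := SchwartzMap.le_seminorm ℂ k (l - i) ψ x
  have h5 := SchwartzMap.le_seminorm ℂ (k + 1) (l - i) ψ x
  calc ‖x‖ ^ k * ((l.choose i : ℝ) * ‖iteratedFDeriv ℝ i f x‖ * ‖iteratedFDeriv ℝ (l - i) ψ x‖)
      ≤ ‖x‖ ^ k * ((l.choose i : ℝ) * (B * (1 + ‖x‖)) * ‖iteratedFDeriv ℝ (l - i) ψ x‖) := by
        gcongr
    _ = B * ((l.choose i : ℝ) * (‖x‖ ^ k * ‖iteratedFDeriv ℝ (l - i) ψ x‖ +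
          ‖x‖ ^ (k + 1) * ‖iteratedFDeriv ℝ (l - i) ψ x‖)) := by ring
    _ ≤ _ := by gcongr

theorem norm_dilate_sub_le (a : ℝˣ) (χ : 𝓢(V, ℂ)) (x : V) :
    ‖dilate a χ x - χ 0‖ ≤ SchwartzMap.seminorm ℂ 0 1 χ * (|(a : ℝ)| * ‖x‖) := by
  have h := Convex.norm_image_sub_le_of_norm_fderiv_le (𝕜 := ℝ) (f := (χ : V → ℂ))
    (s := Set.univ) (x := 0) (y := (a : ℝ) • x) (C := SchwartzMap.seminorm ℂ 0 1 χ)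
    (fun y _ => χ.differentiableAt) (fun y _ => ?_) convex_univ trivial trivial
  · rwa [sub_zero, norm_smul, norm_eq_abs] at h
  · have := SchwartzMap.norm_iteratedFDeriv_le_seminorm ℂ χ 1 y
    rwa [norm_iteratedFDeriv_one] at this

/-- The positive numbers `1 / (j + 1)`. -/
noncomputable def invSucc (j : ℕ) : ℝˣ := Units.mk0 (1 / ((j : ℝ) + 1)) (by positivity)

theorem invSucc_pos (j : ℕ) : (0 : ℝ) < invSucc j := by
  simp only [invSucc, Units.val_mk0]; positivity

theorem invSucc_le_one (j : ℕ) : (invSucc j : ℝ) ≤ 1 := by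
  simp only [invSucc, Units.val_mk0]
  rw [div_le_one (by positivity)]
  linarith [(Nat.cast_nonneg j : (0 : ℝ) ≤ j)]

theorem tendsto_invSucc : Tendsto (fun j => (invSucc j : ℝ)) atTop (𝓝 0) :=
  tendsto_one_div_add_atTop_nhds_zero_nat

/-- The mean value inequality handles i = 0 and costs a factor ‖x‖; for i ≥ 1 the chain rule gives a
^ i, at most |a| in absolute value. -/
theorem norm_iteratedFDeriv_dilate_sub_le {a : ℝˣ} (ha : |(a : ℝ)| ≤ 1) (χ : 𝓢(V, ℂ)) (i : ℕ)
    (x : V) : ‖iteratedFDeriv ℝ i (fun x => dilate a χ x - χ 0) x‖ ≤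
      |(a : ℝ)| * (SchwartzMap.seminorm ℂ 0 1 χ + SchwartzMap.seminorm ℂ 0 i χ) * (1 + ‖x‖) := by
  rcases Nat.eq_zero_or_pos i with rfl | hi
  · rw [norm_iteratedFDeriv_zero]
    refine (norm_dilate_sub_le a χ x).trans ?_
    have h1 : 0 ≤ SchwartzMap.seminorm ℂ 0 1 χ := by positivity
    have h2 : 0 ≤ SchwartzMap.seminorm ℂ 0 0 χ := by positivity
    nlinarith [mul_nonneg (abs_nonneg (a : ℝ)) h1, mul_nonneg (abs_nonneg (a : ℝ)) h2,
      mul_nonneg (mul_nonneg (abs_nonneg (a : ℝ)) h2) (norm_nonneg x)]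
  · have h1 : iteratedFDeriv ℝ i (fun x => dilate a χ x - χ 0) x
        = iteratedFDeriv ℝ i (dilate a χ) x := by
      have := fun_iteratedFDeriv_sub_apply (𝕜 := ℝ) (i := i) (f := dilate a χ)
        (g := fun _ : V => χ 0) (x := x) ((dilate a χ).contDiffAt i) contDiffAt_const
      rw [this, iteratedFDeriv_const_of_ne hi.ne']
      simp
    rw [h1]
    refine (norm_iteratedFDeriv_dilate_le a χ i x).trans ?_
    have h2 : |(a : ℝ)| ^ i ≤ |(a : ℝ)| := pow_le_of_le_one (abs_nonneg _) ha hi.ne'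
    have h3 : 0 ≤ SchwartzMap.seminorm ℂ 0 1 χ := by positivity
    have h4 : 0 ≤ SchwartzMap.seminorm ℂ 0 i χ := by positivity
    calc _ ≤ |(a : ℝ)| * SchwartzMap.seminorm ℂ 0 i χ := by gcongr
      _ ≤ |(a : ℝ)| * (SchwartzMap.seminorm ℂ 0 1 χ + SchwartzMap.seminorm ℂ 0 i χ) := by
        gcongr; linarith
      _ ≤ _ := le_mul_of_one_le_right (by positivity) (by linarith [norm_nonneg x])

theorem tendsto_smulLeftCLM_dilate {χ : 𝓢(V, ℂ)} (hχ : χ 0 = 1) (ψ : 𝓢(V, ℂ)) :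
    Tendsto (fun j => SchwartzMap.smulLeftCLM ℂ (dilate (invSucc j) χ) ψ) atTop (𝓝 ψ) := by
  rw [(schwartz_withSeminorms ℂ V ℂ).tendsto_nhds]
  rintro ⟨k, l⟩ ε hε
  set S := ∑ i ∈ Finset.range (l + 1),
    (SchwartzMap.seminorm ℂ 0 1 χ + SchwartzMap.seminorm ℂ 0 i χ) with hS
  set C := ∑ i ∈ Finset.range (l + 1), (l.choose i : ℝ) *
        (SchwartzMap.seminorm ℂ k (l - i) ψ + SchwartzMap.seminorm ℂ (k + 1) (l - i) ψ) with hC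
  have hlim : Tendsto (fun j => (invSucc j : ℝ) * S * C) atTop (𝓝 0) := by
    simpa using (tendsto_invSucc.mul_const S).mul_const C
  filter_upwards [hlim.eventually_lt_const hε] with j hj
  refine lt_of_le_of_lt ?_ hj
  have hd : (fun x => dilate (invSucc j) χ x - χ 0).HasTemperateGrowth := by
    have := (dilate (invSucc j) χ).hasTemperateGrowth
    fun_prop
  have h1 : SchwartzMap.smulLeftCLM ℂ (dilate (invSucc j) χ) ψ - ψ
      = SchwartzMap.smulLeftCLM ℂ (fun x => dilate (invSucc j) χ x - χ 0) ψ := by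
    ext x
    rw [SchwartzMap.smulLeftCLM_apply_apply hd, sub_apply,
      SchwartzMap.smulLeftCLM_apply_apply (dilate (invSucc j) χ).hasTemperateGrowth, hχ]
    simp only [smul_eq_mul]
    ring
  rw [h1]
  refine seminorm_smulLeftCLM_le hd ψ k l fun i hi x => ?_
  have ha : |(invSucc j : ℝ)| = invSucc j := abs_of_pos (invSucc_pos j)
  have h2 := norm_iteratedFDeriv_dilate_sub_le (by rw [ha]; exact invSucc_le_one j) χ i x
  rw [ha] at h2
  refine h2.trans ?_
  have := (invSucc_pos j).le
  gcongr
  exact Finset.single_le_sum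
    (f := fun i => SchwartzMap.seminorm ℂ 0 1 χ + SchwartzMap.seminorm ℂ 0 i χ)
    (fun _ _ => by positivity) (Finset.mem_range.2 (Nat.lt_succ_of_le hi))

theorem seminorm_dilate_invSucc_le (χ : 𝓢(V, ℂ)) (k j : ℕ) :
    SchwartzMap.seminorm ℂ 0 k (dilate (invSucc j) χ) ≤ SchwartzMap.seminorm ℂ 0 k χ := by
  refine SchwartzMap.seminorm_le_bound ℂ 0 k _ (by positivity) fun x => ?_
  rw [pow_zero, one_mul]
  refine (norm_iteratedFDeriv_dilate_le _ χ k x).trans ?_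
  rw [abs_of_pos (invSucc_pos j)]
  exact mul_le_of_le_one_left (by positivity) (pow_le_one₀ (invSucc_pos j).le (invSucc_le_one j))

theorem tendstoLocallyUniformly_dilate {χ : 𝓢(V, ℂ)} (hχ : χ 0 = 1) (k : ℕ) :
    TendstoLocallyUniformly (fun j x => iteratedFDeriv ℝ k (dilate (invSucc j) χ) x)
      (iteratedFDeriv ℝ k (fun _ : V => (1 : ℂ))) atTop := by
  rw [Metric.tendstoLocallyUniformly_iff]
  intro ε hε x₀
  refine ⟨Metric.ball x₀ 1, Metric.ball_mem_nhds x₀ one_pos, ?_⟩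
  set C := (SchwartzMap.seminorm ℂ 0 1 χ + SchwartzMap.seminorm ℂ 0 k χ) * (1 + (‖x₀‖ + 1))
  have hlim : Tendsto (fun j => (invSucc j : ℝ) * C) atTop (𝓝 0) := by
    simpa using tendsto_invSucc.mul_const C
  filter_upwards [hlim.eventually_lt_const hε] with j hj x hx
  refine lt_of_le_of_lt ?_ hj
  have ha : |(invSucc j : ℝ)| = invSucc j := abs_of_pos (invSucc_pos j)
  have h2 := norm_iteratedFDeriv_dilate_sub_le (by rw [ha]; exact invSucc_le_one j) χ k x
  have h3 := fun_iteratedFDeriv_sub_apply (𝕜 := ℝ) (i := k) (f := dilate (invSucc j) χ)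
        (g := fun _ : V => χ 0) (x := x) ((dilate (invSucc j) χ).contDiffAt k) contDiffAt_const
  rw [h3, ha, hχ] at h2
  rw [dist_comm, dist_eq_norm]
  refine h2.trans ?_
  have hx' : ‖x‖ ≤ ‖x₀‖ + 1 := by
    have := norm_sub_norm_le x x₀
    rw [mem_ball_iff_norm] at hx
    linarith
  rw [mul_assoc]
  have := (invSucc_pos j).le
  gcongr
  · exact mul_le_mul_of_nonneg_left (by linarith) (by positivity)

end Dilation

end GASP

namespace GASP

/-! ### Division by coordinates -/

theorem hasFDerivAt_integral_pow_smul {E F : Type} [NormedAddCommGroup E] [NormedSpace ℝ E]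
    [ProperSpace E] [NormedAddCommGroup F] [NormedSpace ℝ F] {g : E → F}
    (hg : ContDiff ℝ ∞ g) (p : ℕ) (x₀ : E) :
    HasFDerivAt (fun x => ∫ t in (0 : ℝ)..1, t ^ p • g (t • x))
      (∫ t in (0 : ℝ)..1, t ^ (p + 1) • fderiv ℝ g (t • x₀)) x₀ := by
  have hc : Continuous g := hg.continuous
  have hc' : Continuous (fderiv ℝ g) := hg.continuous_fderiv (by simp)
  obtain ⟨C, hC⟩ := (isCompact_closedBall (0 : E) (‖x₀‖ + 1)).exists_bound_of_continuousOn
    hc'.continuousOn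
  refine intervalIntegral.hasFDerivAt_integral_of_dominated_of_fderiv_le (bound := fun _ => C)
    (F' := fun x t => t ^ (p + 1) • fderiv ℝ g (t • x))
    (Metric.ball_mem_nhds x₀ one_pos) (Eventually.of_forall fun x => ?_) ?_ ?_ ?_ (by simp) ?_
  · exact Continuous.aestronglyMeasurable (by fun_prop)
  · exact Continuous.intervalIntegrable (by fun_prop) _ _
  · exact Continuous.aestronglyMeasurable (by fun_prop)
  · refine Eventually.of_forall fun t ht x hx => ?_
    rw [Set.uIoc_of_le zero_le_one] at ht
    have hx' : ‖x‖ ≤ ‖x₀‖ + 1 := by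
      have := norm_sub_norm_le x x₀
      rw [mem_ball_iff_norm] at hx
      linarith
    have h1 : ‖fderiv ℝ g (t • x)‖ ≤ C := by
      refine hC _ ?_
      rw [mem_closedBall_zero_iff, norm_smul, norm_of_nonneg ht.1.le]
      exact (mul_le_of_le_one_left (norm_nonneg _) ht.2).trans hx'
    rw [norm_smul, norm_pow, norm_of_nonneg ht.1.le]
    exact (mul_le_of_le_one_left (norm_nonneg _) (pow_le_one₀ ht.1.le ht.2)).trans h1
  · refine Eventually.of_forall fun t _ x _ => ?_
    have h1 : HasFDerivAt g (fderiv ℝ g (t • x)) (t • x) :=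
      (hg.differentiable (by simp) _).hasFDerivAt
    have h2 := (h1.comp x ((hasFDerivAt_id x).const_smul t)).const_smul (t ^ p)
    refine h2.congr_fderiv ?_
    ext v
    simp [pow_succ, smul_smul]

/-- Each derivative brings out a factor t and passes from g to its derivative, so the induction runs
over all exponents p and all target spaces. -/
theorem contDiff_integral_pow_smul {E F : Type} [NormedAddCommGroup E] [NormedSpace ℝ E]
    [ProperSpace E] [NormedAddCommGroup F] [NormedSpace ℝ F] {g : E → F}
    (hg : ContDiff ℝ ∞ g) (p k : ℕ) :
    ContDiff ℝ k (fun x => ∫ t in (0 : ℝ)..1, t ^ p • g (t • x)) := by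
  induction k generalizing F p with
  | zero =>
    refine contDiff_zero.2 (continuous_iff_continuousAt.2 fun x => ?_)
    exact (hasFDerivAt_integral_pow_smul hg p x).continuousAt
  | succ k ih =>
    rw [Nat.cast_add, Nat.cast_one, contDiff_succ_iff_hasFDerivAt]
    refine ⟨fun x => ∫ t in (0 : ℝ)..1, t ^ (p + 1) • fderiv ℝ g (t • x), ?_,
      hasFDerivAt_integral_pow_smul hg p⟩
    exact ih (hg.fderiv_right (by simp)) (p + 1)

/-- Hadamard's lemma: the fundamental theorem of calculus along the segment from 0 to x. -/
theorem sub_eq_fderiv_integral {E F : Type} [NormedAddCommGroup E] [NormedSpace ℝ E]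
    [NormedAddCommGroup F] [NormedSpace ℝ F] [CompleteSpace F] {g : E → F}
    (hg : ContDiff ℝ ∞ g) (x : E) :
    g x - g 0 = (∫ t in (0 : ℝ)..1, fderiv ℝ g (t • x)) x := by
  have hc' : Continuous (fderiv ℝ g) := hg.continuous_fderiv (by simp)
  have hci : Continuous fun t : ℝ => fderiv ℝ g (t • x) := by fun_prop
  rw [ContinuousLinearMap.intervalIntegral_apply (hci.intervalIntegrable 0 1)]
  have h := intervalIntegral.integral_eq_sub_of_hasDerivAt (a := 0) (b := 1)
    (f := fun t : ℝ => g (t • x)) (f' := fun t => fderiv ℝ g (t • x) x) (fun t _ => ?_)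
    ((hci.clm_apply continuous_const).intervalIntegrable 0 1)
  · rw [h, one_smul, zero_smul]
  · have h1 : HasFDerivAt g (fderiv ℝ g (t • x)) (t • x) :=
      (hg.differentiable (by simp) _).hasFDerivAt
    have h2 := h1.comp_hasDerivAt t ((hasDerivAt_id t).smul_const x)
    simpa [Function.comp_def] using h2

/-! ### Tempered distributions supported at the origin -/

/-- A Schwartz function with compact support that is equal to one near the origin. -/
theorem exists_schwartz_bump (n : ℕ) : ∃ θ : 𝓢(Rn n, ℂ), HasCompactSupport θ ∧ θ =ᶠ[𝓝 0] 1 := by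
  let b : ContDiffBump (0 : Rn n) := ⟨1, 2, one_pos, one_lt_two⟩
  have h1 : HasCompactSupport (fun x => (b x : ℂ)) := 
    b.hasCompactSupport.comp_left (g := fun r : ℝ => (r : ℂ)) Complex.ofReal_zero
  have h2 : ContDiff ℝ ∞ (fun x => (b x : ℂ)) := Complex.ofRealCLM.contDiff.comp b.contDiff
  refine ⟨h1.toSchwartzMap h2, h1, ?_⟩
  filter_upwards [b.eventuallyEq_one] with x hx
  change ((b x : ℝ) : ℂ) = 1
  rw [hx]
  simp

/-- The tempered distribution vanishes on Schwartz functions that are zero near the origin. -/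
def SupportedAtZero {n : ℕ} (T : 𝓢'(Rn n, ℂ)) : Prop :=
  ∀ χ : 𝓢(Rn n, ℂ), χ =ᶠ[𝓝 0] 0 → T χ = 0

theorem hasTemperateGrowth_inner {n : ℕ} (m : Rn n) :
    (fun x : Rn n => ((inner ℝ x m : ℝ) : ℂ)).HasTemperateGrowth := by fun_prop

theorem SupportedAtZero.exists_eq_mul {n : ℕ} {T : 𝓢'(Rn n, ℂ)} (hT : SupportedAtZero T)
    (h : ∀ m : Rn n, ∀ χ : 𝓢(Rn n, ℂ),
      T (SchwartzMap.smulLeftCLM ℂ (fun x => ((inner ℝ x m : ℝ) : ℂ)) χ) = 0) :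
    ∃ c : ℂ, ∀ χ : 𝓢(Rn n, ℂ), T χ = c * χ 0 := by
  obtain ⟨θ, hθc, hθ1⟩ := exists_schwartz_bump n
  refine ⟨T θ, fun χ => ?_⟩
  let e := EuclideanSpace.basisFun (Fin n) ℝ
  set G : Rn n → Rn n →L[ℝ] ℂ := fun x => ∫ t in (0 : ℝ)..1, fderiv ℝ χ (t • x) with hG
  have hχ : ContDiff ℝ ∞ χ := χ.smooth ⊤
  have hGs : ContDiff ℝ ∞ G := by
    refine contDiff_infty.2 fun k => ?_
    have := contDiff_integral_pow_smul (hχ.fderiv_right (m := ∞) (by simp)) 0 k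
    simpa using this
  have hGi : ∀ i, ContDiff ℝ ∞ fun x => θ x * G x (e i) := fun i =>
    (θ.smooth ⊤).mul (hGs.clm_apply contDiff_const)
  have hGc : ∀ i, HasCompactSupport fun x => θ x * G x (e i) := fun i => hθc.mul_right
  set Φ : Fin n → 𝓢(Rn n, ℂ) := fun i => (hGc i).toSchwartzMap (hGi i) with hΦ
  have hsum : ∀ x, χ x - χ 0 = ∑ i, ((inner ℝ x (e i) : ℝ) : ℂ) * G x (e i) := fun x => by
    rw [sub_eq_fderiv_integral hχ x]
    refine (congrArg (G x) (e.sum_repr' x).symm).trans ?_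
    rw [map_sum]
    refine Finset.sum_congr rfl fun i _ => ?_
    rw [map_smul, real_inner_comm]
    simp
  -- Hadamard's decomposition, cut off by θ so that every piece is a Schwartz function. The first
  -- piece vanishes near 0 and the sum consists of multiples of coordinates, so T sees only the
  -- middle piece.
  have key : χ = (χ - SchwartzMap.smulLeftCLM ℂ θ χ) + χ 0 • θ +
      ∑ i, SchwartzMap.smulLeftCLM ℂ (fun x => ((inner ℝ x (e i) : ℝ) : ℂ)) (Φ i) := by
    ext x
    have h1 : (∑ i, SchwartzMap.smulLeftCLM ℂ (fun x => ((inner ℝ x (e i) : ℝ) : ℂ)) (Φ i)) x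
        = θ x * (χ x - χ 0) := by
      rw [hsum, Finset.mul_sum, sum_apply]
      refine Finset.sum_congr rfl fun i _ => ?_
      rw [SchwartzMap.smulLeftCLM_apply_apply (hasTemperateGrowth_inner _)]
      change _ * (θ x * G x (e i)) = _
      ring
    rw [add_apply, add_apply, h1, sub_apply, smul_apply,
      SchwartzMap.smulLeftCLM_apply_apply θ.hasTemperateGrowth]
    simp only [smul_eq_mul]
    ring
  have h0 : T (χ - SchwartzMap.smulLeftCLM ℂ θ χ) = 0 := by
    refine hT _ ?_
    filter_upwards [hθ1] with x hx
    rw [sub_apply, SchwartzMap.smulLeftCLM_apply_apply θ.hasTemperateGrowth, hx]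
    simp
  calc T χ = T ((χ - SchwartzMap.smulLeftCLM ℂ θ χ) + χ 0 • θ +
      ∑ i, SchwartzMap.smulLeftCLM ℂ (fun x => ((inner ℝ x (e i) : ℝ) : ℂ)) (Φ i)) := by
        rw [← key]
    _ = T θ * χ 0 := by
      rw [map_add, map_add, map_sum, map_smul, h0]
      simp only [h, Finset.sum_const_zero, smul_eq_mul]
      ring

theorem exists_bound_of_temperedDistribution {n : ℕ} (T : 𝓢'(Rn n, ℂ)) :
    ∃ (s : Finset (ℕ × ℕ)) (C : ℝ), 0 ≤ C ∧ ∀ χ : 𝓢(Rn n, ℂ),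
      ‖T χ‖ ≤ C * ∑ i ∈ s, SchwartzMap.seminorm ℂ i.1 i.2 χ := by
  have hq : Continuous ((normSeminorm ℂ ℂ).comp (T : 𝓢(Rn n, ℂ) →ₗ[ℂ] ℂ)) :=
    continuous_norm.comp (map_continuous T)
  obtain ⟨s, C, -, hC⟩ := Seminorm.bound_of_continuous
    (schwartz_withSeminorms ℂ (Rn n) ℂ) _ hq
  refine ⟨s, C, C.2, fun χ => (hC χ).trans ?_⟩
  have h1 := Seminorm.finset_sup_le_sum (schwartzSeminormFamily ℂ (Rn n) ℂ) s χ
  rw [sum_apply] at h1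
  exact mul_le_mul_of_nonneg_left h1 C.2

/-- T has a finite order N, and shrinking a cutoff by a ≥ 1 costs a ^ i for i derivatives. This
starts the induction below. -/
theorem exists_pow_mul_norm_dilate_le {n : ℕ} (T : 𝓢'(Rn n, ℂ)) :
    ∃ N : ℕ, ∀ q χ : 𝓢(Rn n, ℂ), ∃ C : ℝ, ∀ a : ℝˣ, 1 ≤ (a : ℝ) →
      ‖T (SchwartzMap.smulLeftCLM ℂ (dilate a q) χ)‖ ≤ C * (a : ℝ) ^ N := by
  obtain ⟨s, C, hC0, hC⟩ := exists_bound_of_temperedDistribution T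
  set N := s.sup Prod.snd with hN
  refine ⟨N, fun q χ => ?_⟩
  set S := ∑ i ∈ Finset.range (N + 1), SchwartzMap.seminorm ℂ 0 i q with hS
  set D : ℕ × ℕ → ℝ := fun p => ∑ i ∈ Finset.range (p.2 + 1), (p.2.choose i : ℝ) *
        (SchwartzMap.seminorm ℂ p.1 (p.2 - i) χ + SchwartzMap.seminorm ℂ (p.1 + 1) (p.2 - i) χ)
  refine ⟨C * (S * ∑ p ∈ s, D p), fun a ha => (hC _).trans ?_⟩
  rw [mul_assoc]
  refine mul_le_mul_of_nonneg_left ?_ hC0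
  rw [mul_right_comm, Finset.mul_sum]
  refine Finset.sum_le_sum fun p hp => ?_
  refine seminorm_smulLeftCLM_le (dilate a q).hasTemperateGrowth χ p.1 p.2 fun i hi x => ?_
  have hiN : i ≤ N := hi.trans (Finset.le_sup (f := Prod.snd) hp)
  refine (norm_iteratedFDeriv_dilate_le a q i x).trans ?_
  have h1 : SchwartzMap.seminorm ℂ 0 i q ≤ S :=
    Finset.single_le_sum (f := fun i => SchwartzMap.seminorm ℂ 0 i q)
      (fun _ _ => by positivity) (Finset.mem_range.2 (Nat.lt_succ_of_le hiN))
  have h2 : |(a : ℝ)| ^ i ≤ (a : ℝ) ^ N := by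
    rw [abs_of_pos (by linarith)]
    exact pow_le_pow_right₀ ha hiN
  have h3 : 0 ≤ SchwartzMap.seminorm ℂ 0 i q := by positivity
  have h4 : 0 ≤ (a : ℝ) ^ N := by positivity
  calc |(a : ℝ)| ^ i * SchwartzMap.seminorm ℂ 0 i q ≤ (a : ℝ) ^ N * S := by gcongr
    _ = S * (a : ℝ) ^ N := mul_comm _ _
    _ ≤ _ := le_mul_of_one_le_right (mul_nonneg (h3.trans h1) h4) (by linarith [norm_nonneg x])

/-- A class of tempered distributions supported at the origin that is stable under multiplication
by linear forms and contains no non-zero multiple of the Dirac distribution is trivial. -/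
theorem eq_zero_of_supportedAtZero {n : ℕ} {P : 𝓢'(Rn n, ℂ) → Prop}
    (hmul : ∀ T m, P T →
      P (TemperedDistribution.smulLeftCLM ℂ (fun x => ((inner ℝ x m : ℝ) : ℂ)) T))
    (hsupp : ∀ T, P T → SupportedAtZero T)
    (hdirac : ∀ T, P T → ∀ c : ℂ, (∀ χ : 𝓢(Rn n, ℂ), T χ = c * χ 0) → c = 0)
    {T : 𝓢'(Rn n, ℂ)} (hT : P T) : T = 0 := by
  obtain ⟨θ, -, hθ1⟩ := exists_schwartz_bump n
  -- The bound says that T grows at most like a ^ (s - 1) on cutoffs at scale 1 / a; the extra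
  -- factor a on the left lets s start at 0.
  have main : ∀ (s : ℕ) (T : 𝓢'(Rn n, ℂ)), P T → (∀ q χ : 𝓢(Rn n, ℂ), ∃ C : ℝ, ∀ a : ℝˣ,
      1 ≤ (a : ℝ) → (a : ℝ) * ‖T (SchwartzMap.smulLeftCLM ℂ (dilate a q) χ)‖
        ≤ C * (a : ℝ) ^ s) → T = 0 := by
    intro s
    induction s with
    | zero =>
      intro T hT hb
      ext χ
      obtain ⟨C, hC⟩ := hb θ χ
      -- The dilated cutoff equals one near 0, so the value does not depend on a, while the bound
      -- makes it O(1 / a); hence it is zero.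
      have h1 : ∀ a : ℝˣ, T (SchwartzMap.smulLeftCLM ℂ (dilate a θ) χ) = T χ := fun a => by
        rw [← sub_eq_zero, ← map_sub]
        refine hsupp T hT _ ?_
        have h2 : Tendsto (fun x : Rn n => (a : ℝ) • x) (𝓝 0) (𝓝 0) := by
          have : Continuous fun x : Rn n => (a : ℝ) • x := by fun_prop
          simpa using this.tendsto 0
        filter_upwards [h2.eventually hθ1] with x hx
        rw [sub_apply, SchwartzMap.smulLeftCLM_apply_apply (dilate a θ).hasTemperateGrowth,
          dilate_apply, hx]
        simp
      simp only [h1, pow_zero, mul_one] at hC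
      by_contra hne
      have hpos : 0 < ‖T χ‖ := norm_pos_iff.2 hne
      have hA : 0 < max 1 (C / ‖T χ‖ + 1) := lt_of_lt_of_le one_pos (le_max_left _ _)
      have h3 := hC (Units.mk0 _ hA.ne') (le_max_left _ _)
      have h4 : C / ‖T χ‖ + 1 ≤ max 1 (C / ‖T χ‖ + 1) := le_max_right _ _
      have h5 := mul_le_mul_of_nonneg_right h4 hpos.le
      rw [add_mul, div_mul_cancel₀ _ hpos.ne'] at h5
      simp only [Units.val_mk0] at h3
      linarith
    | succ s ih =>
      intro T hT hb
      have h0 : ∀ m : Rn n, TemperedDistribution.smulLeftCLM ℂ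
          (fun x => ((inner ℝ x m : ℝ) : ℂ)) T = 0 := fun m => by
        refine ih _ (hmul T m hT) fun q χ => ?_
        obtain ⟨C, hC⟩ := hb
          (SchwartzMap.smulLeftCLM ℂ (fun x => ((inner ℝ x m : ℝ) : ℂ)) q) χ
        refine ⟨C, fun a ha => ?_⟩
        have ha0 : (0 : ℝ) < a := by linarith
        -- A linear form inside the dilated cutoff yields a factor a, so multiplying T by the form
        -- lowers the growth exponent by one.
        have h1 : SchwartzMap.smulLeftCLM ℂ (dilate a
            (SchwartzMap.smulLeftCLM ℂ (fun x => ((inner ℝ x m : ℝ) : ℂ)) q)) χ =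
            ((a : ℝ) : ℂ) • SchwartzMap.smulLeftCLM ℂ (fun x => ((inner ℝ x m : ℝ) : ℂ))
              (SchwartzMap.smulLeftCLM ℂ (dilate a q) χ) := by
          ext x
          rw [smul_apply, SchwartzMap.smulLeftCLM_apply_apply (hasTemperateGrowth_inner m),
            SchwartzMap.smulLeftCLM_apply_apply (SchwartzMap.hasTemperateGrowth _),
            SchwartzMap.smulLeftCLM_apply_apply (SchwartzMap.hasTemperateGrowth _), dilate_apply,
            dilate_apply, SchwartzMap.smulLeftCLM_apply_apply (hasTemperateGrowth_inner m),
            real_inner_smul_left]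
          simp only [smul_eq_mul, Complex.ofReal_mul]
          ring
        have h2 := hC a ha
        rw [h1, map_smul, norm_smul, Complex.norm_real, norm_of_nonneg ha0.le] at h2
        rw [TemperedDistribution.smulLeftCLM_apply_apply]
        refine le_of_mul_le_mul_left ?_ ha0
        calc _ ≤ C * (a : ℝ) ^ (s + 1) := h2
          _ = _ := by ring
      -- All products with linear forms vanish, so T is a multiple of the Dirac distribution, which
      -- `hdirac` excludes unless it is zero.
      obtain ⟨c, hc⟩ := (hsupp T hT).exists_eq_mul fun m χ => by
        have := congrArg (fun S : 𝓢'(Rn n, ℂ) => S χ) (h0 m)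
        exact this
      have hc0 := hdirac T hT c hc
      ext χ
      rw [hc, hc0, zero_mul]
      rfl
  obtain ⟨N, hN⟩ := exists_pow_mul_norm_dilate_le T
  refine main (N + 1) T hT fun q χ => ?_
  obtain ⟨C, hC⟩ := hN q χ
  refine ⟨C, fun a ha => ?_⟩
  have ha0 : (0 : ℝ) ≤ a := by linarith
  calc _ ≤ (a : ℝ) * (C * (a : ℝ) ^ N) := by gcongr; exact hC a ha
    _ = _ := by ring

end GASP

namespace GASP

open FourierTransform LineDeriv

/-! ### Uniqueness of the solution of a convolution equation -/

/-- On the Fourier side both expressions multiply the integrand by 2πi ⟨u, v⟩. -/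
theorem IsFourierOf.fderiv_reflConv {n : ℕ} {g m : Rn n → ℝ} (h : IsFourierOf g m)
    (φ : 𝓢(Rn n, ℂ)) (t v : Rn n) :
    fderiv ℝ (reflConv (toDist g) φ) t v = reflConv (toDist g) (∂_{v} φ) t := by
  set f : Rn n → ℂ := fun u => 𝓕 (φ : Rn n → ℂ) u * (m u : ℂ) with hf
  have hI : Integrable f := by
    have h1 := h.integrable_pow_mul φ 0
    simp only [pow_zero, one_mul] at h1
    refine (integrable_norm_iff ?_).1 h1
    exact (continuous_fourier_of_integrable φ.integrable).aestronglyMeasurable.mul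
      h.integrable.ofReal.aestronglyMeasurable
  have hI1 : Integrable fun u => ‖u‖ * ‖f u‖ := by
    simpa only [pow_one] using h.integrable_pow_mul φ 1
  have hd := Real.hasFDerivAt_fourier hI hI1 (-t)
  have hd2 : HasFDerivAt (reflConv (toDist g) φ)
      ((𝓕 (VectorFourier.fourierSMulRight (innerSL ℝ) f) (-t)).comp
        (-ContinuousLinearMap.id ℝ (Rn n))) t := by
    have he : reflConv (toDist g) φ = fun x => 𝓕 f (-x) := by
      rw [h.reflConv_eq]
      exact funext fun x => Real.fourierInv_eq_fourier_neg f x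
    rw [he]
    exact hd.comp t (hasFDerivAt_id t).neg
  rw [hd2.fderiv, h.reflConv_eq, Real.fourierInv_eq_fourier_neg]
  have hI2 : Integrable (VectorFourier.fourierSMulRight (innerSL ℝ) f) := by
    refine (hI1.const_mul (2 * π * ‖innerSL (E := Rn n) ℝ‖)).mono'
      (hI.aestronglyMeasurable.fourierSMulRight) (Eventually.of_forall fun u => ?_)
    have := VectorFourier.norm_fourierSMulRight_le (innerSL ℝ) f u
    linarith
  rw [ContinuousLinearMap.comp_apply, Real.fourier_continuousLinearMap_apply hI2]
  refine congrArg (fun F : Rn n → ℂ => 𝓕 F (-t)) (funext fun u => ?_)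
  rw [VectorFourier.fourierSMulRight_apply, ← SchwartzMap.fourier_coe,
    SchwartzMap.fourier_lineDerivOp_eq]
  have hg : (inner ℝ · v : Rn n → ℝ).HasTemperateGrowth := by fun_prop
  simp only [smul_apply, SchwartzMap.smulLeftCLM_apply_apply hg, hf]
  simp [innerSL_apply_apply ℝ, SchwartzMap.fourier_coe]
  ring

/-- `u (v̌ ∗ φ)` has vanishing integral along dilations, for all Schwartz functions `φ`. -/
def ConvolvesToZero {n : ℕ} (v u : 𝓢'(Rn n, ℂ)) : Prop :=
  ∀ φ χ : 𝓢(Rn n, ℂ), Tendsto (fun j => u (SchwartzMap.smulLeftCLM ℂ (reflConv v φ)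
    (dilate (invSucc j) χ))) atTop (𝓝 0)

theorem IsSConv.convolvesToZero_sub {n : ℕ} {u u' v w : 𝓢'(Rn n, ℂ)} (h : IsSConv u v w)
    (h' : IsSConv u' v w) : ConvolvesToZero v (u - u') := by
  intro φ χ
  have h1 : ∀ χ : 𝓢(Rn n, ℂ), χ 0 = 1 → Tendsto (fun j => (u - u')
      (SchwartzMap.smulLeftCLM ℂ (reflConv v φ) (dilate (invSucc j) χ))) atTop (𝓝 0) := by
    intro χ hχ
    have ha := (h φ).2 (fun j => dilate (invSucc j) χ)
      (fun k => ⟨_, seminorm_dilate_invSucc_le χ k⟩) (tendstoLocallyUniformly_dilate hχ)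
    have hb := (h' φ).2 (fun j => dilate (invSucc j) χ)
      (fun k => ⟨_, seminorm_dilate_invSucc_le χ k⟩) (tendstoLocallyUniformly_dilate hχ)
    have hab := ha.sub hb
    rw [sub_self] at hab
    exact hab
  obtain ⟨θ, -, hθ⟩ := exists_schwartz_bump n
  have hθ0 : θ 0 = 1 := hθ.self_of_nhds
  -- Both functions have value 1 at the origin, so linearity removes the normalization of χ.
  -- Arbitrary χ are needed later, since derivatives of χ are used as cutoffs.
  have h2 := (h1 (χ + (1 - χ 0) • θ) (by simp [hθ0])).sub ((h1 θ hθ0).const_smul (1 - χ 0))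
  rw [smul_zero, sub_zero] at h2
  refine h2.congr fun j => ?_
  simp only [map_add, map_smul, add_sub_cancel_right]

theorem ConvolvesToZero.smul {n : ℕ} {v u : 𝓢'(Rn n, ℂ)} (h : ConvolvesToZero v u) (c : ℂ) :
    ConvolvesToZero v (c • u) := by
  intro φ χ
  have := (h φ χ).const_smul c
  rw [smul_zero] at this
  exact this

theorem lineDerivOp_dilate {n : ℕ} (a : ℝˣ) (χ : 𝓢(Rn n, ℂ)) (v : Rn n) :
    ∂_{v} (dilate a χ) = ((a : ℝ) : ℂ) • dilate a (∂_{v} χ) := by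
  ext x
  rw [smul_apply, SchwartzMap.lineDerivOp_apply_eq_fderiv, dilate_apply,
    SchwartzMap.lineDerivOp_apply_eq_fderiv]
  have h1 : HasFDerivAt (dilate a χ) _ x :=
    (χ.differentiableAt (x := (a : ℝ) • x)).hasFDerivAt.comp x
      ((hasFDerivAt_id x).const_smul (a : ℝ))
  rw [h1.fderiv]
  simp

/-- By Leibniz' rule the derivative falls either on the dilated cutoff, gaining the factor 1 / (j +
1), or on the multiplier, where it replaces φ by a derivative of φ. Both terms tend to zero by the
hypothesis on u. -/
theorem IsFourierOf.convolvesToZero_lineDerivOp {n : ℕ} {g m : Rn n → ℝ} (h : IsFourierOf g m)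
    {u : 𝓢'(Rn n, ℂ)} (hu : ConvolvesToZero (toDist g) u) (v : Rn n) :
    ConvolvesToZero (toDist g) (∂_{v} u) := by
  intro φ χ
  have h1 : ∀ s : 𝓢(Rn n, ℂ),
      ∂_{v} (SchwartzMap.smulLeftCLM ℂ (reflConv (toDist g) φ) s) =
        SchwartzMap.smulLeftCLM ℂ (reflConv (toDist g) φ) (∂_{v} s) +
        SchwartzMap.smulLeftCLM ℂ (reflConv (toDist g) (∂_{v} φ)) s := fun s => by
    have hR := h.hasTemperateGrowth_reflConv φ
    ext x
    rw [add_apply, SchwartzMap.smulLeftCLM_apply_apply hR,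
      SchwartzMap.smulLeftCLM_apply_apply (h.hasTemperateGrowth_reflConv _),
      SchwartzMap.lineDerivOp_apply_eq_fderiv, SchwartzMap.lineDerivOp_apply_eq_fderiv,
      SchwartzMap.smulLeftCLM_apply hR]
    have h2 := ((hR.1.differentiable (by simp) x).hasFDerivAt).mul
      (s.differentiableAt (x := x)).hasFDerivAt
    have h3 : HasFDerivAt (fun x => reflConv (toDist g) φ x • s x) _ x := h2
    rw [h3.fderiv, ← h.fderiv_reflConv]
    simp [mul_comm]
  have h2 := (hu φ (∂_{v} χ))
  have h3 : Tendsto (fun j => ((invSucc j : ℝ) : ℂ)) atTop (𝓝 0) := by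
    rw [← Complex.ofReal_zero]
    exact (Complex.continuous_ofReal.tendsto 0).comp tendsto_invSucc
  have h4 := ((h3.mul h2).add (hu (∂_{v} φ) χ)).neg
  rw [mul_zero, add_zero, neg_zero] at h4
  refine h4.congr fun j => ?_
  rw [TemperedDistribution.lineDerivOp_apply_apply, h1, lineDerivOp_dilate, map_smul, map_neg,
    map_add, map_smul, smul_eq_mul]

theorem IsFourierOf.integrable_reflConv {n : ℕ} {g m : Rn n → ℝ} (h : IsFourierOf g m)
    (hg : Integrable g) (φ : 𝓢(Rn n, ℂ)) :
    Integrable (reflConv (toDist g) φ) ∧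
      ∫ t, reflConv (toDist g) φ t = (∫ x, φ x) * ∫ x, (g x : ℂ) := by
  have h1 : Integrable fun x : Rn n => (g (-x) : ℂ) := (hg.ofReal (𝕜 := ℂ)).comp_neg
  have h2 : reflConv (toDist g) φ =
      (φ ⋆[ContinuousLinearMap.mul ℂ ℂ, volume] fun x => (g (-x) : ℂ)) := by
    funext t
    rw [reflConv_toDist_eq_integral_sub h.memLp, convolution_def]
    simp only [ContinuousLinearMap.mul_apply', neg_sub]
  rw [h2]
  refine ⟨φ.integrable.integrable_convolution _ h1, ?_⟩
  rw [integral_convolution _ φ.integrable h1, ContinuousLinearMap.mul_apply',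
    integral_neg_eq_self (fun x => (g x : ℂ))]

theorem exists_schwartz_integral_ne_zero (n : ℕ) : ∃ φ : 𝓢(Rn n, ℂ), ∫ x, φ x ≠ 0 := by
  let b : ContDiffBump (0 : Rn n) := ⟨1, 2, one_pos, one_lt_two⟩
  have h1 : HasCompactSupport (fun x => (b x : ℂ)) :=
    b.hasCompactSupport.comp_left (g := fun r : ℝ => (r : ℂ)) Complex.ofReal_zero
  have h2 : ContDiff ℝ ∞ (fun x => (b x : ℂ)) := Complex.ofRealCLM.contDiff.comp b.contDiff
  refine ⟨h1.toSchwartzMap h2, ?_⟩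
  change ∫ x, ((b x : ℝ) : ℂ) ≠ 0
  rw [integral_complex_ofReal, Complex.ofReal_ne_zero]
  exact b.integral_pos.ne'

/-- The transform of c δ is the constant c, so the limit along cutoffs is c times the integral of φ
times that of g. It is also zero, and φ may be chosen with nonzero integral. -/
theorem IsFourierOf.eq_zero_of_dirac {n : ℕ} {g m : Rn n → ℝ} (h : IsFourierOf g m)
    (hg : Integrable g) (hg0 : ∫ x, (g x : ℂ) ≠ 0) {T : 𝓢'(Rn n, ℂ)}
    (hT : ConvolvesToZero (toDist g) (𝓕 T)) {c : ℂ} (hc : ∀ χ : 𝓢(Rn n, ℂ), T χ = c * χ 0) :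
    c = 0 := by
  obtain ⟨φ, hφ⟩ := exists_schwartz_integral_ne_zero n
  obtain ⟨θ, -, hθ⟩ := exists_schwartz_bump n
  have hθ0 : θ 0 = 1 := hθ.self_of_nhds
  set R := reflConv (toDist g) φ with hR
  have hRt : R.HasTemperateGrowth := h.hasTemperateGrowth_reflConv φ
  obtain ⟨hRI, hRi⟩ := h.integrable_reflConv hg φ
  have h1 : ∀ s : 𝓢(Rn n, ℂ), 𝓕 T (SchwartzMap.smulLeftCLM ℂ R s) = c * ∫ x, R x * s x :=
    fun s => by
      rw [TemperedDistribution.fourier_apply, hc, SchwartzMap.fourier_coe, Real.fourier_eq]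
      simp [SchwartzMap.smulLeftCLM_apply_apply hRt]
  have h2 := hT φ θ
  simp only [← hR, h1] at h2
  have h3 : Tendsto (fun j => ∫ x, R x * dilate (invSucc j) θ x) atTop (𝓝 (∫ x, R x)) := by
    refine tendsto_integral_of_dominated_convergence
      (fun x => ‖R x‖ * SchwartzMap.seminorm ℂ 0 0 θ)
      (fun j => hRI.aestronglyMeasurable.mul (dilate (invSucc j) θ).continuous.aestronglyMeasurable)
      (hRI.norm.mul_const _) (fun j => Eventually.of_forall fun x => ?_)
      (Eventually.of_forall fun x => ?_)
    · rw [norm_mul]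
      gcongr
      exact SchwartzMap.norm_le_seminorm ℂ θ _
    · have := (tendsto_apply_of_tendstoLocallyUniformly
        (tendstoLocallyUniformly_dilate hθ0 0) x).const_mul (R x)
      rwa [mul_one] at this
  have h4 := tendsto_nhds_unique h2 (h3.const_mul c)
  rw [hRi] at h4
  exact (mul_eq_zero.1 h4.symm).resolve_right (mul_ne_zero hφ hg0)

/-- For χ vanishing near 0, taking φ with transform χ / m makes the multiplier equal to the inverse
transform of χ. The cutoffs then converge in the Schwartz space, and the limit is T χ. -/
theorem IsFourierOf.supportedAtZero {n : ℕ} {g m : Rn n → ℝ} (h : IsFourierOf g m)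
    (hm : ∀ v ≠ 0, ContDiffAt ℝ ∞ m v) (hm0 : ∀ v ≠ 0, m v ≠ 0) {T : 𝓢'(Rn n, ℂ)}
    (hT : ConvolvesToZero (toDist g) (𝓕 T)) : SupportedAtZero T := by
  obtain ⟨θ, hθc, hθ⟩ := exists_schwartz_bump n
  have hθ0 : θ 0 = 1 := hθ.self_of_nhds
  -- Compact support comes first, because nothing controls 1 / m at infinity; dilated cutoffs remove
  -- this restriction at the end.
  have hcomp : ∀ χ : 𝓢(Rn n, ℂ), χ =ᶠ[𝓝 0] 0 → HasCompactSupport χ → T χ = 0 := by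
    intro χ hχ hχc
    have hs : ContDiff ℝ ∞ fun v => χ v * ((m v)⁻¹ : ℂ) := by
      refine contDiff_iff_contDiffAt.2 fun v => ?_
      by_cases hv : v = 0
      · rw [hv]
        refine (contDiffAt_const (c := (0 : ℂ))).congr_of_eventuallyEq ?_
        filter_upwards [hχ] with x hx
        rw [hx]
        simp
      · refine (χ.smooth ⊤).contDiffAt.mul (ContDiffAt.inv ?_ ?_)
        · exact Complex.ofRealCLM.contDiff.contDiffAt.comp v (hm v hv)
        · exact Complex.ofReal_ne_zero.2 (hm0 v hv)
    set ρ : 𝓢(Rn n, ℂ) := hχc.mul_right.toSchwartzMap hs with hρ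
    have hρm : ∀ v, ρ v * (m v : ℂ) = χ v := fun v => by
      change χ v * ((m v)⁻¹ : ℂ) * (m v : ℂ) = χ v
      by_cases hv : v = 0
      · rw [hv, hχ.self_of_nhds]
        simp
      · rw [inv_mul_cancel_right₀ (Complex.ofReal_ne_zero.2 (hm0 v hv))]
    have hR : reflConv (toDist g) (𝓕⁻ ρ) = (𝓕⁻ χ : 𝓢(Rn n, ℂ)) := by
      rw [h.reflConv_eq, ← SchwartzMap.fourier_coe, fourier_fourierInv_eq,
        SchwartzMap.fourierInv_coe]
      congr 1
      funext v
      exact hρm v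
    have h1 := hT (𝓕⁻ ρ) θ
    rw [hR] at h1
    have h2 : ∀ j, SchwartzMap.smulLeftCLM ℂ (𝓕⁻ χ : 𝓢(Rn n, ℂ)) (dilate (invSucc j) θ) =
        SchwartzMap.smulLeftCLM ℂ (dilate (invSucc j) θ) (𝓕⁻ χ) := fun j => by
      ext x
      rw [SchwartzMap.smulLeftCLM_apply_apply (SchwartzMap.hasTemperateGrowth _),
        SchwartzMap.smulLeftCLM_apply_apply (SchwartzMap.hasTemperateGrowth _), smul_eq_mul,
        smul_eq_mul, mul_comm]
    simp only [h2] at h1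
    have h3 := ((map_continuous (𝓕 T)).tendsto _).comp
      (tendsto_smulLeftCLM_dilate hθ0 (𝓕⁻ χ : 𝓢(Rn n, ℂ)))
    have h4 := tendsto_nhds_unique h3 h1
    rwa [TemperedDistribution.fourier_apply, fourier_fourierInv_eq] at h4
  intro χ hχ
  have h3 := ((map_continuous T).tendsto _).comp (tendsto_smulLeftCLM_dilate hθ0 χ)
  refine tendsto_nhds_unique h3 (tendsto_const_nhds.congr fun j => (hcomp _ ?_ ?_).symm)
  · filter_upwards [hχ] with x hx
    rw [SchwartzMap.smulLeftCLM_apply_apply (SchwartzMap.hasTemperateGrowth _), hx]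
    simp
  · have h5 : HasCompactSupport (dilate (invSucc j) θ) :=
      hθc.comp_homeomorph (Homeomorph.smul (invSucc j))
    rw [SchwartzMap.smulLeftCLM_apply (SchwartzMap.hasTemperateGrowth _)]
    exact h5.smul_right

/-- A convolution equation `u ∗ g = w` has at most one solution if the Fourier transform of the
integrable function `g` has no zeros and is smooth away from the origin. -/
theorem IsFourierOf.isSConv_unique {n : ℕ} {g m : Rn n → ℝ} (h : IsFourierOf g m)
    (hm : ∀ v ≠ 0, ContDiffAt ℝ ∞ m v) (hm0 : ∀ v ≠ 0, m v ≠ 0)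
    (hg : Integrable g) (hg0 : ∫ x, (g x : ℂ) ≠ 0) {u u' w : 𝓢'(Rn n, ℂ)}
    (hu : IsSConv u (toDist g) w) (hu' : IsSConv u' (toDist g) w) : u = u' := by
  have h0 : (𝓕⁻ (u - u') : 𝓢'(Rn n, ℂ)) = 0 := by
    refine eq_zero_of_supportedAtZero (P := fun T => ConvolvesToZero (toDist g) (𝓕 T))
      (fun T v hT => ?_) (fun T hT => h.supportedAtZero hm hm0 hT)
      (fun T hT c hc => h.eq_zero_of_dirac hg hg0 hT hc) ?_
    -- Multiplying T by a linear form differentiates its transform, up to the factor -2πi that is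
    -- divided out here.
    · have h1 := (h.convolvesToZero_lineDerivOp hT v).smul (-(2 * π * Complex.I))⁻¹
      rw [TemperedDistribution.lineDerivOp_fourier_eq, fourier_smul, inv_smul_smul₀] at h1
      · exact h1
      · simp [pi_ne_zero]
    · rw [fourier_fourierInv_eq]
      exact hu.convolvesToZero_sub hu'
  have h1 := congrArg (fun T : 𝓢'(Rn n, ℂ) => 𝓕 T) h0
  simp only [fourier_fourierInv_eq] at h1
  exact sub_eq_zero.1 h1

end GASP

/-! ### The convolution equation for the Poisson kernels, and the theorem -/

namespace GASP

/-- The profile is composed with the norm, which is smooth off the origin; this is all that the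
uniqueness theorem requires. -/
theorem isSConv_poissonKernel_iff (n : ℕ) {α a b : ℝ} (hα : -1 < α) (ha : 0 < a) (hab : a < b)
    (u : 𝓢'(Rn n, ℂ)) :
    IsSConv u (toDist (poissonKernel n α a)) (toDist (poissonKernel n α b)) ↔
      u = toDist (quotKernel n α a b) := by
  have h := isFourierOf_poissonKernel n hα ha
  have hq : IsSConv (toDist (quotKernel n α a b)) (toDist (poissonKernel n α a))
      (toDist (poissonKernel n α b)) :=
    isSConv_toDist (memLp_quotKernel n hα ha hab) (contDiff_quotKernel n hα ha hab).continuous h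
      (memLp_poissonKernel n hα (ha.trans hab))
      (quotKernel_convolution_poissonKernel n hα ha hab).symm
  refine ⟨fun hu => h.isSConv_unique (fun v hv => ?_)
    (fun v _ => (poissonProfile_norm_pos n hα ha v).ne') (integrable_poissonKernel n hα ha)
    ?_ hu hq, fun hu => hu ▸ hq⟩
  · have hpos : 0 < a * (π * ‖v‖) := by have := norm_pos_iff.2 hv; positivity
    exact ((contDiffOn_poissonProfile _).contDiffAt (Ioi_mem_nhds hpos)).comp v
      (contDiffAt_const.mul (contDiffAt_const.mul (contDiffAt_norm ℝ hv)))
  -- The integral of the kernel is its Fourier transform at zero.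
  · have h0 := fourierInt_poissonKernel_ne_zero n hα ha 0
    simpa [fourierInt] using h0

end GASP

theorem proposition4p5 (n : ℕ) (hn : 1 ≤ n) (α : ℝ) (hα : -1 < α) :
    ∃ 𝒢 : ℝ → ℝ → GASP.Rn n → ℝ,
      (∀ η y : ℝ, 0 < η → η < y →
        -- `𝒢 η y` is a smooth function in `L²`
        ContDiff ℝ ∞ (𝒢 η y) ∧ MemLp (𝒢 η y) 2 volume ∧
        -- it solves the equation, with a convolution that converges absolutely at every point
        ConvolutionExists (𝒢 η y) (GASP.poissonKernel n α η) (ContinuousLinearMap.mul ℝ ℝ) volume ∧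
        (𝒢 η y ⋆[ContinuousLinearMap.mul ℝ ℝ, volume] GASP.poissonKernel n α η)
          = GASP.poissonKernel n α y ∧
        -- it is the unique solution among all tempered distributions
        (∀ u : 𝓢'(GASP.Rn n, ℂ),
          GASP.IsSConv u (GASP.toDist (GASP.poissonKernel n α η))
            (GASP.toDist (GASP.poissonKernel n α y)) ↔ u = GASP.toDist (𝒢 η y)) ∧
        -- the integral representation
        (∀ x : GASP.Rn n, x ≠ 0 →
          IntegrableOn (fun s : ℝ =>
            GASP.besselK ((α + 1) / 2) (y * s) / GASP.besselK ((α + 1) / 2) (η * s) *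
              s ^ ((n : ℝ) / 2) * GASP.besselJ (((n : ℝ) - 2) / 2) (‖x‖ * s)) (Set.Ioi 0) volume ∧
          𝒢 η y x = ‖x‖ ^ ((2 - (n : ℝ)) / 2) / (2 * π) ^ ((n : ℝ) / 2) *
            (y / η) ^ ((α + 1) / 2) *
            ∫ s in Set.Ioi (0 : ℝ),
              GASP.besselK ((α + 1) / 2) (y * s) / GASP.besselK ((α + 1) / 2) (η * s) *
                s ^ ((n : ℝ) / 2) * GASP.besselJ (((n : ℝ) - 2) / 2) (‖x‖ * s)) ∧
        -- the Fourier transform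
        (∀ ξ : GASP.Rn n,
          GASP.fourierInt (fun x => (GASP.poissonKernel n α η x : ℂ)) ξ ≠ 0) ∧
        GASP.HasFourierL2 (fun x => (𝒢 η y x : ℂ)) (fun ξ =>
          GASP.fourierInt (fun x => (GASP.poissonKernel n α y x : ℂ)) ξ /
            GASP.fourierInt (fun x => (GASP.poissonKernel n α η x : ℂ)) ξ) ∧
        (∀ ξ : GASP.Rn n, ξ ≠ 0 →
          GASP.besselK ((α + 1) / 2) (η * ‖ξ‖) ≠ 0 ∧
          GASP.fourierInt (fun x => (GASP.poissonKernel n α y x : ℂ)) ξ /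
              GASP.fourierInt (fun x => (GASP.poissonKernel n α η x : ℂ)) ξ =
            (((y / η) ^ ((α + 1) / 2) * (GASP.besselK ((α + 1) / 2) (y * ‖ξ‖) /
              GASP.besselK ((α + 1) / 2) (η * ‖ξ‖)) : ℝ) : ℂ))) ∧
      -- the semigroup property
      (∀ η₁ η₂ y : ℝ, 0 < η₁ → η₁ < η₂ → η₂ < y →
        ConvolutionExists (𝒢 η₂ y) (𝒢 η₁ η₂) (ContinuousLinearMap.mul ℝ ℝ) volume ∧
        𝒢 η₁ y = (𝒢 η₂ y ⋆[ContinuousLinearMap.mul ℝ ℝ, volume] 𝒢 η₁ η₂) ∧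
        GASP.IsSConv (GASP.toDist (𝒢 η₂ y)) (GASP.toDist (𝒢 η₁ η₂))
          (GASP.toDist (𝒢 η₁ y))) := by
  refine ⟨fun η y => GASP.quotKernel n α η y, fun η y hη hy => ?_, fun η₁ η₂ y h₁ h₁₂ h₂ => ?_⟩
  · have hy0 : 0 < y := hη.trans hy
    exact ⟨GASP.contDiff_quotKernel n hα hη hy, GASP.memLp_quotKernel n hα hη hy,
      GASP.convolutionExists_of_memLp (GASP.memLp_quotKernel n hα hη hy)
        (GASP.memLp_poissonKernel n hα hη),
      GASP.quotKernel_convolution_poissonKernel n hα hη hy,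
      GASP.isSConv_poissonKernel_iff n hα hη hy,
      fun x hx => GASP.quotKernel_eq_integral hn hα hη hy hx,
      GASP.fourierInt_poissonKernel_ne_zero n hα hη,
      GASP.hasFourierL2_quotKernel n hα hη hy,
      fun ξ hξ => ⟨(GASP.besselK_pos _ (mul_pos hη (norm_pos_iff.2 hξ))).ne',
        GASP.fourierInt_div_eq_besselK n hα hη hy0 hξ⟩⟩
  · have h₂0 : 0 < η₂ := h₁.trans h₁₂
    have hm := GASP.memLp_quotKernel n hα h₂0 h₂
    have he := GASP.quotKernel_convolution_quotKernel n hα h₁ h₁₂ h₂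
    exact ⟨GASP.convolutionExists_of_memLp hm (GASP.memLp_quotKernel n hα h₁ h₁₂), he,
      GASP.isSConv_toDist hm (GASP.contDiff_quotKernel n hα h₂0 h₂).continuous
        (GASP.isFourierOf_quotKernel n hα h₁ h₁₂)
        (GASP.memLp_quotKernel n hα h₁ (h₁₂.trans h₂)) he⟩
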